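/- Let $X$ be a countable set, let $m$ be a measure on all subsets of $X$ with $0<m(x):=m(\{x\})<\infty$ for all $x\in X$, and let $(b,c)$ be a connected graph over $(X,m)$: $b\colon X\times X\to[0,\infty)$ is symmetric with zero diagonal and $\sum_y b(x,y)<\infty$ for all $x$, $c\colon X\to[0,\infty)$, and any two points of $X$ are joined by a finite path along pairs with $b>0$. Let $\mathcal L f(x)=\frac1{m(x)}\sum_y b(x,y)(f(x)-f(y))+\frac{c(x)}{m(x)}f(x)$; a function $u$ with $\sum_y b(x,y)|u(y)|<\infty$ for all $x$ is $1$-harmonic if $\mathcal Lu+u=0$. Forms are symmetric positive forms $Q$ on real Hilbert spaces, with domain $D(Q)$, identified with their quadratic functionals with $Q(f)=\infty$ off $D(Q)$; $Q\le Q'$ is meant pointwise, $Q_1(f)=Q(f)+\|f\|^2$, and $Q$ is closed if $D(Q)$ is complete for the norm $Q_1^{1/2}$. A form on an $L^2$-space is Markovian if $Q(C\circ f)\le Q(f)$ for all $f\in L^2$ and all $C\colon\mathbb R\to\mathbb R$ with $C(0)=0$ and $|C(s)-C(t)|\le|s-t|$. A Dirichlet form in the wide sense is a closed Markovian form; it is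 a Dirichlet form if it is also densely defined. The form $Q^{(N)}$ on $\ell^2(X,m)$ is $Q^{(N)}(f)=\frac12\sum_{x,y}b(x,y)(f(x)-f(y))^2+\sum_xc(x)f(x)^2$, with domain the $f\in\ell^2(X,m)$ for which this is finite, and $Q^{(D)}$ is its restriction to the closure of the finitely supported functions with respect to $(Q^{(N)}_1)^{1/2}$. Every $f\in D(Q^{(N)})$ has a unique Royden decomposition $f=f_0+f_h$ with $f_0\in D(Q^{(D)})$ and $1$-harmonic $f_h\in D(Q^{(N)})$. Let $\hat X$ be the compactification of $X$ (compact Hausdorff, $X$ dense with open points) to which all functions in $D(Q^{(N)})\cap\ell^\infty(X)$ extend continuously, the extensions separating the points of $\hat X$; it is unique up to homeomorphism. The $1$-harmonic boundary $\partial X$ is the set of points of $\hat X\setminus X$ at which the extensions of all functions in $D(Q^{(D)})\cap\ell^\infty(X)$ vanish. Every $f\in D(Q^{(N)})$ extends uniquely to a continuous function $\hat X\to[-\infty,\infty]$; let $\gamma f$ be the restriction of this extension to $\partial X$. Fix $o\in X$ and let $\mu$ be the $1$-harmonic measure of $o$, i.e. the Radon measure on $\partial X$ of mass at most $1$ with $h(o)=\int_{\partial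 X}\gamma f\,d\mu$ whenever $f\in D(Q^{(N)})\cap\ell^\infty(X)$ and $h\in D(Q^{(N)})$ is $1$-harmonic with $\gamma h=\gamma f$, and with $\mu(\{z\})=0$ if $z\in\partial X$ is a point at which all functions in $D(Q^{(N)})\cap\ell^\infty(X)$ vanish. Write $L^2(\partial X)=L^2(\partial X,\mu)$ and regard $\gamma$ as a map $D(Q^{(N)})\to L^2(\partial X)$. For $\varphi\in\gamma D(Q^{(N)})$ let $H\varphi\in D(Q^{(N)})$ be the $1$-harmonic function with $\gamma(H\varphi)=\varphi$. Let $\mathfrak D(b,c)$ be the set of Dirichlet forms $Q$ on $\ell^2(X,m)$ with $Q^{(N)}\le Q\le Q^{(D)}$. For $Q\in\mathfrak D(b,c)$ let $\operatorname{Tr}Q$ be the form on $L^2(\partial X)$ with domain $\gamma D(Q)$ and $\operatorname{Tr}Q(\varphi)=Q_1(H\varphi)$, and let $q^{DN}=\operatorname{Tr}Q^{(N)}$. Let $\operatorname{Tr}\mathfrak D(b,c)$ be the set of Dirichlet forms in the wide sense $q$ on $L^2(\partial X)$ such that $q\ge q^{DN}$ and $q-q^{DN}$, with domain $D(q)$,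 is Markovian. Theorem. For a closed form $Q$ on $\ell^2(X,m)$ the following are equivalent. (i) $Q\in\mathfrak D(b,c)$. (ii) There is $q\in\operatorname{Tr}\mathfrak D(b,c)$ such that $D(Q)=\{f\in D(Q^{(N)}):\gamma f\in D(q)\}$ and, for all $f\in D(Q)$ with Royden decomposition $f=f_0+f_h$, $$Q(f)=Q^{(N)}(f)+q(\gamma f)-q^{DN}(\gamma f)\quad\text{and}\quad Q_1(f)=Q^{(D)}_1(f_0)+q(\gamma f).$$ If $Q\in\mathfrak D(b,c)$, then in (ii) one can choose $q=\operatorname{Tr}Q$, and the map $\mathfrak D(b,c)\to\operatorname{Tr}\mathfrak D(b,c)$, $Q\mapsto\operatorname{Tr}Q$, is a bijection. -/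

import Mathlib

open MeasureTheory Filter Topology
open scoped ENNReal

noncomputable section

namespace GraphForms

/-! ### Forms on a real Hilbert space -/

section AbstractForms

variable {H : Type*} [NormedAddCommGroup H] [InnerProductSpace ℝ H]

/-- A symmetric positive form: a subspace together with a symmetric, positive semidefinite
bilinear map on it. -/
structure SymmPosForm (H : Type*) [NormedAddCommGroup H] [InnerProductSpace ℝ H] where
  domain : Submodule ℝ H
  form : domain →ₗ[ℝ] domain →ₗ[ℝ] ℝ
  symm : ∀ f g, form f g = form g f
  nonneg : ∀ f, 0 ≤ form f f

open Classical in
/-- The `[0,∞]`-valued functional of a form: `S(f,f)` on the domain and `∞` off the domain.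
It determines the form. -/
def SymmPosForm.value (S : SymmPosForm H) (f : H) : ℝ≥0∞ :=
  if h : f ∈ S.domain then ENNReal.ofReal (S.form ⟨f, h⟩ ⟨f, h⟩) else ⊤

/-- From here on forms are identified with their `[0,∞]`-valued functionals; the domain of `Q` is
`{f | Q f < ⊤}` and `Q ≤ Q'` is the pointwise order. -/
def IsForm (Q : H → ℝ≥0∞) : Prop := ∃ S : SymmPosForm H, Q = S.value

/-- `Q₁(f) = Q(f) + ‖f‖²`, the square of the form norm. -/
def one (Q : H → ℝ≥0∞) (f : H) : ℝ≥0∞ := Q f + ENNReal.ofReal (‖f‖ ^ 2)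

/-- A form is closed if its domain is complete with respect to the form norm. -/
def IsClosedForm (Q : H → ℝ≥0∞) : Prop :=
  IsForm Q ∧
    ∀ u : ℕ → H, (∀ n, Q (u n) < ⊤) →
      (∀ ε : ℝ≥0∞, 0 < ε → ∃ N, ∀ n ≥ N, ∀ k ≥ N, one Q (u n - u k) < ε) →
      ∃ f, Q f < ⊤ ∧ Tendsto (fun n => one Q (u n - f)) atTop (𝓝 0)

end AbstractForms

/-! ### Dirichlet forms on an `L²`-space -/

section DirichletForms

variable {Ω : Type*} [MeasurableSpace Ω] {μ : Measure Ω}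

/-- Compatibility with all normal contractions `C`, that is `C 0 = 0` and
`|C s - C t| ≤ |s - t|`. -/
def IsMarkovian (Q : Lp ℝ 2 μ → ℝ≥0∞) : Prop :=
  ∀ (C : ℝ → ℝ) (hC : LipschitzWith 1 C) (h0 : C 0 = 0) (f : Lp ℝ 2 μ), Q (hC.compLp h0 f) ≤ Q f

/-- Dirichlet form in the wide sense: closed and Markovian, not necessarily densely defined. -/
def IsWideDirichletForm (Q : Lp ℝ 2 μ → ℝ≥0∞) : Prop := IsClosedForm Q ∧ IsMarkovian Q

def IsDirichletForm (Q : Lp ℝ 2 μ → ℝ≥0∞) : Prop :=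
  IsWideDirichletForm Q ∧ Dense {f | Q f < ⊤}

open Classical in
/-- The difference `q - q'` on the domain of `q` (used for `q' ≤ q`). -/
def diffOnDomain (q q' : Lp ℝ 2 μ → ℝ≥0∞) (φ : Lp ℝ 2 μ) : ℝ≥0∞ :=
  if q φ < ⊤ then q φ - q' φ else ⊤

end DirichletForms

/-! ### Graphs -/

/-- A graph `(b,c)` over `X`. -/
structure WGraph (X : Type*) where
  b : X → X → ℝ
  c : X → ℝ
  b_nonneg : ∀ x y, 0 ≤ b x y
  b_symm : ∀ x y, b x y = b y x
  b_diag : ∀ x, b x x = 0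
  b_summable : ∀ x, Summable (b x)
  c_nonneg : ∀ x, 0 ≤ c x

namespace WGraph

variable {X : Type*} (G : WGraph X)

/-- Any two vertices are joined by a finite path of edges. -/
def Connected : Prop := ∀ x y, Relation.ReflTransGen (fun u v => 0 < G.b u v) x y

/-- The energy `½ ∑ b(x,y)(f(x)-f(y))² + ∑ c(x) f(x)²` in `[0,∞]`. -/
def energy (f : X → ℝ) : ℝ≥0∞ :=
  2⁻¹ * (∑' x, ∑' y, ENNReal.ofReal (G.b x y * (f x - f y) ^ 2)) +
    ∑' x, ENNReal.ofReal (G.c x * f x ^ 2)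

variable [MeasurableSpace X] (m : Measure X)

/-- The formal Laplacian. -/
def laplacian (f : X → ℝ) (x : X) : ℝ :=
  1 / m.real {x} * (∑' y, G.b x y * (f x - f y)) + G.c x / m.real {x} * f x

/-- `u` lies in the domain of the formal Laplacian and `(𝓛 + 1) u = 0`. -/
def IsOneHarmonic (u : X → ℝ) : Prop :=
  (∀ x, Summable fun y => G.b x y * |u y|) ∧ ∀ x, G.laplacian m u x + u x = 0

/-- The Neumann form `Q^(N)` on `ℓ²(X,m)`. In the theorem every point has positive mass, so an
element of `Lp ℝ 2 m` is the same as a square summable function on `X`. -/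
def neumann (f : Lp ℝ 2 m) : ℝ≥0∞ := G.energy f

/-- `f` lies in the form norm closure of the finitely supported functions in `D(Q^(N))`. -/
def InDirichletDomain (f : Lp ℝ 2 m) : Prop :=
  G.neumann m f < ⊤ ∧ ∀ ε : ℝ≥0∞, 0 < ε →
    ∃ g : Lp ℝ 2 m, (Function.support (g : X → ℝ)).Finite ∧ one (G.neumann m) (f - g) < ε

open Classical in
/-- The Dirichlet form `Q^(D)`: the restriction of `Q^(N)` to the closure of `C_c(X)`. -/
def dirichlet (f : Lp ℝ 2 m) : ℝ≥0∞ := if G.InDirichletDomain m f then G.neumann m f else ⊤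

/-- `f = f₀ + f_h` with `f₀ ∈ D(Q^(D))` and `1`-harmonic `f_h ∈ D(Q^(N))`. -/
def IsRoydenDecomposition (f f₀ fh : Lp ℝ 2 m) : Prop :=
  f = f₀ + fh ∧ G.dirichlet m f₀ < ⊤ ∧ G.neumann m fh < ⊤ ∧ G.IsOneHarmonic m fh

/-! ### The compactification and the `1`-harmonic boundary -/

/-- `D(Q^(N)) ∩ ℓ^∞(X)`. -/
def BddDomain : Type _ :=
  {f : Lp ℝ 2 m // G.neumann m f < ⊤ ∧ ∃ M : ℝ, ∀ x, |f x| ≤ M}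

/-- The point evaluations `x ↦ (f(x))_f`, where `f` runs through `D(Q^(N)) ∩ ℓ^∞(X)`. -/
def evalMap (x : X) : G.BddDomain m → ℝ := fun f => f.1 x

/-- The compactification `X̂`: the closure of the image of `X` under the point evaluations in the
product space `ℝ^(D(Q^(N)) ∩ ℓ^∞(X))`. The continuous extension of `f ∈ D(Q^(N)) ∩ ℓ^∞(X)` is the
coordinate `z ↦ z f`, and these coordinates separate the points. -/
def Compactification : Type _ :=
  {z : G.BddDomain m → ℝ // z ∈ closure (Set.range (G.evalMap m))}

instance : TopologicalSpace (G.Compactification m) :=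
  instTopologicalSpaceSubtype (X := G.BddDomain m → ℝ)

/-- The embedding of `X` into `X̂`. -/
def embed (x : X) : G.Compactification m := ⟨G.evalMap m x, subset_closure ⟨x, rfl⟩⟩

/-- The `1`-harmonic boundary `∂X`: the points of `X̂ \ X` at which (the extensions of) all
functions of `D(Q^(D)) ∩ ℓ^∞(X)` vanish. -/
def Boundary : Type _ :=
  {z : G.Compactification m //
    z ∉ Set.range (G.embed m) ∧ ∀ f : G.BddDomain m, G.dirichlet m f.1 < ⊤ → z.1 f = 0}

instance : TopologicalSpace (G.Boundary m) :=
  instTopologicalSpaceSubtype (X := G.Compactification m)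

/-- The Borel `σ`-algebra of `∂X`. -/
instance : MeasurableSpace (G.Boundary m) := borel _

instance : BorelSpace (G.Boundary m) := ⟨rfl⟩

/-- The preliminary trace `γ₀ f = f|_∂X` of `f ∈ D(Q^(N)) ∩ ℓ^∞(X)`. -/
def preTrace (f : G.BddDomain m) (z : G.Boundary m) : ℝ := z.1.1 f

/-- The value at `z ∈ ∂X` of the continuous extension `X̂ → [-∞,∞]` of a function on `X`, that is
the limit of `f(x)` as `x ∈ X` tends to `z` in `X̂`. -/
def boundaryValue (f : X → ℝ) (z : G.Boundary m) : EReal :=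
  limUnder (comap (G.embed m) (𝓝 z.1)) fun x => (f x : EReal)

/-! ### Harmonic measures and traces -/

/-- `μ` is the `1`-harmonic measure of the vertex `o`: a Radon measure of mass at most one with
`Hφ(o) = ∫ φ dμ` for all `φ = γ₀ f`, where `Hφ ∈ D(Q^(N))` is the `1`-harmonic function with
boundary values `φ`, and without mass at the point of `∂X` at which all functions in
`D(Q^(N)) ∩ ℓ^∞(X)` vanish, should there be such a point. -/
structure IsHarmonicMeasure (o : X) (μ : Measure (G.Boundary m)) : Prop where
  regular : μ.Regular
  mass_le : μ Set.univ ≤ 1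
  integral_eq : ∀ (f : G.BddDomain m) (h : Lp ℝ 2 m), G.neumann m h < ⊤ → G.IsOneHarmonic m h →
    (∀ z, G.boundaryValue m h z = (G.preTrace m f z : EReal)) → h o = ∫ z, G.preTrace m f z ∂μ
  null_infinity : ∀ z : G.Boundary m, (∀ f : G.BddDomain m, G.preTrace m f z = 0) → μ {z} = 0

open Classical in
/-- The `1`-harmonic measure of `o` (by default zero if there were none). -/
def harmonicMeasure (o : X) : Measure (G.Boundary m) :=
  if h : ∃ μ, G.IsHarmonicMeasure m o μ then h.choose else 0

/-- `L²(∂X)`, taken with respect to the `1`-harmonic measure of `o`. -/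
abbrev L2Boundary (o : X) : Type _ := Lp ℝ 2 (G.harmonicMeasure m o)

open Classical in
/-- The trace map `γ : D(Q^(N)) → L²(∂X)`: the class of the boundary values of `f` (by default zero
if the boundary values were not almost everywhere finite and square integrable). -/
def trace (o : X) (f : Lp ℝ 2 m) : G.L2Boundary m o :=
  if h : ∃ φ : G.L2Boundary m o,
      ∀ᵐ z ∂(G.harmonicMeasure m o), G.boundaryValue m f z = (φ z : EReal)
  then h.choose else 0

open Classical in
/-- The `1`-harmonic extension `Hφ`: the function in `D(Q^(N))` with `(𝓛 + 1) Hφ = 0` and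
`γ(Hφ) = φ` (by default zero if there were none). -/
def harmonicExtension (o : X) (φ : G.L2Boundary m o) : Lp ℝ 2 m :=
  if h : ∃ u : Lp ℝ 2 m, G.neumann m u < ⊤ ∧ G.IsOneHarmonic m u ∧ G.trace m o u = φ
  then h.choose else 0

open Classical in
/-- The trace form `Tr Q` on `L²(∂X)`: its domain is `γ D(Q)`, and `Tr Q(φ) = Q₁(Hφ)` there. -/
def traceForm (o : X) (Q : Lp ℝ 2 m → ℝ≥0∞) (φ : G.L2Boundary m o) : ℝ≥0∞ :=
  if ∃ f, Q f < ⊤ ∧ G.trace m o f = φ then one Q (G.harmonicExtension m o φ) else ⊤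

/-- The Dirichlet-to-Neumann form `q^{DN} = Tr Q^(N)`. -/
def dirichletToNeumann (o : X) : G.L2Boundary m o → ℝ≥0∞ := G.traceForm m o (G.neumann m)

/-- `𝔇(b,c)`: the Dirichlet forms `Q` on `ℓ²(X,m)` with `Q^(N) ≤ Q ≤ Q^(D)`. -/
def formClass : Set (Lp ℝ 2 m → ℝ≥0∞) :=
  {Q | IsDirichletForm Q ∧ G.neumann m ≤ Q ∧ Q ≤ G.dirichlet m}

/-- `Tr 𝔇(b,c)`: the Dirichlet forms in the wide sense `q` on `L²(∂X)` with `q ≥ q^{DN}` for which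
`q - q^{DN}`, with domain `D(q)`, is Markovian. -/
def traceClass (o : X) : Set (G.L2Boundary m o → ℝ≥0∞) :=
  {q | IsWideDirichletForm q ∧ G.dirichletToNeumann m o ≤ q ∧
    IsMarkovian (diffOnDomain q (G.dirichletToNeumann m o))}

/-- `Q` is represented by the form `q` on the boundary: `D(Q) = {f ∈ D(Q^(N)) | γf ∈ D(q)}`, and
for `f ∈ D(Q)` with Royden decomposition `f = f₀ + f_h`,
`Q(f) = Q^(N)(f) + q(γf) - q^{DN}(γf)` and `Q₁(f) = Q^(D)₁(f₀) + q(γf)`. -/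
def IsRepresentedBy (o : X) (Q : Lp ℝ 2 m → ℝ≥0∞) (q : G.L2Boundary m o → ℝ≥0∞) : Prop :=
  (∀ f, Q f < ⊤ ↔ G.neumann m f < ⊤ ∧ q (G.trace m o f) < ⊤) ∧
  ∀ f, Q f < ⊤ →
    Q f = G.neumann m f + q (G.trace m o f) - G.dirichletToNeumann m o (G.trace m o f) ∧
    ∃ f₀ fh, G.IsRoydenDecomposition m f f₀ fh ∧
      one Q f = one (G.dirichlet m) f₀ + q (G.trace m o f)

end WGraph

end GraphForms

end

/-!
The `1`-harmonic functions in `D(Q^(N))` are the orthogonal complement of `D(Q^(D))` for the inner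
product of `Q^(N)₁`, and by the maximum principle a function has vanishing trace exactly if it
belongs to `D(Q^(D))`. A form `Q` between `Q^(N)` and `Q^(D)` agrees with `Q^(N)` on `D(Q^(D))`;
since `Q - Q^(N)` is positive, it then vanishes whenever one argument is in `D(Q^(D))`, so
`Q(f) - Q^(N)(f)` depends only on the trace `γf` and equals `Tr Q(γf) - q^{DN}(γf)`.

That `Tr Q` and `Tr Q - q^{DN}` are Markovian comes down to `Q - Q^(N)` being Markovian. The form
`Q` is the limit of the forms `t⁻¹ ⟪f - (1 + t Q)⁻¹ f, f⟫`, which are given by jumps and killing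
because resolvents of Markovian forms are Markovian. The jumps from and to the points of a finite
set `F` and the killing there can be read off from the forms on `D(Q^(D))`, so they contribute the
same to `Q` and `Q^(N)`; what is left of `Q` is Markovian, and as `F` exhausts `X` it tends to
`Q - Q^(N)`.

Conversely, for `q` in `Tr 𝔇(b,c)` the form `Q^(N)(f) + (q - q^{DN})(γf)` is Markovian as a sum of
two such forms, because the trace commutes with normal contractions.
-/

noncomputable section

namespace GraphForms

open scoped RealInnerProductSpace

section Forms

variable {H : Type*} [NormedAddCommGroup H] [InnerProductSpace ℝ H]

theorem tendsto_ofReal_sq_zero_iff {α : Type*} {l : Filter α} {x : α → ℝ} :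
    Tendsto (fun n => ENNReal.ofReal (x n ^ 2)) l (𝓝 0) ↔ Tendsto x l (𝓝 0) := by
  refine ⟨fun h => ?_, fun h => by simpa using ENNReal.tendsto_ofReal (h.pow 2)⟩
  have hsqrt := ((ENNReal.tendsto_toReal ENNReal.zero_ne_top).comp h).sqrt
  refine (tendsto_zero_iff_abs_tendsto_zero x).2 ?_
  simpa [Function.comp_def, ENNReal.toReal_ofReal, sq_nonneg, Real.sqrt_sq_eq_abs] using hsqrt

theorem tendsto_atTop_prod_zero_iff {F : ℕ → ℕ → ℝ≥0∞} :
    Tendsto (fun p : ℕ × ℕ => F p.1 p.2) atTop (𝓝 0) ↔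
      ∀ ε : ℝ≥0∞, 0 < ε → ∃ N, ∀ n ≥ N, ∀ k ≥ N, F n k < ε := by
  refine ENNReal.nhds_zero_basis.tendsto_right_iff.trans (forall₂_congr fun ε _ => ?_)
  simp only [Set.mem_Iio, eventually_atTop_prod_self]
  exact ⟨fun ⟨N, h⟩ => ⟨N, fun n hn k hk => h n k hn hk⟩,
    fun ⟨N, h⟩ => ⟨N, fun n k hn hk => h n hn k hk⟩⟩

theorem exists_eq_value_of_injective {E : Type*} [AddCommGroup E] [Module ℝ E] {Q : H → ℝ≥0∞}
    {T : E →ₗ[ℝ] H} (injective : Function.Injective T) (B : E →ₗ[ℝ] E →ₗ[ℝ] ℝ)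
    (symm : ∀ u v, B u v = B v u) (nonneg : ∀ u, 0 ≤ B u u)
    (value : ∀ u, Q (T u) = ENNReal.ofReal (B u u)) (range : ∀ f, Q f < ⊤ → ∃ u, T u = f) :
    ∃ S : SymmPosForm H, Q = S.value := by
  let e : E ≃ₗ[ℝ] LinearMap.range T := LinearEquiv.ofInjective T injective
  have coe_symm (f : LinearMap.range T) : T (e.symm f) = f :=
    congrArg Subtype.val (e.apply_symm_apply f)
  refine ⟨⟨_, B.compl₁₂ e.symm.toLinearMap e.symm.toLinearMap, fun f g => symm _ _,
    fun f => nonneg _⟩, funext fun f => ?_⟩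
  by_cases hf : f ∈ LinearMap.range T
  · rw [SymmPosForm.value, dif_pos hf]
    exact (congrArg Q (coe_symm ⟨f, hf⟩)).symm.trans (value _)
  · rw [SymmPosForm.value, dif_neg hf]
    exact not_lt_top_iff.1 fun h => hf (range f h)

/-- The bounds say that `B u u + ‖T u‖²` is equivalent to `‖u‖²`, so that completeness passes from
`E` to the domain of `Q`. -/
theorem isClosedForm_of_parametrization {E : Type*} [NormedAddCommGroup E] [NormedSpace ℝ E]
    [CompleteSpace E] {Q : H → ℝ≥0∞} (T : E →L[ℝ] H) (B : E →ₗ[ℝ] E →ₗ[ℝ] ℝ) (a : ℝ)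
    (symm : ∀ u v, B u v = B v u) (nonneg : ∀ u, 0 ≤ B u u)
    (le_norm : ∀ u, B u u ≤ a * ‖u‖ ^ 2) (norm_le : ∀ u, ‖u‖ ^ 2 ≤ a * (B u u + ‖T u‖ ^ 2))
    (value : ∀ u, Q (T u) = ENNReal.ofReal (B u u)) (range : ∀ f, Q f < ⊤ → ∃ u, T u = f) :
    IsClosedForm Q := by
  have one_apply (u : E) : one Q (T u) = ENNReal.ofReal (B u u + ‖T u‖ ^ 2) := by
    rw [one, value, ENNReal.ofReal_add (nonneg u) (sq_nonneg _)]
  have injective : Function.Injective T := (injective_iff_map_eq_zero T).2 fun u hu => by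
    have hB : B u u = 0 := by
      have h := value u
      rw [hu, ← map_zero T, value 0, ENNReal.ofReal_eq_ofReal_iff (nonneg 0) (nonneg u)] at h
      rw [← h, map_zero]
    simpa [hB, hu] using norm_le u
  refine ⟨exists_eq_value_of_injective (T := T.toLinearMap) injective B symm nonneg value range,
    fun f hf hcauchy => ?_⟩
  choose u hu using fun n => range (f n) (hf n)
  obtain rfl : (fun n => T (u n)) = f := funext hu
  have le_one (w : E) : ENNReal.ofReal (‖w‖ ^ 2) ≤ ENNReal.ofReal a * one Q (T w) := by
    rw [one_apply, ← ENNReal.ofReal_mul' (add_nonneg (nonneg w) (sq_nonneg _))]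
    exact ENNReal.ofReal_le_ofReal (norm_le w)
  have one_le (w : E) : one Q (T w) ≤ ENNReal.ofReal ((a + ‖T‖ ^ 2) * ‖w‖ ^ 2) := by
    rw [one_apply, add_mul, ← mul_pow]
    exact ENNReal.ofReal_le_ofReal (add_le_add (le_norm w) (by gcongr; exact T.le_opNorm w))
  have hu_cauchy : CauchySeq u := by
    rw [cauchySeq_iff_tendsto_dist_atTop_0, ← tendsto_ofReal_sq_zero_iff]
    refine tendsto_of_tendsto_of_tendsto_of_le_of_le tendsto_const_nhds ?_ (fun _ => zero_le)
      (fun p => by simpa only [dist_eq_norm, map_sub] using le_one (u p.1 - u p.2))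
    simpa using ENNReal.Tendsto.const_mul (tendsto_atTop_prod_zero_iff.2 hcauchy)
      (Or.inr ENNReal.ofReal_ne_top)
  obtain ⟨u₀, hu₀⟩ := cauchySeq_tendsto_of_complete hu_cauchy
  refine ⟨T u₀, by rw [value]; exact ENNReal.ofReal_lt_top, ?_⟩
  refine tendsto_of_tendsto_of_tendsto_of_le_of_le tendsto_const_nhds ?_ (fun _ => zero_le)
    (fun n => by simpa only [map_sub] using one_le (u n - u₀))
  simpa using ENNReal.tendsto_ofReal
    (((tendsto_iff_norm_sub_tendsto_zero.1 hu₀).pow 2).const_mul (a + ‖T‖ ^ 2))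

theorem ofReal_norm_sq_lp {ι : Type*} (g : lp (fun _ : ι => ℝ) 2) :
    ENNReal.ofReal (‖g‖ ^ 2) = ∑' i, ENNReal.ofReal (g i ^ 2) := by
  have hsum := lp.hasSum_norm (by norm_num) g
  norm_num at hsum
  rw [← hsum.tsum_eq, ENNReal.ofReal_tsum_of_nonneg (fun _ => sq_nonneg _) hsum.summable]

theorem isClosedForm_tsum_sq [CompleteSpace H] {ι : Type*} (a : ι → H →L[ℝ] ℝ) :
    IsClosedForm fun f => ∑' i, ENNReal.ofReal (a i f ^ 2) := by
  let D : Submodule ℝ (H × lp (fun _ : ι => ℝ) 2) :=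
    ⨅ i, (lp.evalCLM ℝ (fun _ : ι => ℝ) 2 i ∘L .snd ℝ H _ - a i ∘L .fst ℝ H _).ker
  have mem_D {p} : p ∈ D ↔ ∀ i, p.2 i = a i p.1 := by
    simp [D, sub_eq_zero]
    rfl
  have isClosed_D : IsClosed (D : Set (H × lp (fun _ : ι => ℝ) 2)) := by
    rw [Submodule.coe_iInf]
    exact isClosed_iInter fun i => ContinuousLinearMap.isClosed_ker _
  have : CompleteSpace D := isClosed_D.completeSpace_coe
  let B := (innerₗ _).compl₁₂ (LinearMap.snd ℝ H _ ∘ₗ D.subtype) (LinearMap.snd ℝ H _ ∘ₗ D.subtype)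
  have B_self (u : D) : B u u = ‖u.1.2‖ ^ 2 := real_inner_self_eq_norm_sq u.1.2
  refine isClosedForm_of_parametrization (ContinuousLinearMap.fst ℝ H _ ∘L D.subtypeL) B 1
    (fun u v => real_inner_comm v.1.2 u.1.2) (fun u => ?_) (fun u => ?_) (fun u => ?_)
    (fun u => ?_) fun f hf => ?_
  · rw [B_self]
    positivity
  · rw [B_self, one_mul]
    gcongr
    exact norm_snd_le u.1
  · rw [B_self]
    change max ‖u.1.1‖ ‖u.1.2‖ ^ 2 ≤ 1 * (‖u.1.2‖ ^ 2 + ‖u.1.1‖ ^ 2)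
    rcases max_choice ‖u.1.1‖ ‖u.1.2‖ with h | h <;> rw [h] <;>
      nlinarith [sq_nonneg ‖u.1.1‖, sq_nonneg ‖u.1.2‖]
  · rw [B_self, ofReal_norm_sq_lp]
    exact tsum_congr fun i => by rw [mem_D.1 u.2]; rfl
  · have hmem : Memℓp (fun i => a i f) 2 := by
      refine memℓp_gen ?_
      simpa [ENNReal.toReal_ofReal, sq_nonneg] using ENNReal.summable_toReal hf.ne
    exact ⟨⟨(f, ⟨_, hmem⟩), mem_D.2 fun i => rfl⟩, rfl⟩

theorem SymmPosForm.value_coe (S : SymmPosForm H) (f : S.domain) :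
    S.value f = ENNReal.ofReal (S.form f f) := by
  simp [value]

theorem SymmPosForm.value_lt_top (S : SymmPosForm H) {f : H} : S.value f < ⊤ ↔ f ∈ S.domain := by
  by_cases h : f ∈ S.domain <;> simp [value, h]

/-- The domain of a form as an inner product space with the inner product `S(f,g) + ⟪f, g⟫`. -/
def FormSpace (S : SymmPosForm H) : Type _ := S.domain

namespace FormSpace

variable {S : SymmPosForm H}

instance : AddCommGroup (FormSpace S) := inferInstanceAs (AddCommGroup S.domain)
instance : Module ℝ (FormSpace S) := inferInstanceAs (Module ℝ S.domain)

/-- The bilinear form `S(f,g)`, as opposed to the inner product of `FormSpace S`. -/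
def form : FormSpace S →ₗ[ℝ] FormSpace S →ₗ[ℝ] ℝ := S.form

theorem form_comm (f g : FormSpace S) : form f g = form g f := S.symm f g

theorem form_self_nonneg (f : FormSpace S) : 0 ≤ form f f := S.nonneg f

/-- The inclusion of the domain as a linear map; see `incl` for the continuous version. -/
def inclₗ : FormSpace S →ₗ[ℝ] H := S.domain.subtype

variable (S) in
/-- The inner product space structure on the domain of a form. -/
@[reducible] def innerProductCore : InnerProductSpace.Core ℝ (FormSpace S) where
  inner f g := form f g + ⟪inclₗ f, inclₗ g⟫
  conj_inner_symm f g := by simp only [conj_trivial, form_comm g f, real_inner_comm]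
  re_inner_nonneg f := add_nonneg (form_self_nonneg f) real_inner_self_nonneg
  add_left f g h := by
    simp only [map_add, LinearMap.add_apply, inner_add_left]
    ring
  smul_left f g r := by
    simp only [map_smul, LinearMap.smul_apply, real_inner_smul_left, smul_eq_mul, conj_trivial]
    ring
  definite f h := by
    have hform := form_self_nonneg f
    have hinner : 0 ≤ ⟪inclₗ f, inclₗ f⟫ := real_inner_self_nonneg
    exact Subtype.ext (inner_self_eq_zero.1 (by linarith : ⟪inclₗ f, inclₗ f⟫ = 0))

instance : NormedAddCommGroup (FormSpace S) := (innerProductCore S).toNormedAddCommGroup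
instance : InnerProductSpace ℝ (FormSpace S) :=
  InnerProductSpace.ofCore (innerProductCore S).toCore

/-- The inclusion of the domain into the ambient Hilbert space. -/
def incl : FormSpace S →L[ℝ] H :=
  inclₗ.mkContinuous 1 fun f => by
    rw [one_mul]
    refine le_of_sq_le_sq ?_ (norm_nonneg _)
    rw [← real_inner_self_eq_norm_sq, ← real_inner_self_eq_norm_sq]
    exact le_add_of_nonneg_left (form_self_nonneg f)

theorem inner_eq (f g : FormSpace S) : ⟪f, g⟫ = form f g + ⟪incl f, incl g⟫ := rfl

theorem norm_sq_eq (f : FormSpace S) : ‖f‖ ^ 2 = form f f + ‖incl f‖ ^ 2 := by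
  rw [← real_inner_self_eq_norm_sq, inner_eq, real_inner_self_eq_norm_sq]

theorem incl_injective : Function.Injective (incl (S := S)) := Subtype.val_injective

theorem value_incl (f : FormSpace S) : S.value (incl f) = ENNReal.ofReal (form f f) :=
  S.value_coe _

theorem value_incl_lt_top (f : FormSpace S) : S.value (incl f) < ⊤ := by
  rw [value_incl]
  exact ENNReal.ofReal_lt_top

theorem one_value_incl (f : FormSpace S) : one S.value (incl f) = ENNReal.ofReal (‖f‖ ^ 2) := by
  rw [norm_sq_eq, one, value_incl, ← ENNReal.ofReal_add (form_self_nonneg f) (sq_nonneg _)]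

/-- An element of the domain, as an element of the form space. -/
def of (f : H) (hf : S.value f < ⊤) : FormSpace S := ⟨f, S.value_lt_top.1 hf⟩

@[simp] theorem incl_of (f : H) (hf : S.value f < ⊤) : incl (of f hf : FormSpace S) = f := rfl

theorem completeSpace (h : IsClosedForm S.value) : CompleteSpace (FormSpace S) := by
  refine Metric.complete_of_cauchySeq_tendsto fun u hu => ?_
  obtain ⟨f, hf, hlim⟩ := h.2 (fun n => incl (u n)) (fun n => value_incl_lt_top _) <| by
    rw [← tendsto_atTop_prod_zero_iff]
    simp only [← map_sub, one_value_incl, tendsto_ofReal_sq_zero_iff, ← dist_eq_norm]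
    exact cauchySeq_iff_tendsto_dist_atTop_0.1 hu
  refine ⟨of f hf, tendsto_iff_norm_sub_tendsto_zero.2 (tendsto_ofReal_sq_zero_iff.1 ?_)⟩
  simpa only [← one_value_incl, map_sub, incl_of] using hlim

end FormSpace

end Forms

theorem tendsto_inner_of_bounded {E : Type*} [NormedAddCommGroup E] [InnerProductSpace ℝ E]
    [CompleteSpace E] {ι : Type*} (e : ι → E →L[ℝ] ℝ) (hsep : ∀ u, (∀ i, e i u = 0) → u = 0)
    {α : Type*} {l : Filter α} {u : α → E} {u₀ : E} {R : ℝ} (hb : ∀ n, ‖u n‖ ≤ R)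
    (he : ∀ i, Tendsto (fun n => e i (u n)) l (𝓝 (e i u₀))) (v : E) :
    Tendsto (fun n => ⟪u n, v⟫) l (𝓝 ⟪u₀, v⟫) := by
  let K : Submodule ℝ E :=
    { carrier := {v | Tendsto (fun n => ⟪u n, v⟫) l (𝓝 ⟪u₀, v⟫)}
      zero_mem' := by simpa using tendsto_const_nhds
      add_mem' := fun {v w} hv hw => by
        simpa only [Set.mem_ofPred_eq, inner_add_right] using hv.add hw
      smul_mem' := fun c v hv => by
        simpa only [Set.mem_ofPred_eq, real_inner_smul_right] using hv.const_mul c }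
  have isClosed_K : IsClosed (K : Set E) := by
    have hlip (n : α) : LipschitzWith R.toNNReal fun v : E => ⟪u n, v⟫ :=
      LipschitzWith.of_dist_le_mul fun v w => by
        rw [Real.dist_eq, ← inner_sub_right, dist_eq_norm]
        refine (abs_real_inner_le_norm _ _).trans ?_
        gcongr
        exact (hb n).trans (Real.le_coe_toNNReal R)
    exact (LipschitzWith.uniformEquicontinuous _ _ hlip).equicontinuous.isClosed_setOfPred_tendsto
      (continuous_const.inner continuous_id)
  have orthogonal_K : Kᗮ = ⊥ := by
    refine (Submodule.eq_bot_iff _).2 fun w hw => hsep w fun i => ?_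
    have hmem : (InnerProductSpace.toDual ℝ E).symm (e i) ∈ K := by
      change Tendsto _ _ _
      simpa only [real_inner_comm ((InnerProductSpace.toDual ℝ E).symm (e i)),
        InnerProductSpace.toDual_symm_apply] using he i
    simpa only [InnerProductSpace.toDual_symm_apply] using
      (Submodule.mem_orthogonal K w).1 hw _ hmem
  have hv : v ∈ K := by
    rw [← isClosed_K.submodule_topologicalClosure_eq,
      Submodule.topologicalClosure_eq_top_iff.2 orthogonal_K]
    trivial
  exact hv

theorem ofReal_norm_sq_eq_lintegral {Ω : Type*} [MeasurableSpace Ω] {μ : Measure Ω}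
    (f : Lp ℝ 2 μ) : ENNReal.ofReal (‖f‖ ^ 2) = ∫⁻ ω, ENNReal.ofReal (f ω ^ 2) ∂μ := by
  rw [← real_inner_self_eq_norm_sq, L2.inner_def,
    ofReal_integral_eq_lintegral_ofReal (L2.integrable_inner f f)
      (Eventually.of_forall fun x => real_inner_self_nonneg)]
  simp only [real_inner_self_eq_norm_sq, Real.norm_eq_abs, sq_abs]

theorem memLp_two_of_lintegral_lt_top {Ω : Type*} [MeasurableSpace Ω] {μ : Measure Ω} {f : Ω → ℝ}
    (hf : AEStronglyMeasurable f μ) (h : ∫⁻ ω, ENNReal.ofReal (f ω ^ 2) ∂μ < ⊤) :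
    MemLp f 2 μ := by
  refine ⟨hf, ?_⟩
  rw [eLpNorm_lt_top_iff_lintegral_rpow_enorm_lt_top (by simp) (by simp)]
  refine (lintegral_congr fun ω => ?_).trans_lt h
  rw [← sq_abs, ENNReal.ofReal_pow (abs_nonneg _), Real.enorm_eq_ofReal_abs]
  simp

section Discrete

/-- Every point has positive finite mass. -/
class PosFiniteAtoms {X : Type*} [MeasurableSpace X] (m : Measure X) : Prop where
  pos : ∀ x, 0 < m {x}
  lt_top : ∀ x, m {x} < ⊤

variable {X : Type*} [MeasurableSpace X]

theorem lp_ext {m : Measure X} {E : Type*} [NormedAddCommGroup E] {p : ℝ≥0∞} {f g : Lp E p m}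
    (h : ∀ x, f x = g x) : f = g :=
  Lp.ext (Eventually.of_forall h)

theorem measureReal_singleton_pos (m : Measure X) [PosFiniteAtoms m] (x : X) : 0 < m.real {x} :=
  ENNReal.toReal_pos (PosFiniteAtoms.pos x).ne' (PosFiniteAtoms.lt_top x).ne

theorem ofReal_measureReal_singleton (m : Measure X) [PosFiniteAtoms m] (x : X) :
    ENNReal.ofReal (m.real {x}) = m {x} :=
  ENNReal.ofReal_toReal (PosFiniteAtoms.lt_top x).ne

variable {m : Measure X} [PosFiniteAtoms m]

theorem forall_of_ae {p : X → Prop} (h : ∀ᵐ x ∂m, p x) (x : X) : p x := by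
  by_contra hx
  exact (PosFiniteAtoms.pos (m := m) x).ne'
    (measure_mono_null (by simpa using hx) (ae_iff.1 h))

section Lp

variable {E : Type*} [NormedAddCommGroup E] {p : ℝ≥0∞}

theorem lp_add_apply (f g : Lp E p m) (x : X) : (f + g : Lp E p m) x = f x + g x :=
  forall_of_ae (Lp.coeFn_add f g) x

theorem lp_sub_apply (f g : Lp E p m) (x : X) : (f - g : Lp E p m) x = f x - g x :=
  forall_of_ae (Lp.coeFn_sub f g) x

theorem lp_neg_apply (f : Lp E p m) (x : X) : (-f : Lp E p m) x = -f x :=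
  forall_of_ae (Lp.coeFn_neg f) x

theorem lp_zero_apply (x : X) : (0 : Lp E p m) x = 0 :=
  forall_of_ae (Lp.coeFn_zero E p m) x

theorem lp_smul_apply [NormedSpace ℝ E] (c : ℝ) (f : Lp E p m) (x : X) :
    (c • f : Lp E p m) x = c • f x :=
  forall_of_ae (Lp.coeFn_smul c f) x

theorem compLp_apply {C : E → E} (hC : LipschitzWith 1 C) (h0 : C 0 = 0) (f : Lp E p m) (x : X) :
    (hC.compLp h0 f) x = C (f x) :=
  forall_of_ae (hC.coeFn_compLp h0 f) x

end Lp

variable [Countable X] [DiscreteMeasurableSpace X]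

theorem lintegral_ofReal_sq_eq_tsum (f : X → ℝ) :
    ∫⁻ x, ENNReal.ofReal (f x ^ 2) ∂m = ∑' x, ENNReal.ofReal (m.real {x} * f x ^ 2) := by
  rw [lintegral_countable']
  refine tsum_congr fun x => ?_
  rw [mul_comm, ENNReal.ofReal_mul measureReal_nonneg, ofReal_measureReal_singleton]

theorem ofReal_norm_sq (f : Lp ℝ 2 m) :
    ENNReal.ofReal (‖f‖ ^ 2) = ∑' x, ENNReal.ofReal (m.real {x} * f x ^ 2) := by
  rw [ofReal_norm_sq_eq_lintegral, lintegral_ofReal_sq_eq_tsum]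

theorem memLp_two_of_tsum {f : X → ℝ} (hf : ∑' x, ENNReal.ofReal (m.real {x} * f x ^ 2) < ⊤) :
    MemLp f 2 m :=
  memLp_two_of_lintegral_lt_top (measurable_of_countable f).aestronglyMeasurable
    (by rwa [lintegral_ofReal_sq_eq_tsum])

/-- The evaluation of square summable functions at a point. -/
def lpEval (m : Measure X) [PosFiniteAtoms m] (x : X) : Lp ℝ 2 m →L[ℝ] ℝ :=
  LinearMap.mkContinuous
    { toFun := fun f => f x
      map_add' := fun f g => lp_add_apply f g x
      map_smul' := fun c f => lp_smul_apply c f x } (√(m.real {x}))⁻¹ fun f => by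
    have hle : m.real {x} * f x ^ 2 ≤ ‖f‖ ^ 2 := by
      rw [← ENNReal.ofReal_le_ofReal_iff (by positivity), ofReal_norm_sq]
      exact ENNReal.le_tsum x
    rw [inv_mul_eq_div, le_div_iff₀ (Real.sqrt_pos.2 (measureReal_singleton_pos m x))]
    refine le_of_sq_le_sq ?_ (norm_nonneg _)
    rw [mul_pow, Real.sq_sqrt measureReal_nonneg, mul_comm]
    simpa using hle

@[simp] theorem lpEval_apply (x : X) (f : Lp ℝ 2 m) : lpEval m x f = f x := rfl

end Discrete

/-! ### Normal contractions -/

section Contractions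

theorem abs_sub_le_of_lipschitzWith {C : ℝ → ℝ} (hC : LipschitzWith 1 C) (s t : ℝ) :
    |C s - C t| ≤ |s - t| := by
  simpa [Real.dist_eq] using hC.dist_le_mul s t

theorem abs_le_of_lipschitzWith {C : ℝ → ℝ} (hC : LipschitzWith 1 C) (h0 : C 0 = 0) (t : ℝ) :
    |C t| ≤ |t| := by
  simpa [h0] using abs_sub_le_of_lipschitzWith hC t 0

theorem lipschitzWith_abs : LipschitzWith 1 (fun t : ℝ => |t|) :=
  LipschitzWith.of_dist_le_mul fun a b => by
    simpa [Real.dist_eq] using abs_abs_sub_abs_le_abs_sub a b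

/-- The normal contraction which cuts out the part of `t` between `s` and `s + 1`. -/
def slice (s t : ℝ) : ℝ := max 0 (min 1 (t - s))

theorem lipschitzWith_slice (s : ℝ) : LipschitzWith 1 (slice s) := by
  have h : LipschitzWith 1 fun t : ℝ => t - s := LipschitzWith.of_dist_le_mul fun a b => by simp
  exact (h.const_min 1).const_max 0

theorem slice_zero {s : ℝ} (hs : 0 ≤ s) : slice s 0 = 0 := by
  simp [slice, hs]

theorem slice_nonneg (s t : ℝ) : 0 ≤ slice s t := le_max_left _ _

theorem slice_le_one (s t : ℝ) : slice s t ≤ 1 := max_le zero_le_one (min_le_left _ _)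

theorem slice_eq_zero_iff {s t : ℝ} : slice s t = 0 ↔ t ≤ s := by
  simp [slice]

theorem monotone_slice (s : ℝ) : Monotone (slice s) := fun a b h =>
  max_le_max le_rfl (min_le_min le_rfl (by linarith))

theorem slice_sub_mul_self_le (s a b : ℝ) :
    (slice s a - slice s b) * (slice s a - slice s b) ≤ (a - b) * (slice s a - slice s b) := by
  have hle := abs_sub_le_of_lipschitzWith (lipschitzWith_slice s) a b
  rcases le_total a b with hab | hab
  · have hs := monotone_slice s hab
    rw [abs_of_nonpos (by linarith), abs_of_nonpos (by linarith)] at hle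
    nlinarith
  · have hs := monotone_slice s hab
    rw [abs_of_nonneg (by linarith), abs_of_nonneg (by linarith)] at hle
    nlinarith

/-- The truncation of `t` to `[-r, r]`. -/
def clamp (r t : ℝ) : ℝ := max (-r) (min r t)

theorem lipschitzWith_clamp (r : ℝ) : LipschitzWith 1 (clamp r) :=
  (LipschitzWith.id.const_min r).const_max (-r)

theorem continuous_clamp_left (t : ℝ) : Continuous fun r => clamp r t := by
  unfold clamp
  fun_prop

theorem clamp_zero {r : ℝ} (hr : 0 ≤ r) : clamp r 0 = 0 := by
  simp [clamp, hr]

theorem clamp_zero_left (t : ℝ) : clamp 0 t = 0 := by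
  simp [clamp]

theorem abs_clamp_le {r : ℝ} (hr : 0 ≤ r) (t : ℝ) : |clamp r t| ≤ r :=
  abs_le.2 ⟨le_max_left _ _, max_le (by linarith) (min_le_left _ _)⟩

theorem clamp_eq_self {r t : ℝ} (h : |t| ≤ r) : clamp r t = t := by
  obtain ⟨hl, hr⟩ := abs_le.1 h
  rw [clamp, min_eq_right hr, max_eq_right hl]

theorem tendsto_clamp (t : ℝ) : Tendsto (fun n : ℕ => clamp n t) atTop (𝓝 t) := by
  obtain ⟨N, hN⟩ := exists_nat_ge |t|
  refine tendsto_const_nhds.congr' ((eventually_ge_atTop N).mono fun n hn => ?_)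
  exact (clamp_eq_self (hN.trans (by exact_mod_cast hn))).symm

theorem abs_clamp_sub_clamp_le (q r s t : ℝ) : |clamp q s - clamp r t| ≤ |s - t| + |q - r| := by
  have hq : |clamp q t - clamp r t| ≤ |q - r| := by
    refine (abs_max_sub_max_le_max _ _ _ _).trans (max_le ?_ ?_)
    · rw [neg_sub_neg, abs_sub_comm]
    · simpa using abs_min_sub_min_le_max q t r t
  calc |clamp q s - clamp r t| ≤ |clamp q s - clamp q t| + |clamp q t - clamp r t| :=
        abs_sub_le _ _ _
    _ ≤ |s - t| + |q - r| := add_le_add (abs_sub_le_of_lipschitzWith (lipschitzWith_clamp q) s t) hq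

end Contractions

theorem sq_le_of_abs_le {a b c K : ℝ} (h : |a| ≤ K * (|b| + |c|)) :
    a ^ 2 ≤ 2 * K ^ 2 * (b ^ 2 + c ^ 2) := by
  have hsq := pow_le_pow_left₀ (abs_nonneg _) h 2
  rw [sq_abs, mul_pow] at hsq
  have hadd : (|b| + |c|) ^ 2 ≤ 2 * (b ^ 2 + c ^ 2) := by
    simpa only [sq_abs] using add_sq_le (a := |b|) (b := |c|)
  nlinarith [mul_le_mul_of_nonneg_left hadd (sq_nonneg K)]

/-! ### The energy of a graph -/

namespace WGraph

section Energy

variable {X : Type*} (G : WGraph X)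

/-- The weights of the energy regarded as a single sum over pairs and points: `b/2` on pairs, `c`
on points. -/
def weight : (X × X) ⊕ X → ℝ := Sum.elim (fun p => G.b p.1 p.2 / 2) G.c

/-- The differences of a function over pairs and its values at points, which are the quantities
squared in the energy. -/
def grad : (X → ℝ) →ₗ[ℝ] (X × X) ⊕ X → ℝ where
  toFun f := Sum.elim (fun p => f p.1 - f p.2) f
  map_add' f g := funext <| by rintro (p | x) <;> simp [add_sub_add_comm]
  map_smul' a f := funext <| by rintro (p | x) <;> simp [mul_sub]

@[simp] theorem grad_inl (f : X → ℝ) (p : X × X) : grad f (Sum.inl p) = f p.1 - f p.2 := rfl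
@[simp] theorem grad_inr (f : X → ℝ) (x : X) : grad f (Sum.inr x) = f x := rfl

theorem weight_nonneg (y : (X × X) ⊕ X) : 0 ≤ G.weight y := by
  rcases y with p | x
  · exact div_nonneg (G.b_nonneg _ _) zero_le_two
  · exact G.c_nonneg x

theorem abs_grad_comp_le {C : ℝ → ℝ} (hC : LipschitzWith 1 C) (h0 : C 0 = 0) (f : X → ℝ)
    (y : (X × X) ⊕ X) : |grad (fun x => C (f x)) y| ≤ |grad f y| := by
  rcases y with p | x
  · exact abs_sub_le_of_lipschitzWith hC _ _
  · exact abs_le_of_lipschitzWith hC h0 _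

theorem abs_grad_clamp_le (f g : X → ℝ) (y : (X × X) ⊕ X) :
    |grad (fun x => clamp |g x| (f x)) y| ≤ 1 * (|grad f y| + |grad g y|) := by
  rw [one_mul]
  rcases y with ⟨x, y⟩ | x
  · exact (abs_clamp_sub_clamp_le _ _ _ _).trans
      (add_le_add_right (abs_abs_sub_abs_le_abs_sub (g x) (g y)) _)
  · simpa [clamp_zero_left] using abs_clamp_sub_clamp_le |g x| 0 (f x) 0

theorem tendsto_grad {α : Type*} {l : Filter α} {u : α → X → ℝ} {f : X → ℝ}
    (h : ∀ x, Tendsto (fun n => u n x) l (𝓝 (f x))) (y : (X × X) ⊕ X) :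
    Tendsto (fun n => grad (u n) y) l (𝓝 (grad f y)) := by
  rcases y with p | x
  · exact (h _).sub (h _)
  · exact h x

theorem energy_eq_tsum (f : X → ℝ) :
    G.energy f = ∑' y, ENNReal.ofReal (G.weight y * grad f y ^ 2) := by
  rw [ENNReal.summable.tsum_sum ENNReal.summable, energy]
  congr 1
  rw [← ENNReal.tsum_prod (f := fun x y => ENNReal.ofReal (G.b x y * (f x - f y) ^ 2)),
    ← ENNReal.tsum_mul_left]
  refine tsum_congr fun p => ?_
  have two_inv : (2 : ℝ≥0∞)⁻¹ = ENNReal.ofReal 2⁻¹ := by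
    rw [ENNReal.ofReal_inv_of_pos two_pos, ENNReal.ofReal_ofNat]
  rw [two_inv, ← ENNReal.ofReal_mul (by positivity)]
  congr 1
  simp only [weight, Sum.elim_inl, grad_inl]
  ring

theorem energy_mono {f g : X → ℝ} (h : ∀ y, |grad f y| ≤ |grad g y|) :
    G.energy f ≤ G.energy g := by
  rw [energy_eq_tsum, energy_eq_tsum]
  exact ENNReal.tsum_le_tsum fun y => ENNReal.ofReal_le_ofReal
    (mul_le_mul_of_nonneg_left (sq_le_sq.2 (h y)) (G.weight_nonneg y))

theorem energy_lt_top_of_abs_grad_le {f u v : X → ℝ} {K : ℝ} (hu : G.energy u < ⊤)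
    (hv : G.energy v < ⊤) (h : ∀ y, |grad f y| ≤ K * (|grad u y| + |grad v y|)) :
    G.energy f < ⊤ := by
  have hle : G.energy f ≤ ENNReal.ofReal (2 * K ^ 2) * (G.energy u + G.energy v) := by
    rw [energy_eq_tsum, energy_eq_tsum, energy_eq_tsum, ← ENNReal.tsum_add, ← ENNReal.tsum_mul_left]
    refine ENNReal.tsum_le_tsum fun y => ?_
    have hw := G.weight_nonneg y
    rw [← ENNReal.ofReal_add (by positivity) (by positivity), ← ENNReal.ofReal_mul (by positivity)]
    refine ENNReal.ofReal_le_ofReal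
      ((mul_le_mul_of_nonneg_left (sq_le_of_abs_le (h y)) hw).trans_eq ?_)
    ring
  exact hle.trans_lt (ENNReal.mul_lt_top ENNReal.ofReal_lt_top (ENNReal.add_lt_top.2 ⟨hu, hv⟩))

open Classical in
theorem energy_dirac_lt_top (z : X) : G.energy (fun x => if x = z then 1 else 0) < ⊤ := by
  have hb : ∑' y, ENNReal.ofReal (G.b z y) < ⊤ := by
    rw [← ENNReal.ofReal_tsum_of_nonneg (G.b_nonneg z) (G.b_summable z)]
    exact ENNReal.ofReal_lt_top
  have hle (x y : X) : ENNReal.ofReal (G.b x y * ((if x = z then 1 else 0) -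
      if y = z then 1 else 0) ^ 2) ≤ (if x = z then ENNReal.ofReal (G.b z y) else 0) +
      if y = z then ENNReal.ofReal (G.b z x) else 0 := by
    by_cases hx : x = z <;> by_cases hy : y = z <;> simp [hx, hy, G.b_symm x z]
  have hfst : ∑' x, ∑' y, (if x = z then ENNReal.ofReal (G.b z y) else 0) < ⊤ := by
    rw [tsum_eq_single z fun x hx => by simp [hx]]
    simpa using hb
  have hsnd : ∑' x, ∑' y, (if y = z then ENNReal.ofReal (G.b z x) else 0) < ⊤ := by
    simpa only [tsum_ite_eq] using hb
  refine ENNReal.add_lt_top.2 ⟨ENNReal.mul_lt_top (by simp) ?_, ?_⟩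
  · refine lt_of_le_of_lt ?_ (ENNReal.add_lt_top.2 ⟨hfst, hsnd⟩)
    simp only [← ENNReal.tsum_add]
    exact ENNReal.tsum_le_tsum fun x => ENNReal.tsum_le_tsum fun y => hle x y
  · rw [tsum_eq_single z fun x hx => by simp [hx]]
    simp

variable [MeasurableSpace X]

/-- The graph with `m` added to the killing term `c`; its energy is the square of the form norm. -/
def addMass (m : Measure X) : WGraph X where
  b := G.b
  c := fun x => G.c x + m.real {x}
  b_nonneg := G.b_nonneg
  b_symm := G.b_symm
  b_diag := G.b_diag
  b_summable := G.b_summable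
  c_nonneg := fun x => add_nonneg (G.c_nonneg x) measureReal_nonneg

variable {m : Measure X}

theorem energy_addMass (f : X → ℝ) :
    (G.addMass m).energy f = G.energy f + ∑' x, ENNReal.ofReal (m.real {x} * f x ^ 2) := by
  simp only [energy, addMass]
  rw [add_assoc, ← ENNReal.tsum_add]
  congr 1
  refine tsum_congr fun x => ?_
  rw [add_mul, ENNReal.ofReal_add (mul_nonneg (G.c_nonneg x) (sq_nonneg _)) (by positivity)]

variable [PosFiniteAtoms m] [Countable X] [DiscreteMeasurableSpace X]

theorem one_neumann (f : Lp ℝ 2 m) : one (G.neumann m) f = (G.addMass m).energy f := by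
  rw [energy_addMass, one, ofReal_norm_sq, neumann]

theorem isClosedForm_neumann : IsClosedForm (G.neumann m) := by
  let gradL : (X × X) ⊕ X → Lp ℝ 2 m →L[ℝ] ℝ :=
    Sum.elim (fun p => lpEval m p.1 - lpEval m p.2) (lpEval m)
  have gradL_apply (y) (f : Lp ℝ 2 m) : gradL y f = grad f y := by
    rcases y with p | x <;> simp [gradL]
  convert isClosedForm_tsum_sq fun y => √(G.weight y) • gradL y using 1
  funext f
  rw [neumann, energy_eq_tsum]
  refine tsum_congr fun y => ?_
  rw [_root_.smul_apply, gradL_apply, smul_eq_mul, mul_pow,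
    Real.sq_sqrt (G.weight_nonneg y)]

end Energy

end WGraph

/-! ### The Hilbert space `D(Q^(N))` -/

namespace FormSpace

variable {X : Type*} [MeasurableSpace X] {m : Measure X} {S : SymmPosForm (Lp ℝ 2 m)}

/-- Elements of a form domain in `ℓ²(X,m)` as functions on `X`. -/
instance : FunLike (FormSpace S) X ℝ where
  coe u := (incl u : Lp ℝ 2 m)
  coe_injective _ _ h := incl_injective (lp_ext (congrFun h))

theorem incl_apply (u : FormSpace S) (x : X) : (incl u : Lp ℝ 2 m) x = u x := rfl

variable [PosFiniteAtoms m]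

@[simp] theorem add_apply (u v : FormSpace S) (x : X) : (u + v) x = u x + v x := by
  simp only [← incl_apply, map_add, lp_add_apply]

@[simp] theorem sub_apply (u v : FormSpace S) (x : X) : (u - v) x = u x - v x := by
  simp only [← incl_apply, map_sub, lp_sub_apply]

@[simp] theorem neg_apply (u : FormSpace S) (x : X) : (-u) x = -u x := by
  simp only [← incl_apply, map_neg, lp_neg_apply]

@[simp] theorem smul_apply (c : ℝ) (u : FormSpace S) (x : X) : (c • u) x = c * u x := by
  simp only [← incl_apply, map_smul, lp_smul_apply, smul_eq_mul]

@[simp] theorem zero_apply (x : X) : (0 : FormSpace S) x = 0 := by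
  simp only [← incl_apply, map_zero, lp_zero_apply]

theorem grad_add (u v : FormSpace S) (y : (X × X) ⊕ X) :
    WGraph.grad (u + v) y = WGraph.grad u y + WGraph.grad v y := by
  rw [← Pi.add_apply, ← map_add]
  exact congrArg (fun f => WGraph.grad f y) (funext (add_apply u v))

theorem grad_sub (u v : FormSpace S) (y : (X × X) ⊕ X) :
    WGraph.grad (u - v) y = WGraph.grad u y - WGraph.grad v y := by
  rw [← Pi.sub_apply, ← map_sub]
  exact congrArg (fun f => WGraph.grad f y) (funext (sub_apply u v))

variable [Countable X] [DiscreteMeasurableSpace X]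

/-- Point evaluation on a form domain in `ℓ²(X,m)`. -/
def eval (x : X) : FormSpace S →L[ℝ] ℝ := (lpEval m x).comp incl

@[simp] theorem eval_apply (x : X) (u : FormSpace S) : eval x u = u x := rfl

@[simp] theorem sum_apply {ι : Type*} (s : Finset ι) (u : ι → FormSpace S) (x : X) :
    (∑ i ∈ s, u i) x = ∑ i ∈ s, u i x := by
  simp only [← eval_apply, map_sum]

theorem tendsto_inner [CompleteSpace (FormSpace S)] {α : Type*} {l : Filter α}
    {u : α → FormSpace S} {u₀ : FormSpace S} {R : ℝ} (hb : ∀ n, ‖u n‖ ≤ R)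
    (he : ∀ x, Tendsto (fun n => u n x) l (𝓝 (u₀ x))) (v : FormSpace S) :
    Tendsto (fun n => ⟪u n, v⟫) l (𝓝 ⟪u₀, v⟫) :=
  tendsto_inner_of_bounded eval (fun _ h => DFunLike.ext _ _ fun x => by simpa using h x) hb he v

end FormSpace

theorem hasSum_prod_ite_fst {α β M : Type*} [DecidableEq α] [AddCommMonoid M] [TopologicalSpace M]
    {a : β → M} {s : M} (h : HasSum a s) (z : α) :
    HasSum (fun p : α × β => if p.1 = z then a p.2 else 0) s := by
  refine ((Prod.mk_right_injective z).hasSum_iff ?_).1 (by simpa [Function.comp_def] using h)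
  rintro ⟨x, y⟩ hxy
  exact if_neg fun hx => hxy ⟨y, Prod.ext hx.symm rfl⟩

namespace WGraph

variable {X : Type*} [MeasurableSpace X] [Countable X] [DiscreteMeasurableSpace X]
  (G : WGraph X) (m : Measure X) [PosFiniteAtoms m]

/-- The bilinear form of `Q^(N)`. -/
def neumannForm : SymmPosForm (Lp ℝ 2 m) := (G.isClosedForm_neumann (m := m)).1.choose

theorem neumannForm_value : (G.neumannForm m).value = G.neumann m :=
  (G.isClosedForm_neumann (m := m)).1.choose_spec.symm

/-- The Hilbert space `D(Q^(N))`. -/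
abbrev Dom : Type _ := FormSpace (G.neumannForm m)

instance : CompleteSpace (G.Dom m) :=
  FormSpace.completeSpace (by rw [neumannForm_value]; exact G.isClosedForm_neumann)

variable {G m}

namespace Dom

theorem neumann_incl_lt_top (u : G.Dom m) : G.neumann m (FormSpace.incl u) < ⊤ := by
  rw [← neumannForm_value]
  exact FormSpace.value_incl_lt_top u

theorem one_neumann_incl (u : G.Dom m) :
    one (G.neumann m) (FormSpace.incl u) = ENNReal.ofReal (‖u‖ ^ 2) := by
  rw [← neumannForm_value]
  exact FormSpace.one_value_incl u

theorem energy_eq (u : G.Dom m) : (G.addMass m).energy u = ENNReal.ofReal (‖u‖ ^ 2) := by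
  rw [← one_neumann_incl, one_neumann]
  rfl

theorem energy_lt_top (u : G.Dom m) : (G.addMass m).energy u < ⊤ := by
  rw [energy_eq]
  exact ENNReal.ofReal_lt_top

/-- An element of `ℓ²(X,m)` of finite energy, as an element of `D(Q^(N))`. -/
def ofLp (f : Lp ℝ 2 m) (hf : G.neumann m f < ⊤) : G.Dom m :=
  FormSpace.of f (by rwa [neumannForm_value])

@[simp] theorem incl_ofLp (f : Lp ℝ 2 m) (hf : G.neumann m f < ⊤) :
    FormSpace.incl (ofLp f hf) = f := rfl

theorem exists_eq_of_energy_lt_top {f : X → ℝ} (hf : (G.addMass m).energy f < ⊤) :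
    ∃ u : G.Dom m, ∀ x, u x = f x := by
  obtain ⟨henergy, hmass⟩ := ENNReal.add_lt_top.1 (G.energy_addMass f ▸ hf)
  have hLp := memLp_two_of_tsum hmass
  have apply_eq : ⇑(hLp.toLp f) = f := funext (forall_of_ae hLp.coeFn_toLp)
  exact ⟨ofLp (hLp.toLp f) (by rwa [neumann, apply_eq]), congrFun apply_eq⟩

/-- A function of finite energy, as an element of `D(Q^(N))`. -/
def mk (f : X → ℝ) (hf : (G.addMass m).energy f < ⊤) : G.Dom m :=
  (exists_eq_of_energy_lt_top hf).choose

@[simp] theorem mk_apply (f : X → ℝ) (hf : (G.addMass m).energy f < ⊤) (x : X) :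
    mk f hf x = f x :=
  (exists_eq_of_energy_lt_top hf).choose_spec x

theorem exists_eq_of_abs_grad_le {f : X → ℝ} (u v : G.Dom m) {K : ℝ}
    (h : ∀ y, |grad f y| ≤ K * (|grad u y| + |grad v y|)) : ∃ w : G.Dom m, ∀ x, w x = f x :=
  exists_eq_of_energy_lt_top
    ((G.addMass m).energy_lt_top_of_abs_grad_le (energy_lt_top u) (energy_lt_top v) h)

theorem hasSum_norm_sq (u : G.Dom m) :
    HasSum (fun y => (G.addMass m).weight y * grad u y ^ 2) (‖u‖ ^ 2) := by
  have henergy := energy_eq u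
  rw [energy_eq_tsum] at henergy
  have hsum := ENNReal.hasSum_toReal (henergy.trans_ne ENNReal.ofReal_ne_top)
  rw [← ENNReal.tsum_toReal_eq (fun _ => ENNReal.ofReal_ne_top), henergy,
    ENNReal.toReal_ofReal (sq_nonneg _)] at hsum
  convert hsum using 2 with y
  rw [ENNReal.toReal_ofReal (mul_nonneg (weight_nonneg _ y) (sq_nonneg _))]

theorem hasSum_inner (u v : G.Dom m) :
    HasSum (fun y => (G.addMass m).weight y * (grad u y * grad v y)) ⟪u, v⟫ := by
  have h := ((hasSum_norm_sq (u + v)).sub (hasSum_norm_sq (u - v))).div_const 4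
  rw [norm_add_sq_real, norm_sub_sq_real] at h
  convert! h using 1
  · funext y
    rw [FormSpace.grad_add, FormSpace.grad_sub]
    ring
  · ring

theorem inner_le_inner {u v u' v' : G.Dom m}
    (h : ∀ y, grad u y * grad v y ≤ grad u' y * grad v' y) : ⟪u, v⟫ ≤ ⟪u', v'⟫ :=
  hasSum_le (fun y => mul_le_mul_of_nonneg_left (h y) (weight_nonneg _ y))
    (hasSum_inner u v) (hasSum_inner u' v')

theorem norm_le {u v : G.Dom m} (h : ∀ y, |grad u y| ≤ |grad v y|) : ‖u‖ ≤ ‖v‖ :=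
  le_of_sq_le_sq (hasSum_le (fun y => mul_le_mul_of_nonneg_left (sq_le_sq.2 (h y))
    (weight_nonneg _ y)) (hasSum_norm_sq u) (hasSum_norm_sq v)) (norm_nonneg _)

theorem norm_sq_le {u v w : G.Dom m} {K : ℝ}
    (h : ∀ y, |grad u y| ≤ K * (|grad v y| + |grad w y|)) :
    ‖u‖ ^ 2 ≤ 2 * K ^ 2 * (‖v‖ ^ 2 + ‖w‖ ^ 2) :=
  hasSum_le (fun y =>
      (mul_le_mul_of_nonneg_left (sq_le_of_abs_le (h y)) (weight_nonneg _ y)).trans_eq (by ring))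
    (hasSum_norm_sq u) (((hasSum_norm_sq v).add (hasSum_norm_sq w)).mul_left (2 * K ^ 2))

/-- Composition with a normal contraction. -/
def comp {C : ℝ → ℝ} (hC : LipschitzWith 1 C) (h0 : C 0 = 0) (u : G.Dom m) : G.Dom m :=
  mk (fun x => C (u x))
    (((G.addMass m).energy_mono (abs_grad_comp_le hC h0 u)).trans_lt (energy_lt_top u))

@[simp] theorem comp_apply {C : ℝ → ℝ} (hC : LipschitzWith 1 C) (h0 : C 0 = 0) (u : G.Dom m)
    (x : X) : comp hC h0 u x = C (u x) := mk_apply _ _ x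

theorem norm_comp_le {C : ℝ → ℝ} (hC : LipschitzWith 1 C) (h0 : C 0 = 0) (u : G.Dom m) :
    ‖comp hC h0 u‖ ≤ ‖u‖ :=
  norm_le fun y => by
    rw [funext (comp_apply hC h0 u)]
    exact abs_grad_comp_le hC h0 u y

theorem incl_comp {C : ℝ → ℝ} (hC : LipschitzWith 1 C) (h0 : C 0 = 0) (u : G.Dom m) :
    FormSpace.incl (comp hC h0 u) = hC.compLp h0 (FormSpace.incl u) :=
  lp_ext fun x => by
    rw [compLp_apply, FormSpace.incl_apply, FormSpace.incl_apply, comp_apply]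

theorem exists_mul (u v : G.Dom m) {M : ℝ} (hu : ∀ x, |u x| ≤ M) (hv : ∀ x, |v x| ≤ M) :
    ∃ w : G.Dom m, ∀ x, w x = u x * v x :=
  exists_eq_of_abs_grad_le u v (K := M) fun y => by
    rcases y with ⟨x, y⟩ | x
    · calc |u x * v x - u y * v y| = |(u x - u y) * v x + u y * (v x - v y)| := by ring_nf
        _ ≤ |u x - u y| * |v x| + |u y| * |v x - v y| := by
            simpa only [abs_mul] using abs_add_le ((u x - u y) * v x) (u y * (v x - v y))
        _ ≤ |u x - u y| * M + M * |v x - v y| := by gcongr <;> apply_assumption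
        _ = M * (|u x - u y| + |v x - v y|) := by ring
    · have hM : 0 ≤ M := (abs_nonneg _).trans (hu x)
      calc |u x * v x| = |u x| * |v x| := abs_mul _ _
        _ ≤ M * |v x| := by gcongr; exact hu x
        _ ≤ M * (|u x| + |v x|) := by gcongr; exact le_add_of_nonneg_left (abs_nonneg (u x))

open Classical in
/-- The characteristic function of a point. -/
def dirac (z : X) : G.Dom m :=
  mk (fun x => if x = z then 1 else 0) ((G.addMass m).energy_dirac_lt_top z)

open Classical in
@[simp] theorem dirac_apply (z x : X) : (dirac z : G.Dom m) x = if x = z then 1 else 0 :=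
  mk_apply _ _ x

/-- The restriction of a function to a finite set. -/
def restrict (s : Finset X) (f : X → ℝ) : G.Dom m := ∑ z ∈ s, f z • dirac z

open Classical in
@[simp] theorem restrict_apply (s : Finset X) (f : X → ℝ) (x : X) :
    (restrict s f : G.Dom m) x = if x ∈ s then f x else 0 := by
  simp [restrict]

theorem restrict_eq_self {u : G.Dom m} {s : Finset X} (h : ∀ x ∉ s, u x = 0) :
    restrict s u = u := by
  classical
  refine DFunLike.ext _ _ fun x => ?_
  rw [restrict_apply]
  split_ifs with hx
  exacts [rfl, (h x hx).symm]

theorem summable_b_mul (u : G.Dom m) (x : X) : Summable fun y => G.b x y * (u x - u y) := by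
  have hsq : Summable fun y => G.b x y / 2 * (u x - u y) ^ 2 :=
    (hasSum_norm_sq u).summable.comp_injective (i := fun y => Sum.inl (x, y))
      (fun y y' hy => by simpa using hy)
  refine Summable.of_norm_bounded (hsq.add (G.b_summable x)) fun y => ?_
  have hb := G.b_nonneg x y
  rw [Real.norm_eq_abs, abs_mul, abs_of_nonneg hb]
  nlinarith [mul_nonneg hb (sq_nonneg (|u x - u y| - 1)), sq_abs (u x - u y)]

theorem summable_b_abs (u : G.Dom m) (x : X) : Summable fun y => G.b x y * |u y| := by
  refine Summable.of_nonneg_of_le (fun y => mul_nonneg (G.b_nonneg x y) (abs_nonneg _))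
    (fun y => ?_) ((summable_b_mul u x).abs.add ((G.b_summable x).mul_right |u x|))
  rw [abs_mul, abs_of_nonneg (G.b_nonneg x y), ← mul_add]
  refine mul_le_mul_of_nonneg_left ?_ (G.b_nonneg x y)
  rw [abs_sub_comm]
  exact sub_le_iff_le_add.1 (abs_sub_abs_le_abs_sub (u y) (u x))

theorem inner_dirac (u : G.Dom m) (z : X) :
    ⟪u, dirac z⟫ = ∑' y, G.b z y * (u z - u y) + (G.c z + m.real {z}) * u z := by
  classical
  have hrow := (summable_b_mul u z).hasSum.div_const 2
  have hfst := hasSum_prod_ite_fst hrow z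
  have hpairs := hfst.add ((Equiv.prodComm X X).hasSum_iff.2 hfst)
  rw [add_halves] at hpairs
  refine (hasSum_inner u (dirac z)).unique (HasSum.sum ?_ ?_)
  · convert! hpairs using 1
    funext ⟨x, y⟩
    by_cases hx : x = z <;> by_cases hy : y = z <;>
      simp [weight, addMass, hx, hy, G.b_symm z x] <;> ring
  · convert! hasSum_ite_eq z ((G.c z + m.real {z}) * u z) using 1
    funext x
    by_cases hx : x = z <;> simp [weight, addMass, hx]

end Dom

end WGraph

/-! ### The Royden decomposition -/

namespace WGraph

variable {X : Type*} [MeasurableSpace X] (G : WGraph X) (m : Measure X)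

variable {G m} in
theorem neumann_le_dirichlet : G.neumann m ≤ G.dirichlet m := fun f => by
  rw [dirichlet]
  split_ifs
  exacts [le_rfl, le_top]

variable [Countable X] [DiscreteMeasurableSpace X] [PosFiniteAtoms m]

/-- The finitely supported functions as a subspace of `D(Q^(N))`. -/
def finitelySupported : Submodule ℝ (G.Dom m) where
  carrier := {u | (Function.support u).Finite}
  zero_mem' := by
    rw [Set.mem_ofPred_eq, show Function.support (0 : G.Dom m) = ∅ by ext; simp]
    exact Set.finite_empty
  add_mem' {u v} hu hv := (hu.union hv).subset fun x hx => by
    contrapose! hx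
    simp_all
  smul_mem' c u hu := hu.subset fun x hx h => hx (by simp [h])

/-- `D(Q^(D))` as a closed subspace of `D(Q^(N))`. -/
def dirichletDomain : Submodule ℝ (G.Dom m) := (G.finitelySupported m).topologicalClosure

theorem isClosed_dirichletDomain : IsClosed (G.dirichletDomain m : Set (G.Dom m)) :=
  Submodule.isClosed_topologicalClosure _

instance : CompleteSpace (G.dirichletDomain m) := (G.isClosed_dirichletDomain m).completeSpace_coe

variable {G m}

theorem mem_dirichletDomain_of_finite_support {u : G.Dom m} (h : (Function.support u).Finite) :
    u ∈ G.dirichletDomain m :=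
  Submodule.le_topologicalClosure _ h

theorem restrict_mem_dirichletDomain (s : Finset X) (f : X → ℝ) :
    (Dom.restrict s f : G.Dom m) ∈ G.dirichletDomain m := by
  classical
  refine mem_dirichletDomain_of_finite_support (s.finite_toSet.subset fun x hx => ?_)
  by_contra h
  exact hx ((Dom.restrict_apply s f x).trans (if_neg h))

theorem dirac_mem_dirichletDomain (x : X) : (Dom.dirac x : G.Dom m) ∈ G.dirichletDomain m := by
  simpa [Dom.restrict] using restrict_mem_dirichletDomain (G := G) (m := m) {x} 1

theorem inDirichletDomain_iff (u : G.Dom m) :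
    G.InDirichletDomain m (FormSpace.incl u) ↔ u ∈ G.dirichletDomain m := by
  have one_lt_iff (v : G.Dom m) {ε : ℝ} (hε : 0 ≤ ε) :
      one (G.neumann m) (FormSpace.incl u - FormSpace.incl v) < ENNReal.ofReal (ε ^ 2) ↔
        dist u v < ε := by
    rw [← map_sub, Dom.one_neumann_incl, ENNReal.ofReal_lt_ofReal_iff_of_nonneg (sq_nonneg _),
      sq_lt_sq₀ (norm_nonneg _) hε, dist_eq_norm]
  change _ ↔ u ∈ closure _
  constructor
  · rintro ⟨-, h⟩
    refine Metric.mem_closure_iff.2 fun ε hε => ?_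
    obtain ⟨g, hg, hlt⟩ := h (ENNReal.ofReal (ε ^ 2)) (ENNReal.ofReal_pos.2 (pow_pos hε 2))
    obtain ⟨v, rfl⟩ : ∃ v : G.Dom m, FormSpace.incl v = g :=
      ⟨Dom.restrict hg.toFinset g, lp_ext fun x => by
        classical
        rw [FormSpace.incl_apply, Dom.restrict_apply]
        split_ifs with hx
        · rfl
        · exact (not_not.1 (mt hg.mem_toFinset.2 hx)).symm⟩
    exact ⟨v, hg, (one_lt_iff v hε.le).1 hlt⟩
  · intro h
    refine ⟨Dom.neumann_incl_lt_top u, fun ε hε => ?_⟩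
    obtain ⟨δ, hδ, hδε⟩ : ∃ δ : ℝ, 0 < δ ∧ ENNReal.ofReal (δ ^ 2) < ε := by
      have hlim := tendsto_ofReal_sq_zero_iff.2 (tendsto_id.mono_left nhdsWithin_le_nhds :
        Tendsto id (𝓝[>] (0 : ℝ)) (𝓝 0))
      exact ((eventually_mem_nhdsWithin).and (hlim.eventually (gt_mem_nhds hε))).exists
    obtain ⟨v, hv, hlt⟩ := Metric.mem_closure_iff.1 h δ hδ
    exact ⟨FormSpace.incl v, hv, ((one_lt_iff v hδ.le).2 hlt).trans hδε⟩

theorem dirichlet_incl_of_mem {u : G.Dom m} (h : u ∈ G.dirichletDomain m) :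
    G.dirichlet m (FormSpace.incl u) = G.neumann m (FormSpace.incl u) := by
  rw [dirichlet, if_pos ((inDirichletDomain_iff u).2 h)]

theorem dirichlet_incl_lt_top_iff (u : G.Dom m) :
    G.dirichlet m (FormSpace.incl u) < ⊤ ↔ u ∈ G.dirichletDomain m := by
  rw [dirichlet, inDirichletDomain_iff]
  split_ifs with h
  · exact iff_of_true (Dom.neumann_incl_lt_top u) h
  · exact iff_of_false (lt_irrefl _) h

theorem mem_dirichletDomain_of_tendsto {α : Type*} {l : Filter α} [l.NeBot] {u : α → G.Dom m}
    {u₀ : G.Dom m} {R : ℝ} (hu : ∀ n, u n ∈ G.dirichletDomain m) (hb : ∀ n, ‖u n‖ ≤ R)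
    (he : ∀ x, Tendsto (fun n => u n x) l (𝓝 (u₀ x))) : u₀ ∈ G.dirichletDomain m := by
  rw [← Submodule.orthogonal_orthogonal (G.dirichletDomain m), Submodule.mem_orthogonal']
  intro w hw
  have hlim := FormSpace.tendsto_inner hb he w
  simp only [(Submodule.mem_orthogonal _ _).1 hw _ (hu _)] at hlim
  exact tendsto_nhds_unique hlim tendsto_const_nhds

/-- `D(Q^(D))` is an order ideal: clamping `u` by approximations of `w` gives approximations of
`u`. -/
theorem mem_dirichletDomain_of_abs_le {u w : G.Dom m} (hw : w ∈ G.dirichletDomain m)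
    (h : ∀ x, |u x| ≤ |w x|) : u ∈ G.dirichletDomain m := by
  obtain ⟨v, hv, hlim⟩ := mem_closure_iff_seq_limit.1 hw
  choose c hc using fun n =>
    Dom.exists_eq_of_abs_grad_le u (v n) (abs_grad_clamp_le (u : X → ℝ) (v n))
  have c_mem (n) : c n ∈ G.dirichletDomain m :=
    mem_dirichletDomain_of_finite_support <| (hv n).subset fun x hx hvx =>
      hx (by rw [hc, hvx, abs_zero, clamp_zero_left])
  obtain ⟨R, hR⟩ := hlim.norm.bddAbove_range
  refine mem_dirichletDomain_of_tendsto (l := atTop) (R := √(2 * 1 ^ 2 * (‖u‖ ^ 2 + R ^ 2)))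
    c_mem (fun n => Real.le_sqrt_of_sq_le ?_) fun x => ?_
  · refine (Dom.norm_sq_le (v := u) (w := v n) (K := 1) fun y => ?_).trans ?_
    · exact (funext (hc n) : ⇑(c n) = _) ▸ abs_grad_clamp_le (u : X → ℝ) (v n) y
    · gcongr
      exact hR ⟨n, rfl⟩
  · have hcont : Continuous fun v : G.Dom m => clamp |v x| (u x) :=
      (continuous_clamp_left (u x)).comp (FormSpace.eval x).continuous.abs
    simpa only [hc, Function.comp_def, clamp_eq_self (h x)] using (hcont.tendsto w).comp hlim

theorem comp_mem_dirichletDomain {C : ℝ → ℝ} (hC : LipschitzWith 1 C) (h0 : C 0 = 0) {u : G.Dom m}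
    (hu : u ∈ G.dirichletDomain m) : Dom.comp hC h0 u ∈ G.dirichletDomain m :=
  mem_dirichletDomain_of_abs_le hu fun x => by
    rw [Dom.comp_apply]
    exact abs_le_of_lipschitzWith hC h0 _

theorem mem_orthogonal_dirichletDomain_iff (u : G.Dom m) :
    u ∈ (G.dirichletDomain m)ᗮ ↔ ∀ x, ⟪u, Dom.dirac x⟫ = 0 := by
  refine ⟨fun h x => (Submodule.mem_orthogonal' _ _).1 h _ (dirac_mem_dirichletDomain x),
    fun h => ?_⟩
  rw [dirichletDomain, Submodule.orthogonal_closure, Submodule.mem_orthogonal']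
  intro v hv
  have hv' : Dom.restrict hv.toFinset v = v :=
    Dom.restrict_eq_self fun x hx => not_not.1 (mt hv.mem_toFinset.2 hx)
  rw [← hv', Dom.restrict, inner_sum]
  exact Finset.sum_eq_zero fun x _ => by rw [real_inner_smul_right, h, mul_zero]

theorem isOneHarmonic_iff (u : G.Dom m) :
    G.IsOneHarmonic m u ↔ u ∈ (G.dirichletDomain m)ᗮ := by
  rw [mem_orthogonal_dirichletDomain_iff, IsOneHarmonic,
    and_iff_right (Dom.summable_b_abs u)]
  refine forall_congr' fun x => ?_
  have hm := measureReal_singleton_pos m x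
  have hlap : G.laplacian m u x + u x = ⟪u, Dom.dirac x⟫ / m.real {x} := by
    rw [Dom.inner_dirac, laplacian]
    field_simp
    ring
  rw [hlap, div_eq_zero_iff, or_iff_left hm.ne']

/-- The `1`-harmonic part of a function in `D(Q^(N))` in its Royden decomposition. -/
def harmonicPart : G.Dom m →L[ℝ] G.Dom m := (G.dirichletDomain m)ᗮ.starProjection

theorem harmonicPart_mem (u : G.Dom m) : harmonicPart u ∈ (G.dirichletDomain m)ᗮ :=
  Submodule.starProjection_apply_mem _ _

theorem sub_harmonicPart_mem (u : G.Dom m) : u - harmonicPart u ∈ G.dirichletDomain m := by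
  rw [harmonicPart, Submodule.starProjection_orthogonal_val, sub_sub_cancel]
  exact Submodule.starProjection_apply_mem _ _

theorem harmonicPart_eq_of_sub_mem {u h : G.Dom m} (hu : u - h ∈ G.dirichletDomain m)
    (hh : h ∈ (G.dirichletDomain m)ᗮ) : harmonicPart u = h :=
  Submodule.eq_starProjection_of_mem_orthogonal hh (Submodule.le_orthogonal_orthogonal _ hu)

theorem harmonicPart_eq_zero_iff {u : G.Dom m} : harmonicPart u = 0 ↔ u ∈ G.dirichletDomain m := by
  rw [harmonicPart, Submodule.starProjection_apply_eq_zero_iff, Submodule.orthogonal_orthogonal]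

theorem harmonicPart_eq_self {u : G.Dom m} (h : u ∈ (G.dirichletDomain m)ᗮ) : harmonicPart u = u :=
  Submodule.starProjection_eq_self_iff.2 h

theorem inner_harmonicPart_left (u v : G.Dom m) : ⟪harmonicPart u, v⟫ = ⟪u, harmonicPart v⟫ :=
  Submodule.inner_starProjection_left_eq_right _ u v

theorem norm_sq_eq_add_harmonicPart (u : G.Dom m) :
    ‖u‖ ^ 2 = ‖u - harmonicPart u‖ ^ 2 + ‖harmonicPart u‖ ^ 2 := by
  simpa [harmonicPart] using Submodule.norm_sq_eq_add_norm_sq_starProjection u (G.dirichletDomain m)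

/-! ### The maximum principle -/

theorem le_of_slice_mem {h : G.Dom m} (hh : h ∈ (G.dirichletDomain m)ᗮ) {s : ℝ} (hs : 0 ≤ s)
    (hw : Dom.comp (lipschitzWith_slice s) (slice_zero hs) h ∈ G.dirichletDomain m) (x : X) :
    h x ≤ s := by
  set w := Dom.comp (lipschitzWith_slice s) (slice_zero hs) h with w_def
  have hle : ⟪w, w⟫ ≤ ⟪h, w⟫ := Dom.inner_le_inner fun y => by
    rcases y with p | x
    · simpa [w_def] using slice_sub_mul_self_le s (h p.1) (h p.2)
    · simpa [w_def, slice_zero hs] using slice_sub_mul_self_le s (h x) 0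
  rw [(Submodule.mem_orthogonal' _ _).1 hh w hw] at hle
  have w_eq_zero : w = 0 := inner_self_eq_zero.1 (le_antisymm hle real_inner_self_nonneg)
  rw [← slice_eq_zero_iff, ← Dom.comp_apply (lipschitzWith_slice s) (slice_zero hs) h x, ← w_def,
    w_eq_zero, FormSpace.zero_apply]

theorem harmonicPart_le_of_slice_mem {u v : G.Dom m} {s : ℝ} (hs : 0 ≤ s)
    (hv : v ∈ G.dirichletDomain m) (hvu : ∀ x, v x = slice s (u x)) (x : X) :
    harmonicPart u x ≤ s := by
  have habs := comp_mem_dirichletDomain lipschitzWith_abs abs_zero (sub_harmonicPart_mem u)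
  refine le_of_slice_mem (harmonicPart_mem u) hs
    (mem_dirichletDomain_of_abs_le (Submodule.add_mem _ hv habs) fun x => ?_) x
  simp only [Dom.comp_apply, FormSpace.add_apply, FormSpace.sub_apply, hvu]
  rw [abs_of_nonneg (slice_nonneg _ _),
    abs_of_nonneg (add_nonneg (slice_nonneg _ _) (abs_nonneg _))]
  have hle := abs_sub_le_of_lipschitzWith (lipschitzWith_slice s) (harmonicPart u x) (u x)
  rw [abs_sub_comm (harmonicPart u x)] at hle
  linarith [le_abs_self (slice s (harmonicPart u x) - slice s (u x))]

theorem harmonicPart_le {u : G.Dom m} {s : ℝ} (hs : 0 ≤ s) (h : ∀ x, u x ≤ s) (x : X) :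
    harmonicPart u x ≤ s :=
  harmonicPart_le_of_slice_mem hs (Submodule.zero_mem _)
    (fun x => by rw [slice_eq_zero_iff.2 (h x), FormSpace.zero_apply]) x

theorem harmonicPart_nonneg {u : G.Dom m} (h : ∀ x, 0 ≤ u x) (x : X) : 0 ≤ harmonicPart u x := by
  simpa using harmonicPart_le (u := -u) le_rfl (fun x => by simpa using h x) x

theorem harmonicPart_mono {u v : G.Dom m} (h : ∀ x, u x ≤ v x) (x : X) :
    harmonicPart u x ≤ harmonicPart v x := by
  simpa using harmonicPart_nonneg (u := v - u) (fun x => by simpa using h x) x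

theorem eq_zero_of_nonneg_of_apply_eq_zero (hG : G.Connected) {h : G.Dom m}
    (hh : h ∈ (G.dirichletDomain m)ᗮ) (hpos : ∀ x, 0 ≤ h x) {o : X} (ho : h o = 0) : h = 0 := by
  have eq_zero_of_adj {x y : X} (hx : h x = 0) (hb : 0 < G.b x y) : h y = 0 := by
    have hinner := (mem_orthogonal_dirichletDomain_iff h).1 hh x
    simp only [Dom.inner_dirac, hx, zero_sub, mul_neg, mul_zero, add_zero, tsum_neg,
      neg_eq_zero] at hinner
    have hsum : Summable fun y => G.b x y * h y := by
      simpa only [abs_of_nonneg (hpos _)] using Dom.summable_b_abs h x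
    have hzero := (hasSum_zero_iff_of_nonneg
      fun y => mul_nonneg (G.b_nonneg x y) (hpos y)).1 (hinner ▸ hsum.hasSum)
    exact (mul_eq_zero_iff_left (ne_of_gt hb)).1 (congrFun hzero y)
  refine DFunLike.ext _ _ fun x => ?_
  rw [FormSpace.zero_apply]
  induction hG o x with
  | refl => exact ho
  | tail _ hb ih => exact eq_zero_of_adj ih hb

end WGraph

/-! ### Boundary values -/

theorem lipschitzWith_arctan : LipschitzWith 1 Real.arctan := by
  refine lipschitzWith_of_nnnorm_deriv_le Real.differentiable_arctan fun x => ?_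
  rw [← NNReal.coe_le_coe, coe_nnnorm, Real.deriv_arctan, Real.norm_eq_abs,
    abs_of_nonneg (by positivity), NNReal.coe_one, div_le_one (by positivity)]
  linarith [sq_nonneg x]

theorem tendsto_trichotomy_of_tendsto_arctan {α : Type*} {l : Filter α} [l.NeBot] {u : α → ℝ}
    {a : ℝ} (h : Tendsto (fun x => Real.arctan (u x)) l (𝓝 a)) :
    Tendsto u l (𝓝 (Real.tan a)) ∨ Tendsto u l atTop ∨ Tendsto u l atBot := by
  have hle : a ≤ Real.pi / 2 :=
    le_of_tendsto h (Eventually.of_forall fun x => (Real.arctan_lt_pi_div_two _).le)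
  have hge : -(Real.pi / 2) ≤ a :=
    ge_of_tendsto h (Eventually.of_forall fun x => (Real.neg_pi_div_two_lt_arctan _).le)
  rcases hle.eq_or_lt with rfl | hlt
  · refine .inr (.inl (tendsto_atTop.2 fun r => ?_))
    filter_upwards [h.eventually (lt_mem_nhds (Real.arctan_lt_pi_div_two r))] with x hx
    exact (Real.arctan_strictMono.lt_iff_lt.1 hx).le
  rcases hge.eq_or_lt with rfl | hgt
  · refine .inr (.inr (tendsto_atBot.2 fun r => ?_))
    filter_upwards [h.eventually (gt_mem_nhds (Real.neg_pi_div_two_lt_arctan r))] with x hx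
    exact (Real.arctan_strictMono.lt_iff_lt.1 hx).le
  · have hcont : ContinuousAt Real.tan a :=
      Real.continuousAt_tan.2 (Real.cos_pos_of_mem_Ioo ⟨hgt, hlt⟩).ne'
    exact .inl ((hcont.tendsto.comp h).congr fun x => Real.tan_arctan _)

namespace WGraph

section Compactification

variable {X : Type*} [MeasurableSpace X] {G : WGraph X} {m : Measure X}

instance : T2Space (G.Compactification m) :=
  inferInstanceAs (T2Space {z : G.BddDomain m → ℝ // z ∈ closure (Set.range (G.evalMap m))})

instance : CompactSpace (G.Compactification m) := by
  refine isCompact_iff_compactSpace.1 ?_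
  choose M hM using fun f : G.BddDomain m => f.2.2
  refine IsCompact.of_isClosed_subset
    (isCompact_univ_pi fun f => isCompact_Icc (a := -M f) (b := M f)) isClosed_closure ?_
  refine closure_minimal ?_ (isClosed_set_pi fun f _ => isClosed_Icc)
  rintro _ ⟨x, rfl⟩ f -
  exact abs_le.1 (hM f x)

theorem continuous_coord (f : G.BddDomain m) :
    Continuous fun z : G.Compactification m => z.1 f :=
  (continuous_apply f).comp continuous_subtype_val

theorem denseRange_embed : DenseRange (G.embed m) := by
  intro z
  refine closure_subtype.2 (closure_mono ?_ z.2)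
  rintro _ ⟨x, rfl⟩
  exact ⟨G.embed m x, ⟨x, rfl⟩, rfl⟩

/-- The trace on `X` of the neighbourhoods of a point of the compactification. -/
def nhdsX (z : G.Compactification m) : Filter X := comap (G.embed m) (𝓝 z)

instance (z : G.Compactification m) : (nhdsX z).NeBot :=
  comap_neBot_iff.2 fun _ ht => by
    obtain ⟨_, hmem, x, rfl⟩ := mem_closure_iff_nhds.1 (denseRange_embed z) _ ht
    exact ⟨x, hmem⟩

theorem tendsto_coord (f : G.BddDomain m) (z : G.Compactification m) :
    Tendsto (fun x => f.1 x) (nhdsX z) (𝓝 (z.1 f)) :=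
  ((continuous_coord f).tendsto z).comp tendsto_comap

theorem coord_eq_of_tendsto {f : G.BddDomain m} {z : G.Compactification m} {a : ℝ}
    (h : Tendsto (fun x => f.1 x) (nhdsX z) (𝓝 a)) : z.1 f = a :=
  tendsto_nhds_unique (tendsto_coord f z) h

instance : T2Space (G.Boundary m) :=
  inferInstanceAs (T2Space {z : G.Compactification m // z ∉ Set.range (G.embed m) ∧
    ∀ f : G.BddDomain m, G.dirichlet m f.1 < ⊤ → z.1 f = 0})

theorem continuous_preTrace (f : G.BddDomain m) : Continuous (G.preTrace m f) :=
  (continuous_coord f).comp continuous_subtype_val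

theorem measurable_ofReal_preTrace_sq (f : G.BddDomain m) :
    Measurable fun ζ => ENNReal.ofReal (G.preTrace m f ζ ^ 2) :=
  ((continuous_preTrace f).measurable.pow_const 2).ennreal_ofReal

end Compactification

variable {X : Type*} [MeasurableSpace X] [Countable X] [DiscreteMeasurableSpace X]
  {G : WGraph X} {m : Measure X} [PosFiniteAtoms m]

namespace Dom

/-- A bounded element of `D(Q^(N))` as an element of `D(Q^(N)) ∩ ℓ^∞(X)`. -/
def toBdd (u : G.Dom m) (hu : ∃ M : ℝ, ∀ x, |u x| ≤ M) : G.BddDomain m :=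
  ⟨FormSpace.incl u, neumann_incl_lt_top u, hu⟩

/-- An element of `D(Q^(N)) ∩ ℓ^∞(X)` as an element of `D(Q^(N))`. -/
def ofBdd (f : G.BddDomain m) : G.Dom m := ofLp f.1 f.2.1

theorem ofBdd_apply (f : G.BddDomain m) (x : X) : ofBdd f x = f.1 x := rfl

theorem toBdd_apply (u : G.Dom m) (hu : ∃ M : ℝ, ∀ x, |u x| ≤ M) (x : X) :
    (toBdd u hu).1 x = u x := rfl

theorem exists_abs_ofBdd_le (f : G.BddDomain m) : ∃ M : ℝ, ∀ x, |ofBdd f x| ≤ M := f.2.2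

theorem abs_dirac_le (z x : X) : |(dirac z : G.Dom m) x| ≤ 1 := by
  classical
  rw [dirac_apply]
  split_ifs <;> simp

/-- The characteristic function of a point as an element of `D(Q^(N)) ∩ ℓ^∞(X)`. -/
def diracBdd (x : X) : G.BddDomain m := toBdd (dirac x) ⟨1, abs_dirac_le x⟩

end Dom

theorem eq_embed_of_coord_diracBdd {z : G.Compactification m} {x : X}
    (h : 1 / 2 < z.1 (Dom.diracBdd x)) : z = G.embed m x := by
  classical
  have eventually_eq : ∀ᶠ y in nhdsX z, y = x := by
    filter_upwards [(tendsto_coord _ z).eventually (lt_mem_nhds h)] with y hy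
    rw [Dom.diracBdd, Dom.toBdd_apply, Dom.dirac_apply] at hy
    by_contra hne
    rw [if_neg hne] at hy
    norm_num at hy
  exact Subtype.ext <| funext fun f => coord_eq_of_tendsto <|
    tendsto_const_nhds.congr' (eventually_eq.mono fun y hy => by rw [hy]; rfl)

theorem coord_embed_diracBdd (x : X) : (G.embed m x).1 (Dom.diracBdd x) = 1 := by
  classical
  exact (Dom.dirac_apply x x).trans (if_pos rfl)

theorem isOpen_range_embed : IsOpen (Set.range (G.embed m)) := by
  rw [isOpen_iff_mem_nhds]
  rintro _ ⟨x, rfl⟩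
  have h : ∀ᶠ z in 𝓝 (G.embed m x), 1 / 2 < z.1 (Dom.diracBdd x) :=
    ((continuous_coord _).tendsto _).eventually (lt_mem_nhds (by
      rw [coord_embed_diracBdd]; norm_num))
  filter_upwards [h] with z hz
  exact ⟨x, (eq_embed_of_coord_diracBdd hz).symm⟩

instance : CompactSpace (G.Boundary m) := by
  refine isCompact_iff_compactSpace.1 (IsClosed.isCompact ?_)
  refine IsClosed.and (p₁ := fun z => z ∉ Set.range (G.embed m))
    isOpen_range_embed.isClosed_compl ?_
  simp only [Set.ofPred_forall]
  exact isClosed_iInter fun f => isClosed_iInter fun _ =>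
    isClosed_eq (continuous_coord f) continuous_const

theorem exists_coord_ne_zero {z : G.Compactification m} (h : ∀ ζ : G.Boundary m, ζ.1 ≠ z) :
    ∃ f : G.BddDomain m, Dom.ofBdd f ∈ G.dirichletDomain m ∧ z.1 f ≠ 0 := by
  by_cases hz : z ∈ Set.range (G.embed m)
  · obtain ⟨x, rfl⟩ := hz
    refine ⟨Dom.diracBdd x, dirac_mem_dirichletDomain x, ?_⟩
    rw [coord_embed_diracBdd]
    exact one_ne_zero
  · by_contra! hcon
    exact h ⟨z, hz, fun f hf => hcon f ((dirichlet_incl_lt_top_iff (Dom.ofBdd f)).1 hf)⟩ rfl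

theorem exists_dominating_of_isCompact {K : Set (G.Compactification m)} (hK : IsCompact K)
    (h : ∀ ζ : G.Boundary m, ζ.1 ∉ K) :
    ∃ w ∈ G.dirichletDomain m, (∀ x, 0 ≤ w x) ∧ ∀ x, G.embed m x ∈ K → 1 ≤ w x := by
  refine hK.induction_on (p := fun s => ∃ w ∈ G.dirichletDomain m, (∀ x, 0 ≤ w x) ∧
    ∀ x, G.embed m x ∈ s → 1 ≤ w x) ?_ ?_ ?_ ?_
  · exact ⟨0, Submodule.zero_mem _, by simp, fun x hx => hx.elim⟩
  · rintro s t hst ⟨w, hw, hpos, hone⟩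
    exact ⟨w, hw, hpos, fun x hx => hone x (hst hx)⟩
  · rintro s t ⟨w, hw, hpos, hone⟩ ⟨w', hw', hpos', hone'⟩
    refine ⟨w + w', Submodule.add_mem _ hw hw', fun x => ?_, fun x hx => ?_⟩ <;>
      rw [FormSpace.add_apply]
    · exact add_nonneg (hpos x) (hpos' x)
    · rcases hx with hx | hx
      · linarith [hone x hx, hpos' x]
      · linarith [hone' x hx, hpos x]
  · intro z hz
    obtain ⟨f, hf, hne⟩ := exists_coord_ne_zero (z := z) fun ζ hζ => h ζ (hζ ▸ hz)
    have hhalf : 0 < |z.1 f| / 2 := by positivity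
    refine ⟨{z' | |z.1 f| / 2 < |z'.1 f|}, mem_nhdsWithin_of_mem_nhds ?_,
      (|z.1 f| / 2)⁻¹ • Dom.comp lipschitzWith_abs abs_zero (Dom.ofBdd f),
      Submodule.smul_mem _ _ (comp_mem_dirichletDomain _ _ hf), fun x => ?_, fun x hx => ?_⟩
    · exact ((continuous_coord f).abs.tendsto z).eventually (lt_mem_nhds (by linarith))
    · rw [FormSpace.smul_apply, Dom.comp_apply]
      positivity
    · rw [FormSpace.smul_apply, Dom.comp_apply, inv_mul_eq_div, one_le_div hhalf]
      exact hx.le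

theorem sub_comp_clamp_mem_dirichletDomain {v : G.Dom m} (hv : ∃ M : ℝ, ∀ x, |v x| ≤ M)
    (h : ∀ ζ : G.Boundary m, G.preTrace m (v.toBdd hv) ζ = 0) {ε : ℝ} (hε : 0 < ε) :
    v - Dom.comp (lipschitzWith_clamp ε) (clamp_zero hε.le) v ∈ G.dirichletDomain m := by
  let K : Set (G.Compactification m) := {z | ε ≤ |z.1 (v.toBdd hv)|}
  have hK : IsCompact K := (isClosed_le continuous_const (continuous_coord _).abs).isCompact
  obtain ⟨w, hw, hpos, hone⟩ := exists_dominating_of_isCompact hK fun ζ (hζ : ε ≤ |_|) => by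
    have h_zero : ζ.1.1 (v.toBdd hv) = 0 := h ζ
    rw [h_zero, abs_zero] at hζ
    exact hζ.not_gt hε
  obtain ⟨M, hM⟩ := hv
  refine mem_dirichletDomain_of_abs_le (w := (M + ε) • w) (Submodule.smul_mem _ _ hw) fun x => ?_
  have hMε : 0 ≤ M + ε := add_nonneg ((abs_nonneg _).trans (hM x)) hε.le
  rw [FormSpace.sub_apply, Dom.comp_apply, FormSpace.smul_apply,
    abs_of_nonneg (mul_nonneg hMε (hpos x))]
  rcases le_total |v x| ε with hx | hx
  · rw [clamp_eq_self hx, sub_self, abs_zero]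
    exact mul_nonneg hMε (hpos x)
  · calc |v x - clamp ε (v x)| ≤ |v x| + |clamp ε (v x)| := abs_sub _ _
      _ ≤ (M + ε) * 1 := by rw [mul_one]; exact add_le_add (hM x) (abs_clamp_le hε.le _)
      _ ≤ (M + ε) * w x := mul_le_mul_of_nonneg_left (hone x hx) hMε

theorem mem_dirichletDomain_of_preTrace_eq_zero {v : G.Dom m} (hv : ∃ M : ℝ, ∀ x, |v x| ≤ M)
    (h : ∀ ζ : G.Boundary m, G.preTrace m (v.toBdd hv) ζ = 0) : v ∈ G.dirichletDomain m := by
  let ε (n : ℕ) : ℝ := 1 / ((n : ℝ) + 1)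
  have hε (n : ℕ) : 0 < ε n := Nat.one_div_pos_of_nat
  refine mem_dirichletDomain_of_tendsto (l := atTop) (R := ‖v‖ + ‖v‖)
    (fun n => sub_comp_clamp_mem_dirichletDomain hv h (hε n))
    (fun n => (norm_sub_le _ _).trans (by gcongr; exact Dom.norm_comp_le _ _ v)) fun x => ?_
  have hlim : Tendsto (fun n => clamp (ε n) (v x)) atTop (𝓝 0) :=
    squeeze_zero_norm (fun n => abs_clamp_le (hε n).le (v x))
      tendsto_one_div_add_atTop_nhds_zero_nat
  simpa using hlim.const_sub (v x)

theorem preTrace_eq_zero_of_mem {f : G.BddDomain m} (h : Dom.ofBdd f ∈ G.dirichletDomain m)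
    (ζ : G.Boundary m) : G.preTrace m f ζ = 0 :=
  ζ.2.2 f ((dirichlet_incl_lt_top_iff (Dom.ofBdd f)).2 h)

theorem harmonicPart_le_of_tendsto_boundary {u : G.Dom m} {s : ℝ} (hs : 0 ≤ s)
    (h : ∀ ζ : G.Boundary m, ∃ a ≤ s, Tendsto u (nhdsX ζ.1) (𝓝 a)) (x : X) :
    harmonicPart u x ≤ s := by
  let v := Dom.comp (lipschitzWith_slice s) (slice_zero hs) u
  have hv : ∃ M : ℝ, ∀ x, |v x| ≤ M := ⟨1, fun x => by
    rw [Dom.comp_apply, abs_of_nonneg (slice_nonneg _ _)]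
    exact slice_le_one _ _⟩
  refine harmonicPart_le_of_slice_mem (v := v) hs
    (mem_dirichletDomain_of_preTrace_eq_zero hv fun ζ => ?_) (fun x => Dom.comp_apply _ _ _ _) x
  obtain ⟨a, ha, hlim⟩ := h ζ
  refine (coord_eq_of_tendsto (a := slice s a) ?_).trans (slice_eq_zero_iff.2 ha)
  refine (((lipschitzWith_slice s).continuous.tendsto a).comp hlim).congr fun x => ?_
  rw [Dom.toBdd_apply, Dom.comp_apply, Function.comp]

/-- `arctan ∘ u` as an element of `D(Q^(N)) ∩ ℓ^∞(X)`, by which an unbounded `u` is extended to the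
compactification. -/
def Dom.arctan (u : G.Dom m) : G.BddDomain m :=
  Dom.toBdd (Dom.comp lipschitzWith_arctan Real.arctan_zero u) ⟨Real.pi / 2, fun x => by
    rw [Dom.comp_apply]
    exact abs_le.2 ⟨(Real.neg_pi_div_two_lt_arctan _).le, (Real.arctan_lt_pi_div_two _).le⟩⟩

theorem tendsto_trichotomy (u : G.Dom m) (z : G.Compactification m) :
    Tendsto u (nhdsX z) (𝓝 (Real.tan (z.1 u.arctan))) ∨
      Tendsto u (nhdsX z) atTop ∨ Tendsto u (nhdsX z) atBot :=
  tendsto_trichotomy_of_tendsto_arctan <|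
    (tendsto_coord u.arctan z).congr fun x => Dom.comp_apply _ _ u x

theorem tendsto_boundaryValue (u : G.Dom m) (ζ : G.Boundary m) :
    Tendsto (fun x => (u x : EReal)) (nhdsX ζ.1) (𝓝 (G.boundaryValue m u ζ)) := by
  refine tendsto_nhds_limUnder ?_
  rcases tendsto_trichotomy u ζ.1 with h | h | h
  · exact ⟨_, (continuous_coe_real_ereal.tendsto _).comp h⟩
  · exact ⟨⊤, EReal.tendsto_coe_nhds_top_iff.2 h⟩
  · exact ⟨⊥, EReal.tendsto_coe_nhds_bot_iff.2 h⟩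

theorem boundaryValue_eq_coe_iff {u : G.Dom m} {ζ : G.Boundary m} {r : ℝ} :
    G.boundaryValue m u ζ = (r : EReal) ↔ Tendsto u (nhdsX ζ.1) (𝓝 r) := by
  refine ⟨fun hr => EReal.tendsto_coe.1 (hr ▸ tendsto_boundaryValue u ζ), fun hr => ?_⟩
  exact tendsto_nhds_unique (tendsto_boundaryValue u ζ)
    ((continuous_coe_real_ereal.tendsto _).comp hr)

end WGraph

/-! ### Harmonic measure -/

section Representation

theorem exists_linearMap_comp_eq_of_le_sublinear {E V : Type*} [AddCommGroup E] [Module ℝ E]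
    [AddCommGroup V] [Module ℝ V] {N : E → ℝ} (N_hom : ∀ c : ℝ, 0 < c → ∀ x, N (c • x) = c * N x)
    (N_add : ∀ x y, N (x + y) ≤ N x + N y) (r : V →ₗ[ℝ] E) (ℓ : V →ₗ[ℝ] ℝ)
    (h : ∀ v, ℓ v ≤ N (r v)) : ∃ Φ : E →ₗ[ℝ] ℝ, Φ ∘ₗ r = ℓ ∧ ∀ x, Φ x ≤ N x := by
  have N_zero : N 0 = 0 := by
    have := N_hom 2 two_pos 0
    rw [smul_zero] at this
    linarith
  have eq_zero_of_mem_ker : ∀ v ∈ LinearMap.ker r, ℓ v = 0 := by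
    intro v hv
    have hle := h v
    have hge := h (-v)
    rw [map_neg, map_neg, LinearMap.mem_ker.1 hv, neg_zero, N_zero] at hge
    rw [LinearMap.mem_ker.1 hv, N_zero] at hle
    linarith
  obtain ⟨g, hg⟩ : ℓ ∈ LinearMap.range r.dualMap := by
    rw [LinearMap.range_dualMap_eq_dualAnnihilator_ker]
    exact (Submodule.mem_dualAnnihilator ℓ).2 eq_zero_of_mem_ker
  have hgr (v : V) : g (r v) = ℓ v := LinearMap.congr_fun hg v
  obtain ⟨Φ, hΦ, hΦN⟩ := exists_extension_of_le_sublinear ⟨LinearMap.range r, g.domRestrict _⟩ N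
    N_hom N_add (by rintro ⟨_, v, rfl⟩; exact (hgr v).trans_le (h v))
  exact ⟨Φ, LinearMap.ext fun v => (hΦ ⟨r v, v, rfl⟩).trans (hgr v), hΦN⟩

variable {Y : Type*} [TopologicalSpace Y] [CompactSpace Y]

theorem norm_posPart_add_le (φ ψ : C(Y, ℝ)) : ‖(φ + ψ)⁺‖ ≤ ‖φ⁺‖ + ‖ψ⁺‖ := by
  refine (ContinuousMap.norm_le _ (by positivity)).2 fun y => ?_
  have hφ := (le_abs_self _).trans (φ⁺.norm_coe_le_norm y)
  have hψ := (le_abs_self _).trans (ψ⁺.norm_coe_le_norm y)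
  simp only [posPart_def, ContinuousMap.sup_apply, ContinuousMap.add_apply,
    ContinuousMap.zero_apply, Real.norm_eq_abs, sup_le_iff] at hφ hψ ⊢
  rw [abs_of_nonneg le_sup_right]
  exact sup_le (add_le_add hφ.1 hψ.1) (add_nonneg hφ.2 hψ.2)

theorem norm_posPart_smul {c : ℝ} (hc : 0 ≤ c) (φ : C(Y, ℝ)) : ‖(c • φ)⁺‖ = c * ‖φ⁺‖ := by
  have smul_posPart : (c • φ)⁺ = c • φ⁺ := by
    ext y
    simp only [posPart_def, ContinuousMap.sup_apply, ContinuousMap.smul_apply,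
      ContinuousMap.zero_apply, smul_eq_mul, mul_max_of_nonneg _ _ hc, mul_zero]
  rw [smul_posPart, norm_smul, Real.norm_of_nonneg hc]

open CompactlySupported in
theorem exists_regular_measure_integral_eq [T2Space Y] [MeasurableSpace Y] [BorelSpace Y]
    {Φ : C(Y, ℝ) →ₗ[ℝ] ℝ} (h : ∀ φ, Φ φ ≤ ‖φ⁺‖) :
    ∃ μ : Measure Y, μ.Regular ∧ μ Set.univ ≤ 1 ∧ ∀ φ : C(Y, ℝ), ∫ y, φ y ∂μ = Φ φ := by
  have Φ_nonneg {φ : C(Y, ℝ)} (hφ : 0 ≤ φ) : 0 ≤ Φ φ := by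
    simpa [posPart_eq_zero.2 (neg_nonpos.2 hφ)] using h (-φ)
  let Λ : C_c(Y, ℝ) →ₚ[ℝ] ℝ :=
    { toFun := fun g => Φ g.toContinuousMap
      map_add' := fun g g' => Φ.map_add g.toContinuousMap g'.toContinuousMap
      map_smul' := fun c g => Φ.map_smul c g.toContinuousMap
      monotone' := fun g g' hg => by
        have := Φ_nonneg (φ := g'.toContinuousMap - g.toContinuousMap) (sub_nonneg.2 hg)
        rwa [map_sub, sub_nonneg] at this }
  have integral_eq (φ : C(Y, ℝ)) : ∫ y, φ y ∂(RealRMK.rieszMeasure Λ) = Φ φ :=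
    RealRMK.integral_rieszMeasure Λ ⟨φ, HasCompactSupport.of_compactSpace _⟩
  refine ⟨RealRMK.rieszMeasure Λ, inferInstance, ?_, integral_eq⟩
  have mass_le : Φ 1 ≤ 1 :=
    (h 1).trans ((ContinuousMap.norm_le _ zero_le_one).2 fun y => by simp)
  rw [← integral_eq] at mass_le
  simp only [ContinuousMap.one_apply, integral_const, smul_eq_mul, mul_one] at mass_le
  rwa [← ENNReal.toReal_le_toReal (measure_ne_top _ _) ENNReal.one_ne_top, ENNReal.toReal_one]

end Representation

namespace WGraph

variable {X : Type*} [MeasurableSpace X] [Countable X] [DiscreteMeasurableSpace X]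
  {G : WGraph X} {m : Measure X} [PosFiniteAtoms m]

variable (G m) in
/-- `D(Q^(N)) ∩ ℓ^∞(X)` as a subspace of `D(Q^(N))`; unlike `BddDomain` it is a vector space. -/
def boundedSubmodule : Submodule ℝ (G.Dom m) where
  carrier := {u | ∃ M : ℝ, ∀ x, |u x| ≤ M}
  zero_mem' := ⟨0, fun x => by simp⟩
  add_mem' := fun {u v} ⟨M, hM⟩ ⟨M', hM'⟩ => ⟨M + M', fun x => by
    rw [FormSpace.add_apply]
    exact (abs_add_le _ _).trans (add_le_add (hM x) (hM' x))⟩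
  smul_mem' := fun c u ⟨M, hM⟩ => ⟨|c| * M, fun x => by
    rw [FormSpace.smul_apply, abs_mul]
    exact mul_le_mul_of_nonneg_left (hM x) (abs_nonneg c)⟩

/-- The preliminary trace `γ₀` as a linear map. -/
def boundaryRestrict : G.boundedSubmodule m →ₗ[ℝ] C(G.Boundary m, ℝ) where
  toFun u := ⟨G.preTrace m (Dom.toBdd u.1 u.2), continuous_preTrace _⟩
  map_add' u v := by
    ext ζ
    exact coord_eq_of_tendsto (((tendsto_coord (Dom.toBdd u.1 u.2) ζ.1).add
      (tendsto_coord (Dom.toBdd v.1 v.2) ζ.1)).congr fun x => (FormSpace.add_apply u.1 v.1 x).symm)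
  map_smul' c u := by
    ext ζ
    exact coord_eq_of_tendsto (((tendsto_coord (Dom.toBdd u.1 u.2) ζ.1).const_mul c).congr
      fun x => (FormSpace.smul_apply c u.1 x).symm)

theorem harmonicPart_eq_zero_of_tendsto {u : G.Dom m}
    (h : ∀ ζ : G.Boundary m, Tendsto u (nhdsX ζ.1) (𝓝 0)) : harmonicPart u = 0 := by
  have harmonicPart_nonpos {v : G.Dom m} (hv : ∀ ζ : G.Boundary m, Tendsto v (nhdsX ζ.1) (𝓝 0))
      (x : X) : harmonicPart v x ≤ 0 :=
    harmonicPart_le_of_tendsto_boundary le_rfl (fun ζ => ⟨0, le_rfl, hv ζ⟩) x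
  have h_neg (ζ : G.Boundary m) : Tendsto (-u : G.Dom m) (nhdsX ζ.1) (𝓝 0) := by
    simpa using (h ζ).neg.congr fun x => (FormSpace.neg_apply u x).symm
  refine DFunLike.ext _ _ fun x => ?_
  rw [FormSpace.zero_apply]
  exact le_antisymm (harmonicPart_nonpos h x) (by simpa using harmonicPart_nonpos h_neg x)

theorem harmonicPart_eq_of_tendsto {f u : G.Dom m} (hu : u ∈ (G.dirichletDomain m)ᗮ)
    {a : G.Boundary m → ℝ} (hf : ∀ ζ, Tendsto f (nhdsX ζ.1) (𝓝 (a ζ)))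
    (hua : ∀ ζ, Tendsto u (nhdsX ζ.1) (𝓝 (a ζ))) : harmonicPart f = u := by
  have h : harmonicPart (f - u) = 0 := harmonicPart_eq_zero_of_tendsto fun ζ => by
    simpa using ((hf ζ).sub (hua ζ)).congr fun x => (FormSpace.sub_apply f u x).symm
  rwa [map_sub, harmonicPart_eq_self hu, sub_eq_zero] at h

theorem abs_harmonicPart_le {u : G.Dom m} {M : ℝ} (h : ∀ x, |u x| ≤ M) (x : X) :
    |harmonicPart u x| ≤ M := by
  have hM : 0 ≤ M := (abs_nonneg _).trans (h x)
  refine abs_le.2 ⟨?_, harmonicPart_le hM (fun x => (le_abs_self _).trans (h x)) x⟩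
  have h_neg := harmonicPart_le (u := -u) hM (fun x => by
    rw [FormSpace.neg_apply]
    exact (neg_le_abs _).trans (h x)) x
  rw [map_neg, FormSpace.neg_apply] at h_neg
  linarith

theorem tendsto_harmonicPart (f : G.BddDomain m) (ζ : G.Boundary m) :
    Tendsto (harmonicPart (Dom.ofBdd f)) (nhdsX ζ.1) (𝓝 (G.preTrace m f ζ)) := by
  let v := Dom.ofBdd f - harmonicPart (Dom.ofBdd f)
  obtain ⟨M, hM⟩ := Dom.exists_abs_ofBdd_le f
  have hv : ∃ M : ℝ, ∀ x, |v x| ≤ M := ⟨M + M, fun x => by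
    rw [FormSpace.sub_apply]
    exact (abs_sub _ _).trans (add_le_add (hM x) (abs_harmonicPart_le hM x))⟩
  have h := (tendsto_coord f ζ.1).sub (tendsto_coord (v.toBdd hv) ζ.1)
  rw [show ζ.1.1 (v.toBdd hv) = 0 from preTrace_eq_zero_of_mem (sub_harmonicPart_mem _) ζ,
    sub_zero] at h
  refine h.congr fun x => ?_
  rw [Dom.toBdd_apply, FormSpace.sub_apply, ← Dom.ofBdd_apply, sub_sub_cancel]

theorem exists_measure_integral_preTrace_eq (o : X) : ∃ μ : Measure (G.Boundary m), μ.Regular ∧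
    μ Set.univ ≤ 1 ∧ ∀ f, ∫ ζ, G.preTrace m f ζ ∂μ = harmonicPart (Dom.ofBdd f) o := by
  let ℓ : G.boundedSubmodule m →ₗ[ℝ] ℝ :=
    (FormSpace.eval o).toLinearMap ∘ₗ harmonicPart.toLinearMap ∘ₗ (G.boundedSubmodule m).subtype
  have ℓ_le (u : G.boundedSubmodule m) : ℓ u ≤ ‖(boundaryRestrict u)⁺‖ := by
    refine harmonicPart_le_of_tendsto_boundary (u := u.1) (norm_nonneg _) (fun ζ =>
      ⟨_, ?_, tendsto_coord (Dom.toBdd u.1 u.2) ζ.1⟩) o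
    exact (le_max_left _ 0).trans
      ((le_abs_self _).trans ((boundaryRestrict u)⁺.norm_coe_le_norm ζ))
  obtain ⟨Φ, hΦ, hΦ_le⟩ := exists_linearMap_comp_eq_of_le_sublinear (N := fun φ => ‖φ⁺‖)
    (fun c hc φ => norm_posPart_smul hc.le φ) norm_posPart_add_le boundaryRestrict ℓ ℓ_le
  obtain ⟨μ, hreg, hmass, hintegral⟩ := exists_regular_measure_integral_eq hΦ_le
  refine ⟨μ, hreg, hmass, fun f => ?_⟩
  let u : G.boundedSubmodule m := ⟨Dom.ofBdd f, Dom.exists_abs_ofBdd_le f⟩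
  exact (hintegral (boundaryRestrict u)).trans (LinearMap.congr_fun hΦ u)

theorem exists_isHarmonicMeasure (o : X) : ∃ μ, G.IsHarmonicMeasure m o μ := by
  obtain ⟨μ, hreg, hmass, hintegral⟩ := exists_measure_integral_preTrace_eq (G := G) (m := m) o
  have hfin : IsFiniteMeasure μ := ⟨hmass.trans_lt ENNReal.one_lt_top⟩
  let Z : Set (G.Boundary m) := {ζ | ∀ f : G.BddDomain m, G.preTrace m f ζ = 0}
  refine ⟨μ.restrict Zᶜ, Measure.Regular.restrict_of_measure_ne_top (measure_ne_top _ _),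
    (Measure.restrict_apply_le _ _).trans hmass, fun f h hN hH hbv => ?_, fun z hz => ?_⟩
  · have harmonicPart_eq : harmonicPart (Dom.ofBdd f) = Dom.ofLp h hN :=
      harmonicPart_eq_of_tendsto ((isOneHarmonic_iff (Dom.ofLp h hN)).1 hH)
        (fun ζ => tendsto_coord f ζ.1) fun ζ => boundaryValue_eq_coe_iff.1 (hbv ζ)
    rw [setIntegral_eq_integral_of_forall_compl_eq_zero fun ζ hζ => (not_not.1 hζ) f, hintegral f,
      harmonicPart_eq]
    rfl
  · rw [Measure.restrict_apply (measurableSet_singleton z),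
      Set.disjoint_iff_inter_eq_empty.1 (Set.disjoint_singleton_left.2 (not_not.2 hz)),
      measure_empty]

theorem isHarmonicMeasure (o : X) : G.IsHarmonicMeasure m o (G.harmonicMeasure m o) := by
  rw [harmonicMeasure, dif_pos (exists_isHarmonicMeasure o)]
  exact (exists_isHarmonicMeasure o).choose_spec

instance (o : X) : IsFiniteMeasure (G.harmonicMeasure m o) :=
  ⟨(isHarmonicMeasure o).mass_le.trans_lt ENNReal.one_lt_top⟩

theorem integral_preTrace (o : X) (f : G.BddDomain m) :
    ∫ ζ, G.preTrace m f ζ ∂(G.harmonicMeasure m o) = harmonicPart (Dom.ofBdd f) o :=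
  ((isHarmonicMeasure o).integral_eq f (FormSpace.incl (harmonicPart (Dom.ofBdd f)))
    (Dom.neumann_incl_lt_top _) ((isOneHarmonic_iff _).2 (harmonicPart_mem _)) fun ζ =>
      boundaryValue_eq_coe_iff.2 (tendsto_harmonicPart f ζ)).symm

end WGraph

/-! ### The trace map -/

theorem abs_sq_div_sub_sq_div_le {M s t a b : ℝ} (hs : |s| ≤ M) (ht : |t| ≤ M) (ha : 0 ≤ a)
    (hb : 0 ≤ b) :
    |s ^ 2 / (a + 1) - t ^ 2 / (b + 1)| ≤ (2 * M + M ^ 2) * (|s - t| + |a - b|) := by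
  have hM : 0 ≤ M := (abs_nonneg _).trans hs
  have hsum : |(s + t) / (a + 1)| ≤ 2 * M := by
    rw [abs_div, abs_of_pos (by linarith : 0 < a + 1), div_le_iff₀ (by linarith)]
    nlinarith [abs_add_le s t]
  have hsq : |-(t ^ 2 / ((a + 1) * (b + 1)))| ≤ M ^ 2 := by
    rw [abs_neg, abs_of_nonneg (by positivity)]
    refine (div_le_self (sq_nonneg t) (by nlinarith)).trans (sq_le_sq.2 ?_)
    rwa [abs_of_nonneg hM]
  calc |s ^ 2 / (a + 1) - t ^ 2 / (b + 1)|
      = |(s - t) * ((s + t) / (a + 1)) + (a - b) * -(t ^ 2 / ((a + 1) * (b + 1)))| := by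
        congr 1
        field_simp
        ring
    _ ≤ |s - t| * (2 * M) + |a - b| * M ^ 2 := by
        refine (abs_add_le _ _).trans ?_
        rw [abs_mul, abs_mul]
        exact add_le_add (mul_le_mul_of_nonneg_left hsum (abs_nonneg _))
          (mul_le_mul_of_nonneg_left hsq (abs_nonneg _))
    _ ≤ (2 * M + M ^ 2) * (|s - t| + |a - b|) := by
        nlinarith [mul_nonneg (sq_nonneg M) (abs_nonneg (s - t)),
          mul_nonneg hM (abs_nonneg (a - b))]

theorem picone {s t a b : ℝ} (ha : 0 ≤ a) (hb : 0 ≤ b) :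
    (a - b) * (s ^ 2 / (a + 1) - t ^ 2 / (b + 1)) ≤ (s - t) ^ 2 := by
  have hdiff : (s - t) ^ 2 - (a - b) * (s ^ 2 / (a + 1) - t ^ 2 / (b + 1)) =
      (s * (b + 1) - t * (a + 1)) ^ 2 / ((a + 1) * (b + 1)) := by
    field_simp
    ring
  have hnonneg : 0 ≤ (s * (b + 1) - t * (a + 1)) ^ 2 / ((a + 1) * (b + 1)) := by positivity
  linarith

namespace WGraph

variable {X : Type*} [MeasurableSpace X] [Countable X] [DiscreteMeasurableSpace X]
  {G : WGraph X} {m : Measure X} [PosFiniteAtoms m]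

variable (G m) in
/-- The Green function with pole `o`, which represents the evaluation at `o`. -/
def green (o : X) : G.Dom m := (InnerProductSpace.toDual ℝ (G.Dom m)).symm (FormSpace.eval o)

theorem inner_green (o : X) (u : G.Dom m) : ⟪G.green m o, u⟫ = u o := by
  rw [green, InnerProductSpace.toDual_symm_apply, FormSpace.eval_apply]

theorem green_self_nonneg (o : X) : 0 ≤ G.green m o o := by
  rw [← inner_green]
  exact real_inner_self_nonneg

/-- Cutting the Green function off at its value at the pole neither changes that value nor raises
the norm, hence does not change the function. -/
theorem green_mem_Icc (o x : X) : G.green m o x ∈ Set.Icc 0 (G.green m o o) := by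
  set g := G.green m o
  have hg : 0 ≤ g o := green_self_nonneg o
  have hC : LipschitzWith 1 fun t : ℝ => max 0 (min (g o) t) :=
    (LipschitzWith.id.const_min (g o)).const_max 0
  have hC0 : max 0 (min (g o) 0) = 0 := by simp [hg]
  have hcut : Dom.comp hC hC0 g = g := by
    refine eq_of_norm_le_re_inner_eq_norm_sq (𝕜 := ℝ) (Dom.norm_comp_le hC hC0 g) ?_
    rw [real_inner_comm, ← real_inner_self_eq_norm_sq, inner_green, inner_green, Dom.comp_apply]
    simp [hg]
  rw [← hcut, Dom.comp_apply hC hC0 g x, hcut]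
  exact ⟨le_max_left _ _, max_le hg (min_le_left _ _)⟩

theorem inner_harmonicPart_green (o : X) (u : G.Dom m) :
    ⟪harmonicPart (G.green m o), u⟫ = harmonicPart u o := by
  rw [inner_harmonicPart_left, inner_green]

theorem Dom.exists_sq_div {v g : G.Dom m} {M : ℝ} (hv : ∀ x, |v x| ≤ M) (hg : ∀ x, 0 ≤ g x) :
    ∃ w : G.Dom m, ∀ x, w x = v x ^ 2 / (g x + 1) :=
  exists_eq_of_abs_grad_le v g (K := 2 * M + M ^ 2) fun y => by
    rcases y with p | x
    · exact abs_sq_div_sub_sq_div_le (hv _) (hv _) (hg _) (hg _)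
    · simpa using abs_sq_div_sub_sq_div_le (t := 0) (b := 0) (hv x)
        (by simpa using (abs_nonneg _).trans (hv x)) (hg x) le_rfl

theorem Dom.inner_sq_div_le {v g w : G.Dom m} (hg : ∀ x, 0 ≤ g x)
    (hw : ∀ x, w x = v x ^ 2 / (g x + 1)) : ⟪g, w⟫ ≤ ‖v‖ ^ 2 := by
  rw [← real_inner_self_eq_norm_sq]
  refine inner_le_inner fun y => ?_
  rcases y with p | x
  · simpa only [grad_inl, hw, sq] using picone (s := v p.1) (t := v p.2) (hg p.1) (hg p.2)
  · simpa [hw, sq] using picone (s := v x) (t := 0) (hg x) le_rfl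

/-- The bound `⟪g, v² / (g + 1)⟫ ≤ ‖v‖²` for the harmonic part `g` of the Green function, together
with `v² ≤ (max g + 1) v² / (g + 1)`. -/
theorem harmonicPart_sq_le (o : X) {v w : G.Dom m} {M : ℝ} (hv : ∀ x, |v x| ≤ M)
    (hw : ∀ x, w x = v x ^ 2) : harmonicPart w o ≤ (G.green m o o + 1) * ‖v‖ ^ 2 := by
  set g := harmonicPart (G.green m o)
  have hg_nonneg : ∀ x, 0 ≤ g x := harmonicPart_nonneg fun x => (green_mem_Icc o x).1
  have hg_le : ∀ x, g x ≤ G.green m o o :=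
    harmonicPart_le (green_self_nonneg o) fun x => (green_mem_Icc o x).2
  obtain ⟨q, hq⟩ := Dom.exists_sq_div hv hg_nonneg
  have hwq (x : X) : w x ≤ ((G.green m o o + 1) • q) x := by
    have hpos : 0 < g x + 1 := by linarith [hg_nonneg x]
    rw [FormSpace.smul_apply, hw, hq, mul_div_assoc', le_div_iff₀ hpos, mul_comm]
    exact mul_le_mul_of_nonneg_right (by linarith [hg_le x]) (sq_nonneg _)
  calc harmonicPart w o ≤ harmonicPart ((G.green m o o + 1) • q) o := harmonicPart_mono hwq o
    _ = (G.green m o o + 1) * ⟪g, q⟫ := by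
        rw [map_smul, FormSpace.smul_apply, inner_harmonicPart_green]
    _ ≤ (G.green m o o + 1) * ‖v‖ ^ 2 :=
        mul_le_mul_of_nonneg_left (Dom.inner_sq_div_le hg_nonneg hq)
          (by linarith [green_self_nonneg (G := G) (m := m) o])

theorem exists_preTrace_eq_sq (f : G.BddDomain m) :
    ∃ w : G.BddDomain m, (∀ x, w.1 x = f.1 x ^ 2) ∧
      ∀ ζ, G.preTrace m w ζ = G.preTrace m f ζ ^ 2 := by
  obtain ⟨M, hM⟩ := Dom.exists_abs_ofBdd_le f
  obtain ⟨w, hw⟩ := Dom.exists_mul (Dom.ofBdd f) (Dom.ofBdd f) hM hM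
  have hbdd : ∃ K : ℝ, ∀ x, |w x| ≤ K := ⟨M * M, fun x => by
    rw [hw, abs_mul]
    exact mul_le_mul (hM x) (hM x) (abs_nonneg _) ((abs_nonneg _).trans (hM x))⟩
  have hsq (x : X) : (Dom.toBdd w hbdd).1 x = f.1 x ^ 2 := by
    rw [Dom.toBdd_apply, hw, sq, Dom.ofBdd_apply]
  exact ⟨Dom.toBdd w hbdd, hsq, fun ζ =>
    coord_eq_of_tendsto (((tendsto_coord f ζ.1).pow 2).congr fun x => (hsq x).symm)⟩

theorem lintegral_preTrace_sq_eq (o : X) {f w : G.BddDomain m}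
    (hw : ∀ ζ, G.preTrace m w ζ = G.preTrace m f ζ ^ 2) :
    ∫⁻ ζ, ENNReal.ofReal (G.preTrace m f ζ ^ 2) ∂(G.harmonicMeasure m o) =
      ENNReal.ofReal (harmonicPart (Dom.ofBdd w) o) := by
  rw [← integral_preTrace, funext hw]
  have hcont : Continuous fun ζ => G.preTrace m f ζ ^ 2 := (continuous_preTrace f).pow 2
  exact (ofReal_integral_eq_lintegral_ofReal
    (hcont.integrable_of_hasCompactSupport (HasCompactSupport.of_compactSpace _))
    (Eventually.of_forall fun ζ => sq_nonneg _)).symm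

theorem lintegral_preTrace_sq_le (o : X) (f : G.BddDomain m) :
    ∫⁻ ζ, ENNReal.ofReal (G.preTrace m f ζ ^ 2) ∂(G.harmonicMeasure m o) ≤
      ENNReal.ofReal ((G.green m o o + 1) * ‖Dom.ofBdd f‖ ^ 2) := by
  obtain ⟨w, hw, htrace⟩ := exists_preTrace_eq_sq f
  obtain ⟨M, hM⟩ := Dom.exists_abs_ofBdd_le f
  rw [lintegral_preTrace_sq_eq o htrace]
  exact ENNReal.ofReal_le_ofReal (harmonicPart_sq_le o hM hw)

namespace Dom

/-- The truncation of `u` at height `n`, as an element of `D(Q^(N)) ∩ ℓ^∞(X)`. -/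
def clampBdd (n : ℕ) (u : G.Dom m) : G.BddDomain m :=
  toBdd (comp (lipschitzWith_clamp n) (clamp_zero n.cast_nonneg) u) ⟨n, fun x => by
    rw [comp_apply]
    exact abs_clamp_le n.cast_nonneg _⟩

theorem clampBdd_apply (n : ℕ) (u : G.Dom m) (x : X) : (clampBdd n u).1 x = clamp n (u x) :=
  comp_apply _ _ u x

theorem norm_clampBdd_le (n : ℕ) (u : G.Dom m) : ‖ofBdd (clampBdd n u)‖ ≤ ‖u‖ :=
  norm_comp_le (lipschitzWith_clamp n) (clamp_zero n.cast_nonneg) u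

end Dom

theorem preTrace_clampBdd {n : ℕ} {u : G.Dom m} {ζ : G.Boundary m} {a : ℝ}
    (h : Tendsto u (nhdsX ζ.1) (𝓝 a)) : G.preTrace m (Dom.clampBdd n u) ζ = clamp n a :=
  coord_eq_of_tendsto ((((lipschitzWith_clamp n).continuous.tendsto a).comp h).congr fun x =>
    (Dom.clampBdd_apply n u x).symm)

theorem preTrace_clampBdd_of_tendsto_atTop {n : ℕ} {u : G.Dom m} {ζ : G.Boundary m}
    (h : Tendsto u (nhdsX ζ.1) atTop) : G.preTrace m (Dom.clampBdd n u) ζ = n := by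
  refine coord_eq_of_tendsto (tendsto_const_nhds.congr' ?_)
  filter_upwards [h.eventually_ge_atTop (n : ℝ)] with x hx
  rw [Dom.clampBdd_apply, clamp, min_eq_left hx, max_eq_right]
  linarith [(n.cast_nonneg : (0 : ℝ) ≤ n)]

theorem preTrace_clampBdd_of_tendsto_atBot {n : ℕ} {u : G.Dom m} {ζ : G.Boundary m}
    (h : Tendsto u (nhdsX ζ.1) atBot) : G.preTrace m (Dom.clampBdd n u) ζ = -n := by
  refine coord_eq_of_tendsto (tendsto_const_nhds.congr' ?_)
  filter_upwards [h.eventually_le_atBot (-n : ℝ)] with x hx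
  rw [Dom.clampBdd_apply, clamp, max_eq_left ((min_le_right _ _).trans hx)]

theorem tendsto_ofReal_preTrace_clampBdd_sq {u : G.Dom m} {ζ : G.Boundary m}
    (h : Tendsto u (nhdsX ζ.1) atTop ∨ Tendsto u (nhdsX ζ.1) atBot) :
    Tendsto (fun n : ℕ => ENNReal.ofReal (G.preTrace m (Dom.clampBdd n u) ζ ^ 2)) atTop (𝓝 ⊤) := by
  have hsq (n : ℕ) : G.preTrace m (Dom.clampBdd n u) ζ ^ 2 = (n : ℝ) ^ 2 := by
    rcases h with h | h
    · rw [preTrace_clampBdd_of_tendsto_atTop h]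
    · rw [preTrace_clampBdd_of_tendsto_atBot h, neg_sq]
  simp only [hsq]
  exact ENNReal.tendsto_ofReal_nhds_top.2
    ((tendsto_pow_atTop two_ne_zero).comp tendsto_natCast_atTop_atTop)

/-- The boundary values of `u` as a real function; a junk value is taken where `u` has an infinite
limit. -/
def boundaryFn (u : G.Dom m) (ζ : G.Boundary m) : ℝ := Real.tan (G.preTrace m u.arctan ζ)

theorem measurable_boundaryFn (u : G.Dom m) : Measurable (boundaryFn u) := by
  have hmeas : Measurable (G.preTrace m u.arctan) := (continuous_preTrace _).measurable
  exact (funext fun ζ => Real.tan_eq_sin_div_cos _ : boundaryFn u = _) ▸ hmeas.sin.div hmeas.cos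

theorem lintegral_liminf_preTrace_clampBdd_sq_le (o : X) (u : G.Dom m) :
    ∫⁻ ζ, liminf (fun n => ENNReal.ofReal (G.preTrace m (Dom.clampBdd n u) ζ ^ 2)) atTop
      ∂(G.harmonicMeasure m o) ≤ ENNReal.ofReal ((G.green m o o + 1) * ‖u‖ ^ 2) := by
  refine (lintegral_liminf_le fun n => measurable_ofReal_preTrace_sq (Dom.clampBdd n u)).trans ?_
  refine liminf_le_of_le (by isBoundedDefault) fun b hb => ?_
  obtain ⟨n, hn⟩ := hb.exists
  refine (hn.trans (lintegral_preTrace_sq_le o _)).trans (ENNReal.ofReal_le_ofReal ?_)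
  have := green_self_nonneg (G := G) (m := m) o
  gcongr
  exact Dom.norm_clampBdd_le n u

theorem ae_tendsto_boundaryFn (o : X) (u : G.Dom m) :
    ∀ᵐ ζ ∂(G.harmonicMeasure m o), Tendsto u (nhdsX ζ.1) (𝓝 (boundaryFn u ζ)) := by
  filter_upwards [ae_lt_top
    (Measurable.liminf fun n => measurable_ofReal_preTrace_sq (Dom.clampBdd n u))
    ((lintegral_liminf_preTrace_clampBdd_sq_le o u).trans_lt ENNReal.ofReal_lt_top).ne] with ζ hζ
  refine (tendsto_trichotomy u ζ.1).resolve_right fun hinf => hζ.ne ?_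
  exact (tendsto_ofReal_preTrace_clampBdd_sq hinf).liminf_eq

theorem lintegral_boundaryFn_sq_le (o : X) (u : G.Dom m) :
    ∫⁻ ζ, ENNReal.ofReal (boundaryFn u ζ ^ 2) ∂(G.harmonicMeasure m o) ≤
      ENNReal.ofReal ((G.green m o o + 1) * ‖u‖ ^ 2) := by
  refine (lintegral_congr_ae ?_).trans_le (lintegral_liminf_preTrace_clampBdd_sq_le o u)
  filter_upwards [ae_tendsto_boundaryFn o u] with ζ hζ
  refine (Tendsto.liminf_eq ?_).symm
  simp only [preTrace_clampBdd hζ]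
  exact ENNReal.tendsto_ofReal ((tendsto_clamp _).pow 2)

theorem memLp_boundaryFn (o : X) (u : G.Dom m) : MemLp (boundaryFn u) 2 (G.harmonicMeasure m o) :=
  memLp_two_of_lintegral_lt_top (measurable_boundaryFn u).aestronglyMeasurable
    ((lintegral_boundaryFn_sq_le o u).trans_lt ENNReal.ofReal_lt_top)

theorem ae_tendsto_trace (o : X) (u : G.Dom m) : ∀ᵐ ζ ∂(G.harmonicMeasure m o),
    Tendsto u (nhdsX ζ.1) (𝓝 (G.trace m o (FormSpace.incl u) ζ)) := by
  have hex : ∃ φ : G.L2Boundary m o, ∀ᵐ ζ ∂(G.harmonicMeasure m o),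
      G.boundaryValue m (FormSpace.incl u : Lp ℝ 2 m) ζ = (φ ζ : EReal) := by
    refine ⟨(memLp_boundaryFn o u).toLp _, ?_⟩
    filter_upwards [(memLp_boundaryFn o u).coeFn_toLp, ae_tendsto_boundaryFn o u] with ζ hφ hlim
    rw [hφ]
    exact boundaryValue_eq_coe_iff.2 hlim
  rw [trace, dif_pos hex]
  filter_upwards [hex.choose_spec] with ζ hζ
  exact boundaryValue_eq_coe_iff.1 hζ

theorem trace_eq_of_tendsto {o : X} {u : G.Dom m} {φ : G.L2Boundary m o}
    (h : ∀ᵐ ζ ∂(G.harmonicMeasure m o), Tendsto u (nhdsX ζ.1) (𝓝 (φ ζ))) :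
    G.trace m o (FormSpace.incl u) = φ := by
  refine Lp.ext ?_
  filter_upwards [ae_tendsto_trace o u, h] with ζ htrace hφ
  exact tendsto_nhds_unique htrace hφ

theorem norm_trace_sq_le (o : X) (u : G.Dom m) :
    ‖G.trace m o (FormSpace.incl u)‖ ^ 2 ≤ (G.green m o o + 1) * ‖u‖ ^ 2 := by
  have := green_self_nonneg (G := G) (m := m) o
  rw [← ENNReal.ofReal_le_ofReal_iff (by positivity), ofReal_norm_sq_eq_lintegral]
  refine (lintegral_congr_ae ?_).trans_le (lintegral_boundaryFn_sq_le o u)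
  filter_upwards [ae_tendsto_boundaryFn o u, ae_tendsto_trace o u] with ζ hfn htrace
  rw [tendsto_nhds_unique hfn htrace]

variable (G m) in
/-- The trace map as a bounded operator from `D(Q^(N))`, with the form norm, to `L²(∂X)`. -/
def traceMap (o : X) : G.Dom m →L[ℝ] G.L2Boundary m o :=
  LinearMap.mkContinuous
    { toFun := fun u => G.trace m o (FormSpace.incl u)
      map_add' := fun u v => trace_eq_of_tendsto <| by
        filter_upwards [ae_tendsto_trace o u, ae_tendsto_trace o v,
          Lp.coeFn_add (G.trace m o (FormSpace.incl u)) (G.trace m o (FormSpace.incl v))]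
          with ζ hu hv hadd
        rw [hadd]
        exact (hu.add hv).congr fun x => (FormSpace.add_apply u v x).symm
      map_smul' := fun c u => trace_eq_of_tendsto <| by
        filter_upwards [ae_tendsto_trace o u, Lp.coeFn_smul c (G.trace m o (FormSpace.incl u))]
          with ζ hu hsmul
        rw [RingHom.id_apply, hsmul]
        exact (hu.const_mul c).congr fun x => (FormSpace.smul_apply c u x).symm }
    (√(G.green m o o + 1)) fun u => by
      refine le_of_sq_le_sq ?_ (by positivity)
      rw [mul_pow, Real.sq_sqrt (by linarith [green_self_nonneg (G := G) (m := m) o])]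
      exact norm_trace_sq_le o u

theorem traceMap_apply (o : X) (u : G.Dom m) :
    G.traceMap m o u = G.trace m o (FormSpace.incl u) := rfl

theorem traceMap_ofLp (o : X) (f : Lp ℝ 2 m) (hf : G.neumann m f < ⊤) :
    G.traceMap m o (Dom.ofLp f hf) = G.trace m o f := rfl

theorem traceMap_comp (o : X) {C : ℝ → ℝ} (hC : LipschitzWith 1 C) (h0 : C 0 = 0) (u : G.Dom m) :
    G.traceMap m o (Dom.comp hC h0 u) = hC.compLp h0 (G.traceMap m o u) := by
  refine trace_eq_of_tendsto ?_
  filter_upwards [ae_tendsto_trace o u, hC.coeFn_compLp h0 (G.traceMap m o u)] with ζ hu hcomp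
  rw [hcomp]
  exact ((hC.continuous.tendsto _).comp hu).congr fun x => (Dom.comp_apply hC h0 u x).symm

theorem tendsto_zero_of_mem_dirichletDomain {u : G.Dom m} (hu : u ∈ G.dirichletDomain m)
    (ζ : G.Boundary m) : Tendsto u (nhdsX ζ.1) (𝓝 0) := by
  have hcoord : ζ.1.1 u.arctan = 0 := preTrace_eq_zero_of_mem (f := u.arctan)
    (comp_mem_dirichletDomain lipschitzWith_arctan Real.arctan_zero hu) ζ
  have hlim := (tendsto_coord u.arctan ζ.1).congr fun x => Dom.comp_apply _ _ u x
  rw [hcoord] at hlim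
  have htan : ContinuousAt Real.tan 0 := Real.continuousAt_tan.2 (by simp)
  simpa only [Function.comp_def, Real.tan_arctan, Real.tan_zero] using htan.tendsto.comp hlim

theorem traceMap_eq_zero_of_mem (o : X) {u : G.Dom m} (hu : u ∈ G.dirichletDomain m) :
    G.traceMap m o u = 0 := by
  refine trace_eq_of_tendsto ?_
  filter_upwards [Lp.coeFn_zero ℝ 2 (G.harmonicMeasure m o)] with ζ hζ
  rw [hζ]
  exact tendsto_zero_of_mem_dirichletDomain hu ζ

/-- The harmonic part of `f²` is nonnegative and has value `∫ (γ₀ f)² dμ = 0` at `o`, so it vanishes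
identically, and `f` vanishes on all of `∂X`. -/
theorem mem_dirichletDomain_of_ae_preTrace_eq_zero (hG : G.Connected) {o : X} {f : G.BddDomain m}
    (hf : ∀ᵐ ζ ∂(G.harmonicMeasure m o), G.preTrace m f ζ = 0) :
    Dom.ofBdd f ∈ G.dirichletDomain m := by
  obtain ⟨w, hw, htrace⟩ := exists_preTrace_eq_sq f
  have hwo : harmonicPart (Dom.ofBdd w) o = 0 := by
    rw [← integral_preTrace]
    refine integral_eq_zero_of_ae ?_
    filter_upwards [hf] with ζ hζ
    simp [htrace, hζ]
  have hnonneg : ∀ x, 0 ≤ harmonicPart (Dom.ofBdd w) x := harmonicPart_nonneg fun x => by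
    rw [Dom.ofBdd_apply, hw]
    exact sq_nonneg _
  have hmem : Dom.ofBdd w ∈ G.dirichletDomain m := harmonicPart_eq_zero_iff.1 <|
    eq_zero_of_nonneg_of_apply_eq_zero hG (harmonicPart_mem _) hnonneg hwo
  refine mem_dirichletDomain_of_preTrace_eq_zero (Dom.exists_abs_ofBdd_le f) fun ζ => ?_
  exact (pow_eq_zero_iff two_ne_zero).1 ((htrace ζ).symm.trans (preTrace_eq_zero_of_mem hmem ζ))

theorem traceMap_eq_zero_iff (hG : G.Connected) (o : X) {u : G.Dom m} :
    G.traceMap m o u = 0 ↔ u ∈ G.dirichletDomain m := by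
  refine ⟨fun h => ?_, traceMap_eq_zero_of_mem o⟩
  refine mem_dirichletDomain_of_tendsto (l := atTop) (u := fun n : ℕ => Dom.ofBdd (u.clampBdd n))
    (R := ‖u‖) (fun n => mem_dirichletDomain_of_ae_preTrace_eq_zero hG (o := o) ?_)
    (fun n => Dom.norm_clampBdd_le n u) fun x => ?_
  · filter_upwards [ae_tendsto_trace o u, Lp.coeFn_zero ℝ 2 (G.harmonicMeasure m o)] with ζ hlim h0
    rw [← traceMap_apply, h, h0] at hlim
    rw [preTrace_clampBdd hlim, Pi.zero_apply, clamp_zero n.cast_nonneg]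
  · simp only [Dom.ofBdd_apply, Dom.clampBdd_apply]
    exact tendsto_clamp _

theorem traceMap_harmonicPart (o : X) (u : G.Dom m) :
    G.traceMap m o (harmonicPart u) = G.traceMap m o u := by
  have hsub := traceMap_eq_zero_of_mem o (sub_harmonicPart_mem u)
  rw [map_sub, sub_eq_zero] at hsub
  exact hsub.symm

theorem traceMap_eq_iff (hG : G.Connected) (o : X) {u v : G.Dom m} :
    G.traceMap m o u = G.traceMap m o v ↔ u - v ∈ G.dirichletDomain m := by
  rw [← traceMap_eq_zero_iff hG o, map_sub, sub_eq_zero]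

theorem harmonicExtension_traceMap (hG : G.Connected) (o : X) (u : G.Dom m) :
    G.harmonicExtension m o (G.traceMap m o u) = FormSpace.incl (harmonicPart u) := by
  have hex : ∃ v : Lp ℝ 2 m, G.neumann m v < ⊤ ∧ G.IsOneHarmonic m v ∧
      G.trace m o v = G.traceMap m o u :=
    ⟨FormSpace.incl (harmonicPart u), Dom.neumann_incl_lt_top _,
      (isOneHarmonic_iff _).2 (harmonicPart_mem u), traceMap_harmonicPart o u⟩
  rw [harmonicExtension, dif_pos hex]
  obtain ⟨hdom, hharm, htrace⟩ := hex.choose_spec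
  let v : G.Dom m := Dom.ofLp hex.choose hdom
  have hsub : u - v ∈ G.dirichletDomain m := (traceMap_eq_iff hG o).1 htrace.symm
  rw [harmonicPart_eq_of_sub_mem hsub ((isOneHarmonic_iff v).1 hharm), Dom.incl_ofLp]

end WGraph

/-! ### Resolvents -/

namespace FormSpace

section Hilbert

variable {H : Type*} [NormedAddCommGroup H] [InnerProductSpace ℝ H] {S : SymmPosForm H}

theorem form_add_self (u v : FormSpace S) :
    form (u + v) (u + v) = form u u + 2 * form u v + form v v := by
  simp only [map_add, LinearMap.add_apply, form_comm v u]
  ring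

theorem form_sub_self (u v : FormSpace S) :
    form (u - v) (u - v) = form u u - 2 * form u v + form v v := by
  simp only [map_sub, LinearMap.sub_apply, form_comm v u]
  ring

theorem two_mul_form_le (u v : FormSpace S) : 2 * form u v ≤ form u u + form v v := by
  have := form_self_nonneg (u - v)
  rw [form_sub_self] at this
  linarith

theorem form_le_of_value_le {S' : SymmPosForm H} {u : FormSpace S} {v : FormSpace S'}
    (h : S.value (incl u) ≤ S'.value (incl v)) : form u u ≤ form v v := by
  rwa [value_incl, value_incl, ENNReal.ofReal_le_ofReal_iff (form_self_nonneg v)] at h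

theorem form_eq_of_value_eq {S' : SymmPosForm H} (hle : S'.value ≤ S.value)
    (j : FormSpace S →ₗ[ℝ] FormSpace S') (hj : ∀ u, incl (j u) = incl u) {d : FormSpace S}
    (hd : S.value (incl d) = S'.value (incl d)) (v : FormSpace S) :
    form v d = form (j v) (j d) := by
  have hform (u : FormSpace S) : form (j u) (j u) ≤ form u u :=
    form_le_of_value_le ((congrArg S'.value (hj u)).trans_le (hle _))
  have hform_d : form d d = form (j d) (j d) :=
    le_antisymm (form_le_of_value_le (by rw [hj, hd])) (hform d)
  set δ := form v d - form (j v) (j d)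
  set c := form v v - form (j v) (j v)
  -- `S - S'` is nonnegative at `v + t d` and affine in `t`, hence constant.
  have haffine (t : ℝ) : 0 ≤ c + 2 * t * δ := by
    have h := hform (v + t • d)
    rw [map_add, map_smul, form_add_self, form_add_self] at h
    simp only [map_smul, LinearMap.smul_apply, smul_eq_mul, hform_d] at h
    linarith
  by_contra hne
  have hδ0 : δ ≠ 0 := sub_ne_zero.2 hne
  have h := haffine (-(c + 1) / (2 * δ))
  rw [show 2 * (-(c + 1) / (2 * δ)) * δ = -(c + 1) by field_simp] at h
  linarith

/-- `R` is the resolvent `(1 + t S)⁻¹`, characterized weakly by `t S(R f, v) + ⟪R f, v⟫ = ⟪f, v⟫`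
and taking values in the form domain. -/
def IsResolvent (t : ℝ) (R : H →L[ℝ] FormSpace S) : Prop :=
  ∀ f v, t * form (R f) v + ⟪incl (R f), incl v⟫ = ⟪f, incl v⟫

theorem exists_isResolvent [CompleteSpace H] [CompleteSpace (FormSpace S)] {t : ℝ} (ht : 0 < t) :
    ∃ R : H →L[ℝ] FormSpace S, IsResolvent t R := by
  let B : FormSpace S →L[ℝ] FormSpace S →L[ℝ] ℝ :=
    t • innerSL ℝ + (1 - t) • (innerSL ℝ (E := H)).bilinearComp incl incl
  have B_apply (u v : FormSpace S) : B u v = t * form u v + ⟪incl u, incl v⟫ := by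
    have : B u v = t * ⟪u, v⟫ + (1 - t) * ⟪incl u, incl v⟫ := rfl
    rw [this, inner_eq]
    ring
  have isCoercive_B : IsCoercive B := by
    refine ⟨min t 1, lt_min ht one_pos, fun u => ?_⟩
    rw [B_apply, real_inner_self_eq_norm_sq, mul_assoc, ← sq, norm_sq_eq, mul_add]
    exact add_le_add (mul_le_mul_of_nonneg_right (min_le_left _ _) (form_self_nonneg u))
      (mul_le_of_le_one_left (sq_nonneg _) (min_le_right _ _))
  refine ⟨isCoercive_B.continuousLinearEquivOfBilin.symm.toContinuousLinearMap.comp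
    (ContinuousLinearMap.adjoint incl), fun f v => ?_⟩
  rw [← B_apply, ← isCoercive_B.continuousLinearEquivOfBilin_apply]
  simp only [ContinuousLinearMap.comp_apply, ContinuousLinearEquiv.coe_coe,
    ContinuousLinearEquiv.apply_symm_apply]
  exact ContinuousLinearMap.adjoint_inner_left incl v f

/-- The approximating form `(f, g) ↦ ⟪f - R f, g⟫`. If `R = (1 + t S)⁻¹`, then dividing it by `t`
and letting `t → 0` gives `S(f, g)`. -/
def approxForm (R : H →L[ℝ] FormSpace S) (f g : H) : ℝ := ⟪f - incl (R f), g⟫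

theorem tendsto_approxForm (R : H →L[ℝ] FormSpace S) {α : Type*} {l : Filter α} {f g : α → H}
    {f₀ g₀ : H} (hf : Tendsto f l (𝓝 f₀)) (hg : Tendsto g l (𝓝 g₀)) :
    Tendsto (fun n => approxForm R (f n) (g n)) l (𝓝 (approxForm R f₀ g₀)) :=
  (hf.sub (((incl.comp R).continuous.tendsto f₀).comp hf)).inner hg

namespace IsResolvent

variable {t : ℝ} {R : H →L[ℝ] FormSpace S}

theorem inner_comm (hR : IsResolvent t R) (f g : H) : ⟪incl (R f), g⟫ = ⟪f, incl (R g)⟫ := by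
  rw [← hR, real_inner_comm, ← hR, form_comm, real_inner_comm]

theorem approxForm_incl (hR : IsResolvent t R) (f : H) (v : FormSpace S) :
    approxForm R f (incl v) = t * form (R f) v := by
  rw [approxForm, inner_sub_left, ← hR, add_sub_cancel_right]

theorem mul_form_sub_eq (hR : IsResolvent t R) (u : FormSpace S) :
    t * form (R (incl u)) (u - R (incl u)) = ‖incl (u - R (incl u))‖ ^ 2 := by
  rw [← hR.approxForm_incl, approxForm, ← map_sub, real_inner_self_eq_norm_sq]

theorem form_sub_nonneg (hR : IsResolvent t R) (ht : 0 < t) (u : FormSpace S) :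
    0 ≤ form (R (incl u)) (u - R (incl u)) :=
  nonneg_of_mul_nonneg_right (hR.mul_form_sub_eq u ▸ sq_nonneg _) ht

theorem form_sub_self_le (hR : IsResolvent t R) (ht : 0 < t) (u : FormSpace S) :
    form (u - R (incl u)) (u - R (incl u)) ≤ form u u := by
  have hnonneg := hR.form_sub_nonneg ht u
  rw [map_sub] at hnonneg
  rw [form_sub_self, form_comm u (R _)]
  linarith [form_self_nonneg (R (incl u))]

theorem norm_incl_sub_sq_le (hR : IsResolvent t R) (ht : 0 < t) (u : FormSpace S) :
    ‖incl (u - R (incl u))‖ ^ 2 ≤ t * form u u := by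
  have hnonneg := hR.form_sub_nonneg ht u
  rw [← hR.mul_form_sub_eq]
  refine mul_le_mul_of_nonneg_left ?_ ht.le
  rw [map_sub] at hnonneg ⊢
  linarith [two_mul_form_le (R (incl u)) u, form_self_nonneg (R (incl u))]

theorem norm_le (hR : IsResolvent t R) (ht : 0 < t) (ht1 : t ≤ 1) (u : FormSpace S) :
    ‖R (incl u)‖ ≤ √(2 * form u u) + ‖u‖ := by
  have hsub : ‖u - R (incl u)‖ ≤ √(2 * form u u) := by
    refine Real.le_sqrt_of_sq_le ?_
    rw [norm_sq_eq]
    linarith [hR.form_sub_self_le ht u, hR.norm_incl_sub_sq_le ht u,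
      mul_le_of_le_one_left (form_self_nonneg u) ht1]
  calc ‖R (incl u)‖ = ‖u - (u - R (incl u))‖ := by rw [sub_sub_cancel]
    _ ≤ ‖u‖ + ‖u - R (incl u)‖ := norm_sub_le _ _
    _ ≤ √(2 * form u u) + ‖u‖ := by linarith

theorem tendsto_incl {τ : ℕ → ℝ} {R : ℕ → H →L[ℝ] FormSpace S} (hR : ∀ n, IsResolvent (τ n) (R n))
    (hτ : ∀ n, 0 < τ n) (hτ0 : Tendsto τ atTop (𝓝 0)) (u : FormSpace S) :
    Tendsto (fun n => incl (R n (incl u))) atTop (𝓝 (incl u)) := by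
  rw [tendsto_iff_norm_sub_tendsto_zero]
  refine squeeze_zero (fun n => norm_nonneg _) (fun n => ?_)
    (by simpa using (hτ0.mul_const (form u u)).sqrt)
  rw [norm_sub_rev, ← map_sub]
  exact Real.le_sqrt_of_sq_le ((hR n).norm_incl_sub_sq_le (hτ n) u)

end IsResolvent

end Hilbert

section Discrete

variable {X : Type*} [MeasurableSpace X] {m : Measure X} {S : SymmPosForm (Lp ℝ 2 m)}

/-- Composition with a normal contraction in the domain of a Markovian form. -/
def comp (hM : IsMarkovian S.value) {C : ℝ → ℝ} (hC : LipschitzWith 1 C) (h0 : C 0 = 0)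
    (u : FormSpace S) : FormSpace S :=
  of (hC.compLp h0 (incl u)) ((hM C hC h0 _).trans_lt (value_incl_lt_top u))

section Contraction

variable (hM : IsMarkovian S.value) {C : ℝ → ℝ} (hC : LipschitzWith 1 C) (h0 : C 0 = 0)

theorem form_comp_le (u : FormSpace S) :
    form (comp hM hC h0 u) (comp hM hC h0 u) ≤ form u u :=
  form_le_of_value_le (hM C hC h0 _)

theorem norm_comp_le (u : FormSpace S) : ‖comp hM hC h0 u‖ ≤ ‖u‖ := by
  have hincl : ‖incl (comp hM hC h0 u)‖ ≤ ‖incl u‖ :=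
    (hC.norm_compLp_le h0 (incl u)).trans_eq (one_mul _)
  refine le_of_sq_le_sq ?_ (norm_nonneg _)
  rw [norm_sq_eq, norm_sq_eq]
  gcongr
  exact form_comp_le hM hC h0 u

variable [PosFiniteAtoms m]

theorem comp_apply (u : FormSpace S) (x : X) : comp hM hC h0 u x = C (u x) :=
  compLp_apply hC h0 (incl u) x

/-- `R f` is the unique minimizer of `u ↦ t S(u,u) + ‖u - f‖²`, which does not increase under
composition with `C`. -/
theorem comp_resolvent {t : ℝ} (ht : 0 < t) {R : Lp ℝ 2 m →L[ℝ] FormSpace S} (hR : IsResolvent t R)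
    {f : Lp ℝ 2 m} (hf : ∀ x, C (f x) = f x) : comp hM hC h0 (R f) = R f := by
  set u := R f
  set c := comp hM hC h0 u
  have hCf : hC.compLp h0 f = f := lp_ext fun x => by rw [compLp_apply, hf]
  have hdist : ‖incl c - f‖ ≤ ‖incl u - f‖ := by
    have := hC.norm_compLp_sub_le h0 (incl u) f
    rwa [hCf, NNReal.coe_one, one_mul] at this
  have hnorm : ‖incl c - f‖ ^ 2 = ‖incl (c - u)‖ ^ 2 + 2 * ⟪incl u - f, incl (c - u)⟫ +
      ‖incl u - f‖ ^ 2 := by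
    rw [show incl c - f = incl (c - u) + (incl u - f) by rw [map_sub]; abel, norm_add_sq_real,
      real_inner_comm]
  have hform : form c c = form (c - u) (c - u) + 2 * form u (c - u) + form u u := by
    rw [form_comm u, ← form_add_self, sub_add_cancel]
  have hresolvent := hR f (c - u)
  have hzero : ‖incl (c - u)‖ ^ 2 ≤ 0 := by
    rw [inner_sub_left] at hnorm
    have hvalue := mul_le_mul_of_nonneg_left (hform ▸ form_comp_le hM hC h0 u) ht.le
    have hdist_sq := pow_le_pow_left₀ (norm_nonneg _) hdist 2
    linarith [mul_nonneg ht.le (form_self_nonneg (c - u))]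
  refine sub_eq_zero.1 (incl_injective ?_)
  rw [map_zero, ← norm_eq_zero, ← sq_eq_zero_iff]
  exact le_antisymm hzero (sq_nonneg _)

end Contraction

theorem IsResolvent.apply_mem_Icc [PosFiniteAtoms m] (hM : IsMarkovian S.value) {t : ℝ} (ht : 0 < t)
    {R : Lp ℝ 2 m →L[ℝ] FormSpace S} (hR : IsResolvent t R) {f : Lp ℝ 2 m}
    (hf : ∀ x, f x ∈ Set.Icc 0 1) (x : X) : R f x ∈ Set.Icc 0 1 := by
  have hC : LipschitzWith 1 fun s : ℝ => max 0 (min 1 s) :=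
    (LipschitzWith.id.const_min 1).const_max 0
  rw [← comp_resolvent hM hC (by simp) ht hR
    fun x => by rw [min_eq_right (hf x).2, max_eq_right (hf x).1], comp_apply]
  exact ⟨le_max_left _ _, max_le zero_le_one (min_le_left _ _)⟩

variable [PosFiniteAtoms m] [Countable X] [DiscreteMeasurableSpace X]
  [CompleteSpace (FormSpace S)]

theorem tendsto_form {α : Type*} {l : Filter α} {u : α → FormSpace S} {u₀ : FormSpace S} {K : ℝ}
    (hb : ∀ n, ‖u n‖ ≤ K) (he : ∀ x, Tendsto (fun n => u n x) l (𝓝 (u₀ x))) (v : FormSpace S) :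
    Tendsto (fun n => form (u n) v) l (𝓝 (form u₀ v)) := by
  have hincl : Tendsto (fun n => ⟪incl (u n), incl v⟫) l (𝓝 ⟪incl u₀, incl v⟫) := by
    refine tendsto_inner_of_bounded (R := K) (lpEval m) (fun f h => lp_ext fun x => ?_)
      (fun n => ?_) he _
    · exact (h x).trans (lp_zero_apply x).symm
    · refine (le_of_sq_le_sq ?_ (norm_nonneg _)).trans (hb n)
      rw [norm_sq_eq]
      exact le_add_of_nonneg_left (form_self_nonneg (u n))
  simpa only [inner_eq, add_sub_cancel_right] using (tendsto_inner hb he v).sub hincl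

theorem IsResolvent.tendsto_approxForm_div {τ : ℕ → ℝ} {R : ℕ → Lp ℝ 2 m →L[ℝ] FormSpace S}
    (hR : ∀ n, IsResolvent (τ n) (R n)) (hτ : ∀ n, 0 < τ n) (hτ1 : ∀ n, τ n ≤ 1)
    (hτ0 : Tendsto τ atTop (𝓝 0)) (u v : FormSpace S) :
    Tendsto (fun n => approxForm (R n) (incl u) (incl v) / τ n) atTop (𝓝 (form u v)) := by
  refine (tendsto_form (fun n => (hR n).norm_le (hτ n) (hτ1 n) u) (fun x =>
    ((lpEval m x).continuous.tendsto _).comp (tendsto_incl hR hτ hτ0 u)) v).congr fun n => ?_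
  rw [(hR n).approxForm_incl, mul_div_cancel_left₀ _ (hτ n).ne']

end Discrete

end FormSpace

/-! ### Finitely supported functions and the approximating forms -/

theorem sum_sum_mul_mul_eq {X : Type*} {k : X → X → ℝ} (hk : ∀ x y, k x y = k y x) (s : Finset X)
    (a : X → ℝ) :
    ∑ x ∈ s, ∑ y ∈ s, k x y * (a x * a y) =
      ∑ x ∈ s, (∑ y ∈ s, k x y) * a x ^ 2 - ∑ x ∈ s, ∑ y ∈ s, k x y / 2 * (a x - a y) ^ 2 := by
  have hswap : ∑ x ∈ s, ∑ y ∈ s, k x y * a y ^ 2 = ∑ x ∈ s, ∑ y ∈ s, k x y * a x ^ 2 := by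
    rw [Finset.sum_comm]
    exact Finset.sum_congr rfl fun x _ => Finset.sum_congr rfl fun y _ => by rw [hk]
  have hsq : ∑ x ∈ s, ∑ y ∈ s, k x y / 2 * (a x - a y) ^ 2 =
      (∑ x ∈ s, ∑ y ∈ s, k x y * a x ^ 2 + ∑ x ∈ s, ∑ y ∈ s, k x y * a y ^ 2) / 2 -
        ∑ x ∈ s, ∑ y ∈ s, k x y * (a x * a y) := by
    simp only [← Finset.sum_add_distrib, Finset.sum_div, ← Finset.sum_sub_distrib]
    exact Finset.sum_congr rfl fun x _ => Finset.sum_congr rfl fun y _ => by ring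
  rw [hsq, hswap]
  simp only [Finset.sum_mul]
  ring

section Lp

variable {X : Type*} [MeasurableSpace X] [DiscreteMeasurableSpace X]

/-- The characteristic function of a point in `ℓ²(X,m)`. -/
def lpDirac (m : Measure X) [PosFiniteAtoms m] (x : X) : Lp ℝ 2 m :=
  indicatorConstLp 2 (measurableSet_singleton x) (PosFiniteAtoms.lt_top x).ne 1

/-- The function which agrees with `f` on the finite set `s` and vanishes off `s`, in `ℓ²(X,m)`. -/
def lpRestrict (m : Measure X) [PosFiniteAtoms m] (s : Finset X) (f : X → ℝ) : Lp ℝ 2 m :=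
  ∑ x ∈ s, f x • lpDirac m x

variable {m : Measure X} [PosFiniteAtoms m]

open Classical in
theorem lpDirac_apply (x y : X) : lpDirac m x y = if y = x then 1 else 0 := by
  have h := forall_of_ae (m := m) (indicatorConstLp_coeFn (p := 2)
    (hs := measurableSet_singleton x) (hμs := (PosFiniteAtoms.lt_top (m := m) x).ne) (c := (1 : ℝ)))
  rw [lpDirac, h, Set.indicator_apply]
  simp only [Set.mem_singleton_iff]

theorem inner_lpDirac (f : Lp ℝ 2 m) (x : X) : ⟪f, lpDirac m x⟫ = m.real {x} * f x := by
  rw [real_inner_comm, lpDirac, L2.inner_indicatorConstLp_one, integral_singleton, smul_eq_mul]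

theorem inner_lpRestrict (f : Lp ℝ 2 m) (s : Finset X) (a : X → ℝ) :
    ⟪f, lpRestrict m s a⟫ = ∑ x ∈ s, m.real {x} * (f x * a x) := by
  rw [lpRestrict, inner_sum]
  refine Finset.sum_congr rfl fun x _ => ?_
  rw [real_inner_smul_right, inner_lpDirac]
  ring

variable [Countable X]

open Classical in
theorem lpRestrict_apply (s : Finset X) (a : X → ℝ) (x : X) :
    lpRestrict m s a x = if x ∈ s then a x else 0 := by
  rw [← lpEval_apply (m := m), lpRestrict, map_sum]
  simp [lpDirac_apply]

theorem tendsto_lpRestrict (f : Lp ℝ 2 m) :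
    Tendsto (fun s : Finset X => lpRestrict m s f) atTop (𝓝 f) := by
  classical
  have htail : Tendsto (fun s : Finset X =>
      ∑' x : {x // x ∉ s}, ENNReal.ofReal (m.real {(x : X)} * f x ^ 2)) atTop (𝓝 0) :=
    ENNReal.tendsto_tsum_compl_atTop_zero ((ofReal_norm_sq f).symm.trans_ne ENNReal.ofReal_ne_top)
  rw [tendsto_iff_norm_sub_tendsto_zero, ← tendsto_ofReal_sq_zero_iff]
  refine htail.congr fun s => ?_
  rw [ofReal_norm_sq]
  refine (tsum_subtype (s : Set X)ᶜ fun x => ENNReal.ofReal (m.real {x} * f x ^ 2)).trans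
    (tsum_congr fun x => ?_)
  rw [lp_sub_apply, lpRestrict_apply, Set.indicator_apply]
  by_cases hx : x ∈ s <;> simp [hx]

theorem tendsto_lpRestrict_sdiff [DecidableEq X] {f : Lp ℝ 2 m} {F : Finset X}
    (hf : ∀ x ∈ F, f x = 0) :
    Tendsto (fun s : Finset X => lpRestrict m (s \ F) f) atTop (𝓝 f) := by
  refine (tendsto_lpRestrict f).congr fun s => lp_ext fun x => ?_
  rw [lpRestrict_apply, lpRestrict_apply]
  by_cases hx : x ∈ F
  · simp [hx, hf x hx]
  · simp [hx]

end Lp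

namespace FormSpace

variable {X : Type*} [MeasurableSpace X] [DiscreteMeasurableSpace X] {m : Measure X}
  [PosFiniteAtoms m] {S : SymmPosForm (Lp ℝ 2 m)}

/-- The matrix `⟪R 1_x, 1_y⟫` of a resolvent. -/
def resolventKernel (R : Lp ℝ 2 m →L[ℝ] FormSpace S) (x y : X) : ℝ :=
  ⟪incl (R (lpDirac m x)), lpDirac m y⟫

theorem inner_resolvent_lpRestrict (R : Lp ℝ 2 m →L[ℝ] FormSpace S) (s s' : Finset X)
    (a b : X → ℝ) :
    ⟪incl (R (lpRestrict m s a)), lpRestrict m s' b⟫ =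
      ∑ x ∈ s, ∑ y ∈ s', resolventKernel R x y * (a x * b y) := by
  simp only [lpRestrict, map_sum, map_smul]
  rw [sum_inner]
  refine Finset.sum_congr rfl fun x _ => ?_
  rw [inner_sum]
  refine Finset.sum_congr rfl fun y _ => ?_
  rw [real_inner_smul_left, real_inner_smul_right, resolventKernel]
  ring

namespace IsResolvent

variable {t : ℝ} {R : Lp ℝ 2 m →L[ℝ] FormSpace S}

theorem kernel_comm (hR : IsResolvent t R) (x y : X) :
    resolventKernel R x y = resolventKernel R y x := by
  rw [resolventKernel, hR.inner_comm, real_inner_comm, resolventKernel]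

theorem kernel_nonneg (hR : IsResolvent t R) (hM : IsMarkovian S.value) (ht : 0 < t) (x y : X) :
    0 ≤ resolventKernel R x y := by
  classical
  rw [resolventKernel, inner_lpDirac]
  refine mul_nonneg (measureReal_singleton_pos m y).le (hR.apply_mem_Icc hM ht (fun z => ?_) y).1
  rw [lpDirac_apply]
  split_ifs <;> simp

variable [Countable X]

theorem sum_kernel_le (hR : IsResolvent t R) (hM : IsMarkovian S.value) (ht : 0 < t)
    (s : Finset X) (x : X) : ∑ y ∈ s, resolventKernel R x y ≤ m.real {x} := by
  classical
  have hsum : ∑ y ∈ s, resolventKernel R x y = ⟪incl (R (lpRestrict m s 1)), lpDirac m x⟫ := by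
    rw [lpRestrict, map_sum, map_sum, sum_inner]
    refine Finset.sum_congr rfl fun y _ => ?_
    rw [hR.kernel_comm, resolventKernel, Pi.one_apply, one_smul]
  rw [hsum, inner_lpDirac]
  refine mul_le_of_le_one_right (measureReal_singleton_pos m x).le
    (hR.apply_mem_Icc hM ht (fun z => ?_) x).2
  rw [lpRestrict_apply]
  split_ifs <;> simp

theorem approxForm_lpRestrict_add_eq (hR : IsResolvent t R) {F F' : Finset X} (hF : Disjoint F F')
    (a : X → ℝ) :
    approxForm R (lpRestrict m F' a) (lpRestrict m F' a) +
        approxForm R (lpRestrict m F 1) (lpRestrict m F' fun x => a x ^ 2) =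
      ∑ x ∈ F', (m.real {x} - ∑ y ∈ F.disjUnion F' hF, resolventKernel R x y) * a x ^ 2 +
        ∑ x ∈ F', ∑ y ∈ F', resolventKernel R x y / 2 * (a x - a y) ^ 2 := by
  classical
  have hdiag : ⟪lpRestrict m F' a, lpRestrict m F' a⟫ = ∑ x ∈ F', m.real {x} * a x ^ 2 := by
    rw [inner_lpRestrict]
    refine Finset.sum_congr rfl fun x hx => ?_
    rw [lpRestrict_apply, if_pos hx, sq]
  have hdisj : ⟪lpRestrict m F 1, lpRestrict m F' fun x => a x ^ 2⟫ = 0 := by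
    rw [inner_lpRestrict]
    refine Finset.sum_eq_zero fun x hx => ?_
    rw [lpRestrict_apply, if_neg (Finset.disjoint_right.1 hF hx), zero_mul, mul_zero]
  have hcross : ∑ x ∈ F, ∑ y ∈ F', resolventKernel R x y * ((1 : X → ℝ) x * a y ^ 2) =
      ∑ x ∈ F', (∑ y ∈ F, resolventKernel R x y) * a x ^ 2 := by
    rw [Finset.sum_comm]
    refine Finset.sum_congr rfl fun x _ => ?_
    rw [Finset.sum_mul]
    refine Finset.sum_congr rfl fun y _ => ?_
    rw [hR.kernel_comm, Pi.one_apply, one_mul]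
  rw [approxForm, approxForm, inner_sub_left, inner_sub_left, inner_resolvent_lpRestrict,
    inner_resolvent_lpRestrict, sum_sum_mul_mul_eq hR.kernel_comm, hdiag, hdisj, hcross]
  simp only [Finset.sum_disjUnion, sub_mul, add_mul, Finset.sum_sub_distrib,
    Finset.sum_add_distrib]
  ring

/-- Adding `approxForm R 1_F (a²)` removes from the form at `a` the contribution of the jumps
between `F` and its complement. -/
theorem approxForm_lpRestrict_add_le (hR : IsResolvent t R) (hM : IsMarkovian S.value) (ht : 0 < t)
    {F F' : Finset X} (hF : Disjoint F F') {a b : X → ℝ} (h1 : ∀ x, |b x| ≤ |a x|)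
    (h2 : ∀ x y, |b x - b y| ≤ |a x - a y|) :
    approxForm R (lpRestrict m F' b) (lpRestrict m F' b) +
        approxForm R (lpRestrict m F 1) (lpRestrict m F' fun x => b x ^ 2) ≤
      approxForm R (lpRestrict m F' a) (lpRestrict m F' a) +
        approxForm R (lpRestrict m F 1) (lpRestrict m F' fun x => a x ^ 2) := by
  rw [hR.approxForm_lpRestrict_add_eq hF, hR.approxForm_lpRestrict_add_eq hF]
  refine add_le_add (Finset.sum_le_sum fun x _ => mul_le_mul_of_nonneg_left (sq_le_sq.2 (h1 x))
    (sub_nonneg.2 (hR.sum_kernel_le hM ht _ x))) (Finset.sum_le_sum fun x _ =>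
      Finset.sum_le_sum fun y _ => mul_le_mul_of_nonneg_left (sq_le_sq.2 (h2 x y))
        (div_nonneg (hR.kernel_nonneg hM ht x y) zero_le_two))

theorem approxForm_add_le (hR : IsResolvent t R) (hM : IsMarkovian S.value) (ht : 0 < t)
    {F : Finset X} {g g₂ c c₂ : Lp ℝ 2 m} (hg0 : ∀ x ∈ F, g x = 0) (hg₂ : ∀ x, g₂ x = g x ^ 2)
    (hc₂ : ∀ x, c₂ x = c x ^ 2) (h1 : ∀ x, |c x| ≤ |g x|)
    (h2 : ∀ x y, |c x - c y| ≤ |g x - g y|) :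
    approxForm R c c + approxForm R (lpRestrict m F 1) c₂ ≤
      approxForm R g g + approxForm R (lpRestrict m F 1) g₂ := by
  classical
  have hlim {f f₂ : Lp ℝ 2 m} (hf : ∀ x ∈ F, f x = 0) (hf₂ : ∀ x, f₂ x = f x ^ 2) :
      Tendsto (fun s : Finset X => approxForm R (lpRestrict m (s \ F) f) (lpRestrict m (s \ F) f) +
          approxForm R (lpRestrict m F 1) (lpRestrict m (s \ F) fun x => f x ^ 2)) atTop
        (𝓝 (approxForm R f f + approxForm R (lpRestrict m F 1) f₂)) := by
    rw [← (funext hf₂ : (f₂ : X → ℝ) = fun x => f x ^ 2)]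
    have hf₂0 : ∀ x ∈ F, f₂ x = 0 := fun x hx => by rw [hf₂, hf x hx, zero_pow two_ne_zero]
    exact (tendsto_approxForm R (tendsto_lpRestrict_sdiff hf) (tendsto_lpRestrict_sdiff hf)).add
      (tendsto_approxForm R tendsto_const_nhds (tendsto_lpRestrict_sdiff hf₂0))
  have hc0 : ∀ x ∈ F, c x = 0 := fun x hx => abs_nonpos_iff.1 (by simpa [hg0 x hx] using h1 x)
  exact le_of_tendsto_of_tendsto' (hlim hc0 hc₂) (hlim hg0 hg₂) fun s =>
    hR.approxForm_lpRestrict_add_le hM ht Finset.disjoint_sdiff h1 h2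

end IsResolvent

theorem form_add_le_of_eq_zero_on [Countable X] [CompleteSpace (FormSpace S)]
    (hM : IsMarkovian S.value) {F : Finset X} {e g g₂ c c₂ : FormSpace S}
    (he : incl e = lpRestrict m F 1) (hg0 : ∀ x ∈ F, g x = 0) (hg₂ : ∀ x, g₂ x = g x ^ 2)
    (hc₂ : ∀ x, c₂ x = c x ^ 2) (h1 : ∀ x, |c x| ≤ |g x|)
    (h2 : ∀ x y, |c x - c y| ≤ |g x - g y|) :
    form c c + form e c₂ ≤ form g g + form e g₂ := by
  have hpos (n : ℕ) : 0 < 1 / ((n : ℝ) + 1) := by positivity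
  have hle (n : ℕ) : 1 / ((n : ℝ) + 1) ≤ 1 := by
    rw [div_le_one (by positivity)]
    linarith [(n.cast_nonneg : (0 : ℝ) ≤ n)]
  choose R hR using fun n : ℕ => exists_isResolvent (S := S) (hpos n)
  have hlim := IsResolvent.tendsto_approxForm_div hR hpos hle
    tendsto_one_div_add_atTop_nhds_zero_nat
  refine le_of_tendsto_of_tendsto' ((hlim c c).add (hlim e c₂)) ((hlim g g).add (hlim e g₂))
    fun n => ?_
  rw [← add_div, ← add_div, he]
  exact div_le_div_of_nonneg_right ((hR n).approxForm_add_le hM (hpos n) hg0 hg₂ hc₂ h1 h2)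
    (hpos n).le

end FormSpace

/-! ### The difference to the Neumann form -/

theorem FormSpace.exists_eq_sq {X : Type*} [MeasurableSpace X] {m : Measure X} [PosFiniteAtoms m]
    {S : SymmPosForm (Lp ℝ 2 m)} (hM : IsMarkovian S.value) (u : FormSpace S) {K : ℝ} (hK : 0 < K)
    (hu : ∀ x, |u x| ≤ K) : ∃ w : FormSpace S, ∀ x, w x = u x ^ 2 := by
  have hC : LipschitzWith 1 fun t : ℝ => clamp K t ^ 2 / (2 * K) := by
    refine LipschitzWith.of_dist_le_mul fun s t => ?_
    rw [Real.dist_eq, Real.dist_eq, NNReal.coe_one, one_mul, ← sub_div, abs_div,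
      abs_of_pos (by positivity : 0 < 2 * K), div_le_iff₀ (by positivity), sq_sub_sq, abs_mul,
      mul_comm]
    refine mul_le_mul (abs_sub_le_of_lipschitzWith (lipschitzWith_clamp K) s t) ?_ (abs_nonneg _)
      (abs_nonneg _)
    linarith [abs_add_le (clamp K s) (clamp K t), abs_clamp_le hK.le s, abs_clamp_le hK.le t]
  refine ⟨(2 * K) • comp hM hC (by simp [clamp_zero hK.le]) u, fun x => ?_⟩
  rw [smul_apply, comp_apply, clamp_eq_self (hu x)]
  field_simp

namespace WGraph

open FormSpace

section EdgesAt

variable {X : Type*}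

/-- The terms of the energy, indexed by `(X × X) ⊕ X`, which involve a point of `F`. -/
def edgesAt (F : Finset X) : Set ((X × X) ⊕ X) :=
  {y | Sum.elim (fun p => p.1 ∈ F ∨ p.2 ∈ F) (fun x => x ∈ F) y}

theorem exists_subset_edgesAt (A : Finset ((X × X) ⊕ X)) : ∃ F : Finset X, ↑A ⊆ edgesAt F := by
  classical
  refine ⟨A.biUnion (Sum.elim (fun p => {p.1}) fun x => {x}), fun y hy => ?_⟩
  rcases y with p | x
  · exact Or.inl (Finset.mem_biUnion.2 ⟨_, hy, by simp⟩)
  · exact Finset.mem_biUnion.2 ⟨_, hy, by simp⟩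

open Classical in
theorem indicator_edgesAt_grad_sq (F : Finset X) (u : X → ℝ) (y : (X × X) ⊕ X) :
    (edgesAt F).indicator (fun y => grad u y ^ 2) y =
      grad u y ^ 2 - grad (fun x => if x ∈ F then 0 else u x) y ^ 2 -
        grad (fun x => if x ∈ F then 1 else 0) y *
          grad (fun x => (if x ∈ F then 0 else u x) ^ 2) y := by
  rcases y with p | x
  · by_cases h1 : p.1 ∈ F <;> by_cases h2 : p.2 ∈ F <;>
      simp [edgesAt, Set.indicator_apply, h1, h2]
  · by_cases hx : x ∈ F <;> simp [edgesAt, Set.indicator_apply, hx]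

end EdgesAt

variable {X : Type*} [MeasurableSpace X] [Countable X] [DiscreteMeasurableSpace X]
  {G : WGraph X} {m : Measure X} [PosFiniteAtoms m]

theorem Dom.hasSum_form_self (u : G.Dom m) :
    HasSum (fun y => G.weight y * grad u y ^ 2) (form u u) := by
  have henergy : G.energy u = ENNReal.ofReal (form u u) := by
    rw [← value_incl, neumannForm_value]
    rfl
  rw [energy_eq_tsum] at henergy
  have hsum := ENNReal.hasSum_toReal (henergy.trans_ne ENNReal.ofReal_ne_top)
  rw [← ENNReal.tsum_toReal_eq fun _ => ENNReal.ofReal_ne_top, henergy,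
    ENNReal.toReal_ofReal (form_self_nonneg _)] at hsum
  convert! hsum using 2 with y
  rw [ENNReal.toReal_ofReal (mul_nonneg (weight_nonneg _ y) (sq_nonneg _))]

theorem Dom.hasSum_form (u v : G.Dom m) :
    HasSum (fun y => G.weight y * (grad u y * grad v y)) (form u v) := by
  have h := ((Dom.hasSum_form_self (u + v)).sub (Dom.hasSum_form_self (u - v))).div_const 4
  rw [form_add_self, form_sub_self] at h
  convert! h using 1
  · funext y
    rw [grad_add, grad_sub]
    ring
  · ring

variable {S : SymmPosForm (Lp ℝ 2 m)}

/-- The inclusion of the domain of a form above `Q^(N)` into `D(Q^(N))`. -/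
def toDom (hN : G.neumann m ≤ S.value) : FormSpace S →L[ℝ] G.Dom m :=
  LinearMap.mkContinuous
    { toFun := fun u => Dom.ofLp (incl u) ((hN _).trans_lt (value_incl_lt_top u))
      map_add' := fun u v => incl_injective (by simp)
      map_smul' := fun c u => incl_injective (by simp) }
    1 fun u => by
      rw [one_mul]
      refine le_of_sq_le_sq ?_ (norm_nonneg _)
      rw [norm_sq_eq, norm_sq_eq]
      exact add_le_add (form_le_of_value_le (by rw [neumannForm_value]; exact hN _)) le_rfl

theorem incl_toDom (hN : G.neumann m ≤ S.value) (u : FormSpace S) :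
    incl (toDom hN u) = incl u := rfl

/-- An element of `D(Q^(D))`, in the domain of a form below `Q^(D)`. -/
def ofDirichletDomain (hD : S.value ≤ G.dirichlet m) (d : G.Dom m)
    (hd : d ∈ G.dirichletDomain m) : FormSpace S :=
  of (incl d) ((hD _).trans_lt ((dirichlet_incl_lt_top_iff d).2 hd))

theorem incl_ofDirichletDomain (hD : S.value ≤ G.dirichlet m) (d : G.Dom m)
    (hd : d ∈ G.dirichletDomain m) : incl (ofDirichletDomain hD d hd) = incl d := rfl

section Comparison

variable (hN : G.neumann m ≤ S.value) (hD : S.value ≤ G.dirichlet m)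

include hD

theorem form_eq_form_toDom {d : FormSpace S} (hd : toDom hN d ∈ G.dirichletDomain m)
    (v : FormSpace S) : form v d = form (toDom hN v) (toDom hN d) := by
  refine form_eq_of_value_eq (by rwa [neumannForm_value]) (toDom hN).toLinearMap (incl_toDom hN)
    ?_ v
  rw [neumannForm_value]
  refine le_antisymm ((hD _).trans_eq ?_) (hN _)
  rw [← incl_toDom hN d]
  exact dirichlet_incl_of_mem hd

theorem form_sub_form_toDom_add {d : FormSpace S} (hd : toDom hN d ∈ G.dirichletDomain m)
    (v : FormSpace S) :
    form (v + d) (v + d) - form (toDom hN (v + d)) (toDom hN (v + d)) =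
      form v v - form (toDom hN v) (toDom hN v) := by
  rw [map_add (toDom hN), form_add_self, form_add_self, form_eq_form_toDom hN hD hd,
    form_eq_form_toDom hN hD hd]
  ring

omit hN in
/-- The restriction of `f` to a finite set, in the domain of a form below `Q^(D)`. -/
def formRestrict (s : Finset X) (f : X → ℝ) : FormSpace S :=
  ofDirichletDomain hD (Dom.restrict s f) (restrict_mem_dirichletDomain s f)

open Classical in
theorem formRestrict_apply (s : Finset X) (f : X → ℝ) (x : X) :
    formRestrict hD s f x = if x ∈ s then f x else 0 :=
  Dom.restrict_apply s f x

open Classical in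
theorem sub_formRestrict_apply (u : FormSpace S) (F : Finset X) (x : X) :
    (u - formRestrict hD F u) x = if x ∈ F then 0 else u x := by
  rw [FormSpace.sub_apply, formRestrict_apply]
  split_ifs <;> simp

theorem incl_formRestrict (s : Finset X) (f : X → ℝ) :
    incl (formRestrict hD s f : FormSpace S) = lpRestrict m s f := by
  classical
  exact lp_ext fun x => by rw [incl_apply, formRestrict_apply, lpRestrict_apply]

include hN in
/-- On `D(Q^(D))` all forms between `Q^(N)` and `Q^(D)` agree, so the jumps at a finite set are
those of the graph. -/
theorem hasSum_indicator_edgesAt (u : FormSpace S) (F : Finset X) {w : FormSpace S}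
    (hw : ∀ x, w x = (u - formRestrict hD F u) x ^ 2) :
    HasSum (fun y => G.weight y * (edgesAt F).indicator (fun y => grad u y ^ 2) y)
      (form u u - (form (u - formRestrict hD F u) (u - formRestrict hD F u) +
        form (formRestrict hD F 1) w)) := by
  classical
  set g := u - formRestrict hD F u with hg
  have hg_coe : (g : X → ℝ) = fun x => if x ∈ F then 0 else u x :=
    funext (sub_formRestrict_apply hD u F)
  have hw_coe : (w : X → ℝ) = fun x => (if x ∈ F then 0 else u x) ^ 2 :=
    funext fun x => by rw [hw, hg_coe]
  have he_coe : (formRestrict hD F 1 : FormSpace S) = fun x : X => if x ∈ F then (1 : ℝ) else 0 :=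
    funext (formRestrict_apply hD F 1)
  have hdiff : form u u - form (toDom hN u) (toDom hN u) =
      form g g - form (toDom hN g) (toDom hN g) := by
    rw [← form_sub_form_toDom_add hN hD (d := formRestrict hD F u)
      (restrict_mem_dirichletDomain F u) g, hg, sub_add_cancel]
  have hjump : form (formRestrict hD F 1) w =
      form (toDom hN (formRestrict hD F 1)) (toDom hN w) := by
    rw [form_comm, form_eq_form_toDom hN hD (restrict_mem_dirichletDomain F 1), form_comm]
  convert! ((Dom.hasSum_form_self (toDom hN u)).sub (Dom.hasSum_form_self (toDom hN g))).sub
    (Dom.hasSum_form (toDom hN (formRestrict hD F 1)) (toDom hN w)) using 1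
  · funext y
    rw [indicator_edgesAt_grad_sq, ← hg_coe, ← hw_coe, ← he_coe, mul_sub, mul_sub]
    rfl
  · rw [hjump]
    linarith

variable (hM : IsMarkovian S.value) [CompleteSpace (FormSpace S)] {C : ℝ → ℝ}
  (hC : LipschitzWith 1 C) (h0 : C 0 = 0)

include hN

theorem form_comp_add_sum_le_of_abs_le (f : FormSpace S) {K : ℝ} (hf : ∀ x, |f x| ≤ K)
    (A : Finset ((X × X) ⊕ X)) :
    form (comp hM hC h0 f) (comp hM hC h0 f) + ∑ y ∈ A, G.weight y * grad f y ^ 2 ≤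
      form f f + ∑ y ∈ A, G.weight y * grad (comp hM hC h0 f) y ^ 2 := by
  classical
  obtain ⟨F, hF⟩ := exists_subset_edgesAt A
  set k := comp hM hC h0 f
  set g := f - formRestrict hD F f
  set c := k - formRestrict hD F k
  have hg (x : X) : g x = if x ∈ F then 0 else f x := sub_formRestrict_apply hD f F x
  have hc (x : X) : c x = C (g x) := by
    rw [sub_formRestrict_apply, hg, comp_apply, apply_ite C, h0]
  have hc_le (x : X) : |c x| ≤ |g x| := hc x ▸ abs_le_of_lipschitzWith hC h0 _
  have hg_le (x : X) : |g x| ≤ max K 1 := by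
    rw [hg]
    split_ifs
    · simp
    · exact (hf x).trans (le_max_left _ _)
  have hpos : 0 < max K 1 := lt_max_of_lt_right one_pos
  obtain ⟨g₂, hg₂⟩ := exists_eq_sq hM g hpos hg_le
  obtain ⟨c₂, hc₂⟩ := exists_eq_sq hM c hpos fun x => (hc_le x).trans (hg_le x)
  have hoff : form c c + form (formRestrict hD F 1) c₂ ≤
      form g g + form (formRestrict hD F 1) g₂ :=
    form_add_le_of_eq_zero_on hM (incl_formRestrict hD F 1) (fun x hx => by rw [hg, if_pos hx])
      hg₂ hc₂ hc_le fun x y => by rw [hc, hc]; exact abs_sub_le_of_lipschitzWith hC _ _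
  have hgrad (y : (X × X) ⊕ X) : grad k y ^ 2 ≤ grad f y ^ 2 :=
    sq_le_sq.2 <| by
      rw [show (k : X → ℝ) = fun x => C (f x) from funext (comp_apply hM hC h0 f)]
      exact abs_grad_comp_le hC h0 f y
  have hjump := sum_le_hasSum A (fun y _ => ?_)
    ((hasSum_indicator_edgesAt hN hD f F hg₂).sub (hasSum_indicator_edgesAt hN hD k F hc₂))
  · rw [Finset.sum_congr rfl fun y hy => by
      rw [Set.indicator_of_mem (hF hy), Set.indicator_of_mem (hF hy)],
      Finset.sum_sub_distrib] at hjump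
    linarith
  · rw [← mul_sub]
    exact mul_nonneg (G.weight_nonneg y)
      (sub_nonneg.2 (Set.indicator_le_indicator (hgrad y)))

theorem form_comp_add_sum_le (f : FormSpace S) (A : Finset ((X × X) ⊕ X)) :
    form (comp hM hC h0 f) (comp hM hC h0 f) + ∑ y ∈ A, G.weight y * grad f y ^ 2 ≤
      form f f + ∑ y ∈ A, G.weight y * grad (comp hM hC h0 f) y ^ 2 := by
  set k := comp hM hC h0 f with hk
  set f' : ℕ → FormSpace S := fun n => comp hM (lipschitzWith_clamp n) (clamp_zero n.cast_nonneg) f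
  set k' : ℕ → FormSpace S := fun n => comp hM hC h0 (f' n)
  have hf' (n : ℕ) (x : X) : f' n x = clamp n (f x) := comp_apply _ _ _ _ _
  have hlim_f' (x : X) : Tendsto (fun n => f' n x) atTop (𝓝 (f x)) := by
    simpa only [hf'] using tendsto_clamp (f x)
  have hlim_k' (x : X) : Tendsto (fun n => k' n x) atTop (𝓝 (k x)) := by
    simpa only [k', hk, comp_apply, Function.comp_def] using
      (hC.continuous.tendsto (f x)).comp (hlim_f' x)
  have hlim_sum {u : ℕ → FormSpace S} {v : FormSpace S}
      (h : ∀ x, Tendsto (fun n => u n x) atTop (𝓝 (v x))) :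
      Tendsto (fun n => ∑ y ∈ A, G.weight y * grad (u n) y ^ 2) atTop
        (𝓝 (∑ y ∈ A, G.weight y * grad v y ^ 2)) :=
    tendsto_finsetSum _ fun y _ => ((tendsto_grad h y).pow 2).const_mul _
  have hlim_form : Tendsto (fun n => form (k' n) k) atTop (𝓝 (form k k)) :=
    tendsto_form (fun n => (norm_comp_le hM hC h0 _).trans (norm_comp_le hM _ _ f)) hlim_k' k
  have hle := le_of_tendsto_of_tendsto'
    (((hlim_form.const_mul 2).sub_const (form k k)).add (hlim_sum hlim_f'))
    ((hlim_sum hlim_k').const_add (form f f)) fun n => by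
      have hbdd := form_comp_add_sum_le_of_abs_le hN hD hM hC h0 (f' n) (K := n)
        (fun x => hf' n x ▸ abs_clamp_le n.cast_nonneg _) A
      linarith [two_mul_form_le (k' n) k,
        form_comp_le hM (lipschitzWith_clamp n) (clamp_zero n.cast_nonneg) f]
  linarith

theorem form_comp_add_form_toDom_le (f : FormSpace S) :
    form (comp hM hC h0 f) (comp hM hC h0 f) + form (toDom hN f) (toDom hN f) ≤
      form f f + form (toDom hN (comp hM hC h0 f)) (toDom hN (comp hM hC h0 f)) :=
  le_of_tendsto_of_tendsto' (Tendsto.const_add _ (Dom.hasSum_form_self (toDom hN f)))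
    (Tendsto.const_add _ (Dom.hasSum_form_self (toDom hN (comp hM hC h0 f))))
    fun A => form_comp_add_sum_le hN hD hM hC h0 f A

end Comparison

end WGraph

/-! ### Trace forms -/

theorem diffOnDomain_lt_top {Ω : Type*} [MeasurableSpace Ω] {μ : Measure Ω}
    {q q' : Lp ℝ 2 μ → ℝ≥0∞} {φ : Lp ℝ 2 μ} : diffOnDomain q q' φ < ⊤ ↔ q φ < ⊤ := by
  rw [diffOnDomain]
  split_ifs with h
  · exact iff_of_true (tsub_le_self.trans_lt h) h
  · exact iff_of_false (lt_irrefl _) h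

namespace WGraph

open FormSpace

theorem exists_of_traceForm_lt_top {X : Type*} [MeasurableSpace X] {G : WGraph X} {m : Measure X}
    {Q : Lp ℝ 2 m → ℝ≥0∞} {o : X} {φ : G.L2Boundary m o} (h : G.traceForm m o Q φ < ⊤) :
    ∃ f, Q f < ⊤ ∧ G.trace m o f = φ := by
  by_contra hφ
  rw [traceForm, if_neg hφ] at h
  exact lt_irrefl _ h

variable {X : Type*} [MeasurableSpace X] [Countable X] [DiscreteMeasurableSpace X]
  {G : WGraph X} {m : Measure X} [PosFiniteAtoms m]

theorem dirichletToNeumann_traceMap (hG : G.Connected) (o : X) (u : G.Dom m) :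
    G.dirichletToNeumann m o (G.traceMap m o u) = ENNReal.ofReal (‖harmonicPart u‖ ^ 2) := by
  rw [dirichletToNeumann, traceForm, if_pos ⟨incl u, Dom.neumann_incl_lt_top u, rfl⟩,
    harmonicExtension_traceMap hG, Dom.one_neumann_incl]

theorem exists_traceMap_eq_of_dirichletToNeumann_lt_top {o : X} {φ : G.L2Boundary m o}
    (h : G.dirichletToNeumann m o φ < ⊤) : ∃ u : G.Dom m, G.traceMap m o u = φ := by
  obtain ⟨f, hf, hφ⟩ := exists_of_traceForm_lt_top h
  exact ⟨Dom.ofLp f hf, hφ⟩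

section TraceForm

variable {S : SymmPosForm (Lp ℝ 2 m)} (hN : G.neumann m ≤ S.value)

/-- The part of `D(Q^(D))` in the domain of a form above `Q^(N)`. -/
def formDirichletDomain : Submodule ℝ (FormSpace S) :=
  (G.dirichletDomain m).comap (toDom hN).toLinearMap

instance [CompleteSpace (FormSpace S)] : CompleteSpace (formDirichletDomain hN) :=
  ((isClosed_dirichletDomain G m).preimage (toDom hN).continuous).completeSpace_coe

variable [CompleteSpace (FormSpace S)]

/-- The orthogonal projection onto the `1`-harmonic functions in the domain of a form above
`Q^(N)`. -/
def formHarmonicPart : FormSpace S →L[ℝ] FormSpace S := (formDirichletDomain hN)ᗮ.starProjection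

theorem sub_formHarmonicPart_mem (v : FormSpace S) :
    v - formHarmonicPart hN v ∈ formDirichletDomain hN := by
  rw [formHarmonicPart, Submodule.starProjection_orthogonal_val, sub_sub_cancel]
  exact Submodule.starProjection_apply_mem _ _

theorem norm_formHarmonicPart_le (v : FormSpace S) : ‖formHarmonicPart hN v‖ ≤ ‖v‖ :=
  Submodule.norm_starProjection_apply_le _ v

theorem formHarmonicPart_idem (v : FormSpace S) :
    formHarmonicPart hN (formHarmonicPart hN v) = formHarmonicPart hN v :=
  Submodule.starProjection_eq_self_iff.2 (Submodule.starProjection_apply_mem _ _)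

theorem traceMap_toDom_formHarmonicPart (o : X) (v : FormSpace S) :
    G.traceMap m o (toDom hN (formHarmonicPart hN v)) = G.traceMap m o (toDom hN v) := by
  have hsub := traceMap_eq_zero_of_mem o (sub_formHarmonicPart_mem hN v)
  rw [ContinuousLinearMap.coe_coe, map_sub, map_sub, sub_eq_zero] at hsub
  exact hsub.symm

variable (hD : S.value ≤ G.dirichlet m)

include hD

theorem toDom_formHarmonicPart (v : FormSpace S) :
    toDom hN (formHarmonicPart hN v) = harmonicPart (toDom hN v) := by
  refine (harmonicPart_eq_of_sub_mem ?_ ((Submodule.mem_orthogonal _ _).2 fun d hd => ?_)).symm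
  · rw [← map_sub]
    exact sub_formHarmonicPart_mem hN v
  · have h := (Submodule.mem_orthogonal _ _).1 (Submodule.starProjection_apply_mem
      (formDirichletDomain hN)ᗮ v) (ofDirichletDomain hD d hd) hd
    rw [real_inner_comm, inner_eq, form_eq_form_toDom hN hD hd] at h
    rw [real_inner_comm, inner_eq]
    exact h

theorem norm_sq_eq_add_formHarmonicPart (v : FormSpace S) :
    ‖v‖ ^ 2 = ‖toDom hN v - harmonicPart (toDom hN v)‖ ^ 2 + ‖formHarmonicPart hN v‖ ^ 2 := by
  have hd := sub_formHarmonicPart_mem hN v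
  have hnorm : ‖toDom hN v - harmonicPart (toDom hN v)‖ ^ 2 = ‖v - formHarmonicPart hN v‖ ^ 2 := by
    rw [← toDom_formHarmonicPart hN hD, ← map_sub, norm_sq_eq, norm_sq_eq,
      form_eq_form_toDom hN hD hd, incl_toDom]
  rw [hnorm]
  simpa [formHarmonicPart] using
    Submodule.norm_sq_eq_add_norm_sq_starProjection v (formDirichletDomain hN)

theorem norm_formHarmonicPart_sq_sub (v : FormSpace S) :
    ‖formHarmonicPart hN v‖ ^ 2 - ‖harmonicPart (toDom hN v)‖ ^ 2 =
      form v v - form (toDom hN v) (toDom hN v) := by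
  have hv := norm_sq_eq v
  have hu := norm_sq_eq (toDom hN v)
  rw [incl_toDom] at hu
  linarith [norm_sq_eq_add_formHarmonicPart hN hD v, norm_sq_eq_add_harmonicPart (toDom hN v)]

omit [CompleteSpace (FormSpace S)] hD in
theorem toDom_comp (hM : IsMarkovian S.value) {C : ℝ → ℝ} (hC : LipschitzWith 1 C) (h0 : C 0 = 0)
    (v : FormSpace S) : toDom hN (comp hM hC h0 v) = Dom.comp hC h0 (toDom hN v) :=
  incl_injective (by rw [Dom.incl_comp]; rfl)

variable (hG : G.Connected) (o : X)

include hG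

theorem traceForm_traceMap (v : FormSpace S) :
    G.traceForm m o S.value (G.traceMap m o (toDom hN v)) =
      ENNReal.ofReal (‖formHarmonicPart hN v‖ ^ 2) := by
  rw [traceForm, if_pos ⟨incl v, value_incl_lt_top v, rfl⟩, harmonicExtension_traceMap hG,
    ← toDom_formHarmonicPart hN hD, incl_toDom, one_value_incl]

omit [CompleteSpace (FormSpace S)] hD hG in
variable {o} in
theorem exists_traceMap_toDom_eq_of_traceForm_lt_top {φ : G.L2Boundary m o}
    (h : G.traceForm m o S.value φ < ⊤) :
    ∃ v : FormSpace S, G.traceMap m o (toDom hN v) = φ := by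
  obtain ⟨f, hf, hφ⟩ := exists_of_traceForm_lt_top h
  exact ⟨of f hf, hφ⟩

include hN

theorem value_lt_top_iff_traceForm_lt_top (f : Lp ℝ 2 m) :
    S.value f < ⊤ ↔ G.neumann m f < ⊤ ∧ G.traceForm m o S.value (G.trace m o f) < ⊤ := by
  refine ⟨fun hf => ⟨(hN f).trans_lt hf, ?_⟩, fun ⟨hf, hφ⟩ => ?_⟩
  · have htrace := traceForm_traceMap hN hD hG o (of f hf)
    rw [traceMap_apply, incl_toDom, incl_of] at htrace
    exact htrace.trans_lt ENNReal.ofReal_lt_top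
  · obtain ⟨v, hv⟩ := exists_traceMap_toDom_eq_of_traceForm_lt_top hN hφ
    have hd : Dom.ofLp f hf - toDom hN v ∈ G.dirichletDomain m := by
      rw [← traceMap_eq_iff hG o, hv, traceMap_ofLp]
    have hfv : f = incl (v + ofDirichletDomain hD _ hd) := by
      rw [map_add, incl_ofDirichletDomain, map_sub, incl_toDom, Dom.incl_ofLp, add_sub_cancel]
    rw [hfv]
    exact value_incl_lt_top _

theorem value_incl_eq_neumann_add_traceForm_sub (v : FormSpace S) :
    S.value (incl v) = G.neumann m (incl v) + G.traceForm m o S.value (G.trace m o (incl v)) -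
      G.dirichletToNeumann m o (G.trace m o (incl v)) := by
  rw [← incl_toDom hN v, ← traceMap_apply, traceForm_traceMap hN hD hG,
    dirichletToNeumann_traceMap hG, ← neumannForm_value, value_incl, incl_toDom, value_incl,
    ← ENNReal.ofReal_add (form_self_nonneg _) (sq_nonneg _), ← ENNReal.ofReal_sub _ (sq_nonneg _)]
  congr 1
  linarith [norm_formHarmonicPart_sq_sub hN hD v]

theorem isRepresentedBy_traceForm :
    G.IsRepresentedBy m o S.value (G.traceForm m o S.value) := by
  refine ⟨value_lt_top_iff_traceForm_lt_top hN hD hG o, fun f hf => ?_⟩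
  obtain ⟨v, rfl⟩ : ∃ v : FormSpace S, incl v = f := ⟨of f hf, rfl⟩
  have hd := sub_harmonicPart_mem (toDom hN v)
  refine ⟨value_incl_eq_neumann_add_traceForm_sub hN hD hG o v,
    incl (toDom hN v - harmonicPart (toDom hN v)), incl (harmonicPart (toDom hN v)),
    ⟨?_, (dirichlet_incl_lt_top_iff _).2 hd, Dom.neumann_incl_lt_top _,
      (isOneHarmonic_iff _).2 (harmonicPart_mem _)⟩, ?_⟩
  · rw [map_sub, sub_add_cancel, incl_toDom]
  · have hone := Dom.one_neumann_incl (toDom hN v - harmonicPart (toDom hN v))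
    rw [one] at hone
    rw [one_value_incl, one, dirichlet_incl_of_mem hd, hone, ← incl_toDom hN, ← traceMap_apply,
      traceForm_traceMap hN hD hG, ← ENNReal.ofReal_add (sq_nonneg _) (sq_nonneg _),
      norm_sq_eq_add_formHarmonicPart hN hD v]

theorem isClosedForm_traceForm : IsClosedForm (G.traceForm m o S.value) := by
  refine isClosedForm_of_parametrization
    ((G.traceMap m o ∘L toDom hN) ∘L (formDirichletDomain hN)ᗮ.subtypeL) (innerₗ _) 1
    (fun u v => real_inner_comm v u) (fun u => real_inner_self_nonneg (x := u))
    (fun u => ?_) (fun u => ?_)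
    (fun u => ?_) (fun φ hφ => ?_)
  · rw [innerₗ_apply_apply, real_inner_self_eq_norm_sq, one_mul]
  · rw [innerₗ_apply_apply, real_inner_self_eq_norm_sq, one_mul]
    exact le_add_of_nonneg_right (sq_nonneg _)
  · have hu : formHarmonicPart hN u = u := Submodule.starProjection_eq_self_iff.2 u.2
    rw [innerₗ_apply_apply, real_inner_self_eq_norm_sq]
    exact (traceForm_traceMap hN hD hG o u).trans (by rw [hu, Submodule.coe_norm])
  · obtain ⟨v, rfl⟩ := exists_traceMap_toDom_eq_of_traceForm_lt_top hN hφ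
    exact ⟨⟨formHarmonicPart hN v, Submodule.starProjection_apply_mem _ _⟩,
      traceMap_toDom_formHarmonicPart hN o v⟩

theorem isMarkovian_traceForm (hM : IsMarkovian S.value) :
    IsMarkovian (G.traceForm m o S.value) := by
  intro C hC h0 φ
  rcases eq_top_or_lt_top (G.traceForm m o S.value φ) with h | h
  · exact h ▸ le_top
  obtain ⟨v, rfl⟩ := exists_traceMap_toDom_eq_of_traceForm_lt_top hN h
  rw [← traceMap_toDom_formHarmonicPart hN, ← traceMap_comp, ← toDom_comp hN hM,
    traceForm_traceMap hN hD hG, traceForm_traceMap hN hD hG, formHarmonicPart_idem]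
  gcongr
  exact (norm_formHarmonicPart_le hN _).trans (norm_comp_le hM hC h0 _)

theorem diffOnDomain_traceForm_traceMap (v : FormSpace S) :
    diffOnDomain (G.traceForm m o S.value) (G.dirichletToNeumann m o)
      (G.traceMap m o (toDom hN v)) =
      ENNReal.ofReal (form v v - form (toDom hN v) (toDom hN v)) := by
  rw [diffOnDomain, traceForm_traceMap hN hD hG, if_pos ENNReal.ofReal_lt_top,
    dirichletToNeumann_traceMap hG, ← ENNReal.ofReal_sub _ (sq_nonneg _),
    norm_formHarmonicPart_sq_sub hN hD]

theorem dirichletToNeumann_le_traceForm :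
    G.dirichletToNeumann m o ≤ G.traceForm m o S.value := by
  intro φ
  rcases eq_top_or_lt_top (G.traceForm m o S.value φ) with h | h
  · exact h ▸ le_top
  obtain ⟨v, rfl⟩ := exists_traceMap_toDom_eq_of_traceForm_lt_top hN h
  rw [dirichletToNeumann_traceMap hG, traceForm_traceMap hN hD hG]
  refine ENNReal.ofReal_le_ofReal (sub_nonneg.1 ?_)
  rw [norm_formHarmonicPart_sq_sub hN hD, sub_nonneg]
  exact form_le_of_value_le (by rw [neumannForm_value]; exact hN _)

theorem isMarkovian_diffOnDomain_traceForm (hM : IsMarkovian S.value) :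
    IsMarkovian (diffOnDomain (G.traceForm m o S.value) (G.dirichletToNeumann m o)) := by
  intro C hC h0 φ
  by_cases h : G.traceForm m o S.value φ < ⊤
  · obtain ⟨v, rfl⟩ := exists_traceMap_toDom_eq_of_traceForm_lt_top hN h
    rw [← traceMap_comp, ← toDom_comp hN hM, diffOnDomain_traceForm_traceMap hN hD hG,
      diffOnDomain_traceForm_traceMap hN hD hG]
    exact ENNReal.ofReal_le_ofReal
      (by linarith [form_comp_add_form_toDom_le hN hD hM hC h0 v])
  · rw [← diffOnDomain_lt_top (q' := G.dirichletToNeumann m o), not_lt_top_iff] at h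
    exact h ▸ le_top

end TraceForm

theorem traceForm_mem_traceClass (hG : G.Connected) (o : X) {Q : Lp ℝ 2 m → ℝ≥0∞}
    (hQ : Q ∈ G.formClass m) :
    G.traceForm m o Q ∈ G.traceClass m o ∧ G.IsRepresentedBy m o Q (G.traceForm m o Q) := by
  obtain ⟨⟨⟨hclosed, hM⟩, -⟩, hN, hD⟩ := hQ
  obtain ⟨S, rfl⟩ := hclosed.1
  have := FormSpace.completeSpace hclosed
  exact ⟨⟨⟨isClosedForm_traceForm hN hD hG o, isMarkovian_traceForm hN hD hG o hM⟩,
    dirichletToNeumann_le_traceForm hN hD hG o, isMarkovian_diffOnDomain_traceForm hN hD hG o hM⟩,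
    isRepresentedBy_traceForm hN hD hG o⟩

end WGraph

/-! ### Forms with prescribed trace -/

namespace WGraph

open FormSpace

section Definition

variable {X : Type*} [MeasurableSpace X]

/-- The form `Q^(N)(f) + (q - q^{DN})(γf)`, the only candidate for a form with trace form `q`. -/
def formOfTrace (G : WGraph X) (m : Measure X) (o : X) (q : G.L2Boundary m o → ℝ≥0∞)
    (f : Lp ℝ 2 m) : ℝ≥0∞ :=
  G.neumann m f + diffOnDomain q (G.dirichletToNeumann m o) (G.trace m o f)

variable {G : WGraph X} {m : Measure X} {o : X} {q : G.L2Boundary m o → ℝ≥0∞}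

theorem formOfTrace_lt_top_iff {f : Lp ℝ 2 m} :
    G.formOfTrace m o q f < ⊤ ↔ G.neumann m f < ⊤ ∧ q (G.trace m o f) < ⊤ := by
  rw [formOfTrace, ENNReal.add_lt_top, diffOnDomain_lt_top]

theorem IsRepresentedBy.eq_formOfTrace {Q : Lp ℝ 2 m → ℝ≥0∞} (h : G.IsRepresentedBy m o Q q)
    (hle : G.dirichletToNeumann m o ≤ q) : Q = G.formOfTrace m o q := by
  funext f
  by_cases hf : Q f < ⊤
  · have hf' := (h.1 f).1 hf
    rw [(h.2 f hf).1, formOfTrace, diffOnDomain, if_pos hf'.2]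
    exact AddLECancellable.add_tsub_assoc_of_le
      (ENNReal.cancel_of_ne ((hle _).trans_lt hf'.2).ne) (hle _) _
  · have hf' : ¬ G.formOfTrace m o q f < ⊤ := by
      rw [formOfTrace_lt_top_iff, ← h.1]
      exact hf
    rw [not_lt_top_iff.1 hf, not_lt_top_iff.1 hf']

end Definition

variable {X : Type*} [MeasurableSpace X] [Countable X] [DiscreteMeasurableSpace X]
  {G : WGraph X} {m : Measure X} [PosFiniteAtoms m] {o : X}

section TraceGraph

variable (T : SymmPosForm (G.L2Boundary m o))

/-- The pairs `(u, φ)` in `D(Q^(N)) × D(T)` with `γu = φ`: the domain of `formOfTrace`, with a norm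
for which it is complete. -/
def traceGraph : Submodule ℝ (G.Dom m × FormSpace T) :=
  (G.traceMap m o ∘L ContinuousLinearMap.fst ℝ _ _ - incl ∘L ContinuousLinearMap.snd ℝ _ _).ker

instance [CompleteSpace (FormSpace T)] : CompleteSpace (traceGraph T) :=
  (ContinuousLinearMap.isClosed_ker _).completeSpace_coe

/-- The bilinear form of `formOfTrace`. -/
def traceGraphForm : traceGraph T →ₗ[ℝ] traceGraph T →ₗ[ℝ] ℝ :=
  let fst := LinearMap.fst ℝ (G.Dom m) (FormSpace T) ∘ₗ (traceGraph T).subtype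
  let snd := LinearMap.snd ℝ (G.Dom m) (FormSpace T) ∘ₗ (traceGraph T).subtype
  let harmonic := harmonicPart.toLinearMap ∘ₗ fst
  form.compl₁₂ fst fst + form.compl₁₂ snd snd - (innerₗ (G.Dom m)).compl₁₂ harmonic harmonic

variable {T}

theorem mem_traceGraph {p : G.Dom m × FormSpace T} :
    p ∈ traceGraph T ↔ G.traceMap m o p.1 = incl p.2 :=
  LinearMap.mem_ker.trans sub_eq_zero

theorem traceGraphForm_apply (p p' : traceGraph T) :
    traceGraphForm T p p' = form p.1.1 p'.1.1 + form p.1.2 p'.1.2 -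
      ⟪harmonicPart p.1.1, harmonicPart p'.1.1⟫ := rfl

theorem traceGraphForm_self (p : traceGraph T) :
    traceGraphForm T p p = form p.1.1 p.1.1 + (form p.1.2 p.1.2 - ‖harmonicPart p.1.1‖ ^ 2) := by
  rw [traceGraphForm_apply, real_inner_self_eq_norm_sq, add_sub_assoc]

theorem traceGraphForm_add_norm_sq (p : traceGraph T) :
    traceGraphForm T p p + ‖incl p.1.1‖ ^ 2 =
      ‖p.1.1 - harmonicPart p.1.1‖ ^ 2 + form p.1.2 p.1.2 := by
  rw [traceGraphForm_self]
  linarith [norm_sq_eq p.1.1, norm_sq_eq_add_harmonicPart p.1.1]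

variable (hG : G.Connected) (hle : G.dirichletToNeumann m o ≤ T.value)

include hG hle

theorem norm_harmonicPart_sq_le_form (p : traceGraph T) :
    ‖harmonicPart p.1.1‖ ^ 2 ≤ form p.1.2 p.1.2 := by
  have h := hle (G.traceMap m o p.1.1)
  rwa [dirichletToNeumann_traceMap hG, mem_traceGraph.1 p.2, value_incl,
    ENNReal.ofReal_le_ofReal_iff (form_self_nonneg _)] at h

theorem traceGraphForm_self_nonneg (p : traceGraph T) : 0 ≤ traceGraphForm T p p := by
  rw [traceGraphForm_self]
  exact add_nonneg (form_self_nonneg _) (sub_nonneg.2 (norm_harmonicPart_sq_le_form hG hle p))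

theorem formOfTrace_incl (p : traceGraph T) :
    G.formOfTrace m o T.value (incl p.1.1) = ENNReal.ofReal (traceGraphForm T p p) := by
  have hp : G.trace m o (incl p.1.1) = incl p.1.2 := mem_traceGraph.1 p.2
  have hDN : G.dirichletToNeumann m o (incl p.1.2) =
      ENNReal.ofReal (‖harmonicPart p.1.1‖ ^ 2) := by
    rw [← mem_traceGraph.1 p.2, dirichletToNeumann_traceMap hG]
  rw [formOfTrace, hp, diffOnDomain, if_pos (value_incl_lt_top _), hDN, value_incl,
    ← ENNReal.ofReal_sub _ (sq_nonneg _), ← neumannForm_value, value_incl, traceGraphForm_self,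
    ENNReal.ofReal_add (form_self_nonneg _)
      (sub_nonneg.2 (norm_harmonicPart_sq_le_form hG hle p))]

theorem norm_sq_le_traceGraphForm (p : traceGraph T) :
    ‖p‖ ^ 2 ≤ (G.green m o o + 2) * (traceGraphForm T p p + ‖incl p.1.1‖ ^ 2) := by
  have hgreen := green_self_nonneg (G := G) (m := m) o
  have hu : ‖p.1.1‖ ^ 2 ≤ traceGraphForm T p p + ‖incl p.1.1‖ ^ 2 := by
    rw [traceGraphForm_add_norm_sq, norm_sq_eq_add_harmonicPart]
    linarith [norm_harmonicPart_sq_le_form hG hle p]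
  have hφ : ‖p.1.2‖ ^ 2 ≤
      traceGraphForm T p p + ‖incl p.1.1‖ ^ 2 + (G.green m o o + 1) * ‖p.1.1‖ ^ 2 := by
    have htrace : ‖G.traceMap m o p.1.1‖ ^ 2 ≤ _ := norm_trace_sq_le o p.1.1
    rw [mem_traceGraph.1 p.2] at htrace
    rw [norm_sq_eq, traceGraphForm_add_norm_sq]
    linarith [sq_nonneg ‖p.1.1 - harmonicPart p.1.1‖]
  have hmul := mul_le_mul_of_nonneg_left hu (add_nonneg hgreen zero_le_one)
  rw [Submodule.coe_norm, Prod.norm_def]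
  rcases max_choice ‖p.1.1‖ ‖p.1.2‖ with h | h <;> rw [h]
  · linarith [mul_nonneg (add_nonneg hgreen zero_le_one) (sq_nonneg ‖p.1.1‖)]
  · linarith

theorem isClosedForm_formOfTrace (hT : IsClosedForm T.value) :
    IsClosedForm (G.formOfTrace m o T.value) := by
  have := FormSpace.completeSpace hT
  refine isClosedForm_of_parametrization
    ((incl ∘L ContinuousLinearMap.fst ℝ _ _) ∘L (traceGraph T).subtypeL) (traceGraphForm T)
    (G.green m o o + 2) (fun p p' => ?_) (traceGraphForm_self_nonneg hG hle) (fun p => ?_)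
    (norm_sq_le_traceGraphForm hG hle) (formOfTrace_incl hG hle) (fun f hf => ?_)
  · simp only [traceGraphForm_apply, form_comm p.1.1, form_comm p.1.2,
      real_inner_comm (harmonicPart p.1.1)]
  · have hu : ‖p.1.1‖ ^ 2 ≤ ‖p‖ ^ 2 :=
      pow_le_pow_left₀ (norm_nonneg _) (norm_fst_le p.1) 2
    have hφ : ‖p.1.2‖ ^ 2 ≤ ‖p‖ ^ 2 :=
      pow_le_pow_left₀ (norm_nonneg _) (norm_snd_le p.1) 2
    rw [traceGraphForm_self]
    linarith [norm_sq_eq p.1.1, norm_sq_eq p.1.2, sq_nonneg ‖incl p.1.1‖, sq_nonneg ‖incl p.1.2‖,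
      sq_nonneg ‖harmonicPart p.1.1‖,
      mul_nonneg (green_self_nonneg (G := G) (m := m) o) (sq_nonneg ‖p‖)]
  · obtain ⟨hN, hφ⟩ := formOfTrace_lt_top_iff.1 hf
    exact ⟨⟨(Dom.ofLp f hN, of _ hφ), mem_traceGraph.2 rfl⟩, rfl⟩

theorem traceForm_formOfTrace_value : G.traceForm m o (G.formOfTrace m o T.value) = T.value := by
  funext φ
  by_cases h : T.value φ < ⊤
  · obtain ⟨u, rfl⟩ := exists_traceMap_eq_of_dirichletToNeumann_lt_top ((hle φ).trans_lt h)
    let p : traceGraph T := ⟨(harmonicPart u, of _ h),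
      mem_traceGraph.2 (traceMap_harmonicPart o u)⟩
    have hone : one (G.formOfTrace m o T.value) (incl (harmonicPart u)) =
        ENNReal.ofReal (form p.1.2 p.1.2) := by
      rw [one, show incl (harmonicPart u) = incl p.1.1 from rfl, formOfTrace_incl hG hle,
        ← ENNReal.ofReal_add (traceGraphForm_self_nonneg hG hle p) (sq_nonneg _),
        traceGraphForm_add_norm_sq, harmonicPart_eq_self (harmonicPart_mem u), sub_self, norm_zero,
        zero_pow two_ne_zero, zero_add]
    rw [traceForm,
      if_pos ⟨incl u, formOfTrace_lt_top_iff.2 ⟨Dom.neumann_incl_lt_top u, h⟩, rfl⟩,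
      harmonicExtension_traceMap hG, hone, ← value_incl, incl_of]
  · rw [traceForm, if_neg, not_lt_top_iff.1 h]
    rintro ⟨f, hf, rfl⟩
    exact h (formOfTrace_lt_top_iff.1 hf).2

end TraceGraph

theorem isMarkovian_formOfTrace {q : G.L2Boundary m o → ℝ≥0∞}
    (hM : IsMarkovian (diffOnDomain q (G.dirichletToNeumann m o))) :
    IsMarkovian (G.formOfTrace m o q) := by
  intro C hC h0 f
  rcases eq_top_or_lt_top (G.neumann m f) with h | h
  · rw [formOfTrace, formOfTrace, h, top_add]
    exact le_top
  set u := Dom.ofLp f h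
  have hincl : hC.compLp h0 f = incl (Dom.comp hC h0 u) := by
    rw [Dom.incl_comp, Dom.incl_ofLp]
  have htrace : G.trace m o (hC.compLp h0 f) = hC.compLp h0 (G.trace m o f) := by
    rw [hincl, ← traceMap_apply, traceMap_comp, traceMap_ofLp]
  have henergy : G.neumann m (hC.compLp h0 f) ≤ G.neumann m f := by
    rw [neumann, funext (compLp_apply hC h0 f)]
    exact G.energy_mono (abs_grad_comp_le hC h0 f)
  rw [formOfTrace, formOfTrace, htrace]
  exact add_le_add henergy (hM C hC h0 _)

theorem formOfTrace_le_dirichlet (T : SymmPosForm (G.L2Boundary m o)) :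
    G.formOfTrace m o T.value ≤ G.dirichlet m := by
  intro f
  rcases eq_top_or_lt_top (G.dirichlet m f) with h | h
  · exact h ▸ le_top
  have hN := (neumann_le_dirichlet f).trans_lt h
  have htrace : G.trace m o f = 0 := by
    rw [← traceMap_ofLp o f hN]
    exact traceMap_eq_zero_of_mem o ((dirichlet_incl_lt_top_iff (Dom.ofLp f hN)).1 h)
  have hzero : T.value 0 = 0 := by
    simpa using value_incl (0 : FormSpace T)
  rw [formOfTrace, htrace, diffOnDomain, hzero, if_pos ENNReal.zero_lt_top, zero_tsub, add_zero]
  exact neumann_le_dirichlet f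

theorem dense_dirichlet_lt_top : Dense {f : Lp ℝ 2 m | G.dirichlet m f < ⊤} := by
  intro f
  refine mem_closure_of_tendsto (tendsto_lpRestrict f) (Eventually.of_forall fun s => ?_)
  have hincl : incl (Dom.restrict s f : G.Dom m) = lpRestrict m s f := by
    refine lp_ext fun x => ?_
    rw [incl_apply, Dom.restrict_apply, lpRestrict_apply]
  change G.dirichlet m (lpRestrict m s f) < ⊤
  rw [← hincl]
  exact (dirichlet_incl_lt_top_iff _).2 (restrict_mem_dirichletDomain s f)

theorem formOfTrace_mem_formClass (hG : G.Connected) {q : G.L2Boundary m o → ℝ≥0∞}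
    (hq : q ∈ G.traceClass m o) : G.formOfTrace m o q ∈ G.formClass m := by
  obtain ⟨⟨hclosed, -⟩, hle, hM⟩ := hq
  obtain ⟨T, rfl⟩ := hclosed.1
  exact ⟨⟨⟨isClosedForm_formOfTrace hG hle hclosed, isMarkovian_formOfTrace hM⟩,
    dense_dirichlet_lt_top.mono fun f => (formOfTrace_le_dirichlet T f).trans_lt⟩,
    fun f => le_self_add, formOfTrace_le_dirichlet T⟩

theorem traceForm_formOfTrace (hG : G.Connected) {q : G.L2Boundary m o → ℝ≥0∞}
    (hq : q ∈ G.traceClass m o) : G.traceForm m o (G.formOfTrace m o q) = q := by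
  obtain ⟨⟨⟨⟨T, rfl⟩, -⟩, -⟩, hle, -⟩ := hq
  exact traceForm_formOfTrace_value hG hle

theorem mem_formClass_iff (hG : G.Connected) (o : X) (Q : Lp ℝ 2 m → ℝ≥0∞) :
    Q ∈ G.formClass m ↔ ∃ q ∈ G.traceClass m o, G.IsRepresentedBy m o Q q := by
  constructor
  · exact fun hQ => ⟨_, traceForm_mem_traceClass hG o hQ⟩
  · rintro ⟨q, hq, h⟩
    rw [h.eq_formOfTrace hq.2.1]
    exact formOfTrace_mem_formClass hG hq

theorem bijOn_traceForm (hG : G.Connected) (o : X) :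
    Set.BijOn (G.traceForm m o) (G.formClass m) (G.traceClass m o) := by
  refine Set.BijOn.mk (fun Q hQ => (traceForm_mem_traceClass hG o hQ).1) (fun Q hQ Q' hQ' h => ?_)
    fun q hq => ⟨_, formOfTrace_mem_formClass hG hq, traceForm_formOfTrace hG hq⟩
  have eq_formOfTrace {Q} (hQ : Q ∈ G.formClass m) : Q = G.formOfTrace m o (G.traceForm m o Q) :=
    have ⟨htrace, hrep⟩ := traceForm_mem_traceClass hG o hQ
    hrep.eq_formOfTrace htrace.2.1
  rw [eq_formOfTrace hQ, eq_formOfTrace hQ', h]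

end WGraph

end GraphForms

end

theorem mainTheorem1_general {X : Type*} [Countable X] [MeasurableSpace X]
    [DiscreteMeasurableSpace X] (m : MeasureTheory.Measure X) (hm_pos : ∀ x, 0 < m {x})
    (hm_fin : ∀ x, m {x} < ⊤) (G : GraphForms.WGraph X) (hG : G.Connected) (o : X) :
    (∀ Q : MeasureTheory.Lp ℝ 2 m → ENNReal,
      Q ∈ G.formClass m ↔ ∃ q ∈ G.traceClass m o, G.IsRepresentedBy m o Q q) ∧
    (∀ Q ∈ G.formClass m,
      G.traceForm m o Q ∈ G.traceClass m o ∧ G.IsRepresentedBy m o Q (G.traceForm m o Q)) ∧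
    Set.BijOn (G.traceForm m o) (G.formClass m) (G.traceClass m o) := by
  have : GraphForms.PosFiniteAtoms m := ⟨hm_pos, hm_fin⟩
  exact ⟨GraphForms.WGraph.mem_formClass_iff hG o,
    fun Q hQ => GraphForms.WGraph.traceForm_mem_traceClass hG o hQ,
    GraphForms.WGraph.bijOn_traceForm hG o⟩

theorem mainTheorem1 {X : Type*} [Countable X] [MeasurableSpace X] [DiscreteMeasurableSpace X]
    (m : MeasureTheory.Measure X) (hm_pos : ∀ x, 0 < m {x}) (hm_fin : ∀ x, m {x} < ⊤)
    (G : GraphForms.WGraph X) (hG : G.Connected) (o : X) :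
    (∀ Q : MeasureTheory.Lp ℝ 2 m → ENNReal, GraphForms.IsClosedForm Q →
      (Q ∈ G.formClass m ↔ ∃ q ∈ G.traceClass m o, G.IsRepresentedBy m o Q q)) ∧
    (∀ Q ∈ G.formClass m,
      G.traceForm m o Q ∈ G.traceClass m o ∧ G.IsRepresentedBy m o Q (G.traceForm m o Q)) ∧
    Set.BijOn (G.traceForm m o) (G.formClass m) (G.traceClass m o) :=
  have h := mainTheorem1_general m hm_pos hm_fin G hG o
  ⟨fun Q _ => h.1 Q, h.2⟩
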